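/- **Setting.** For integers $a\le b$ let $G=G^{[a,b]}$ be a simple undirected graph (a similarity graph) on the observations labelled $a,\dots,b$. Write $|G|$ for its number of edges, $|G_i|$ for the number of edges containing node $i$ (the degree of $i$), and $|G_{i,2}|$ for the number of edges having at least one endpoint among the endpoints of the edges containing $i$; put $$V_G=\sum_{i=a}^{b}|G_i|^2-\frac{4|G|^2}{b-a+1}.$$ The permutation null distribution on $[a,b]$ gives probability $1/(b-a+1)!$ to each assignment of the $b-a+1$ observations to the times $a,\dots,b$, the graph on the observations being fixed. For a split point $t$ let $R_1(t)$ and $R_2(t)$ be the numbers of edges joining two observations both placed in $[a,t]$, respectively both placed in $[t+1,b]$. The generalized edge-count statistic is $$S^{[a,b]}(t)=\begin{pmatrix}R_1(t)-\mathbf E R_1(t)\\R_2(t)-\mathbf E R_2(t)\end{pmatrix}^{T}\Sigma(t)^{-1}\begin{pmatrix}R_1(t)-\mathbf E R_1(t)\\R_2(t)-\mathbf E R_2(t)\end{pmatrix},$$ where the expectation $\mathbf E$ and the covariance matrix $\Sigma(t)$ of $(R_1(t),R_2(t))^T$ are taken under the permutation null distribution on $[a,b]$. **Theorem.** Fix $m\ge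 1$. Along a sequence (index $n\to\infty$, suppressed in the notation) let $[a_j,b_j]$, $j=1,\dots,m$, be mutually disjoint intervals of integers, $t_j\in[a_j,b_j]$, and $G^{[a_j,b_j]}$ graphs as above which have at least one edge for all large $n$. Suppose that for each $j$, with $G=G^{[a_j,b_j]}$, one has $b_j-a_j\to\infty$, $$\frac{t_j-a_j}{b_j-a_j}\to u_j\in(0,1),\qquad \sum_{i=a_j}^{b_j}|G_i|^2=o\big(|G|^{3/2}\big),\qquad \sum_{i=a_j}^{b_j}|G_{i,2}|^2=o\big(|G|\,V_G\big),\qquad \sum_{i=a_j}^{b_j}|G_i|^3=o\big(V_G\sqrt{\min\{|G|,V_G\}}\big).$$ Then, when the observations of the $m$ intervals are permuted independently, each according to the permutation null distribution on its own interval, $$\sum_{j=1}^{m}S^{[a_j,b_j]}(t_j)\ \xrightarrow{d}\ \chi^2_{2m}.$$ In particular, let $\tilde m\ge1$ be fixed and let $1\le\tilde\tau_1<\dots<\tilde\tau_{\tilde m}\le N-1$ be (non-random) candidate change-points in a sequence of length $N$, both depending on $n$. Put $\tilde\eta_0=0$, $\tilde\eta_j=\lceil(\tilde\tau_j+\tilde\tau_{j+1})/2\rceil$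 for $1\le j<\tilde m$, $\tilde\eta_{\tilde m}=N$, and $$AS(\tilde{\boldsymbol\tau})=\sum_{j=1}^{\tilde m}S^{[\tilde\eta_{j-1}+1,\tilde\eta_j]}(\tilde\tau_j).$$ If the intervals $[\tilde\eta_{j-1}+1,\tilde\eta_j]$, the split points $\tilde\tau_j$ and the graphs on these intervals satisfy the above conditions (length tending to infinity, limit fraction in $(0,1)$, at least one edge for all large $n$, and the three degree conditions) for each $j=1,\dots,\tilde m$, then, under independent permutation null distributions on these intervals, $AS(\tilde{\boldsymbol\tau})\xrightarrow{d}\chi^2_{2\tilde m}$. -/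

import Mathlib

open MeasureTheory ProbabilityTheory Filter Topology Asymptotics

noncomputable section

namespace GraphCP

/-- The time points (equivalently, the labels of the observations) `a, a + 1, …, b`. -/
abbrev Seg (a b : ℕ) : Type := ↥(Finset.Icc a b)

/-- Permutations of a segment form a finite set, all of whose subsets are events. -/
instance instMeasurableSpacePermSeg (a b : ℕ) : MeasurableSpace (Equiv.Perm (Seg a b)) := ⊤

/-- The permutation null distribution on `[a, b]`: probability `1 / (b - a + 1)!` for each
permutation. A permutation `σ` places the observation with label `v` at time `σ v`. -/
abbrev permNull (a b : ℕ) : Measure (Equiv.Perm (Seg a b)) :=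
  (PMF.uniformOfFintype (Equiv.Perm (Seg a b))).toMeasure

section Graph

variable {a b : ℕ} (G : SimpleGraph (Seg a b))

/-- `|G|`, the number of edges. -/
def edgeCount : ℕ := G.edgeSet.ncard

/-- `|G_i|`, the number of edges that contain the node `i`. -/
def deg (i : Seg a b) : ℕ := (G.incidenceSet i).ncard

/-- `|G_{i,2}|`, the number of edges with at least one endpoint among the endpoints of the edges
that contain `i`. -/
def deg2 (i : Seg a b) : ℕ :=
  {e | e ∈ G.edgeSet ∧ ∃ v ∈ e, ∃ f ∈ G.incidenceSet i, v ∈ f}.ncard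

/-- `V_G = ∑ |G_i|² - 4 |G|² / (b - a + 1)`. -/
def degVar : ℝ :=
  ∑ i, (deg G i : ℝ) ^ 2 - 4 * (edgeCount G : ℝ) ^ 2 / ((b : ℝ) - (a : ℝ) + 1)

/-- The number of edges between observations placed at times in `[a, t]`. -/
def R1 (t : ℕ) (σ : Equiv.Perm (Seg a b)) : ℕ :=
  {e | e ∈ G.edgeSet ∧ ∀ v ∈ e, (σ v : ℕ) ≤ t}.ncard

/-- The number of edges between observations placed at times in `[t + 1, b]`. -/
def R2 (t : ℕ) (σ : Equiv.Perm (Seg a b)) : ℕ :=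
  {e | e ∈ G.edgeSet ∧ ∀ v ∈ e, t < (σ v : ℕ)}.ncard

/-- The random vector `(R₁(t), R₂(t))`. -/
def R (t : ℕ) (i : Fin 2) (σ : Equiv.Perm (Seg a b)) : ℝ :=
  ![(R1 G t σ : ℝ), (R2 G t σ : ℝ)] i

/-- The covariance matrix of `(R₁(t), R₂(t))` under the permutation null distribution. -/
def covMatrix (t : ℕ) : Matrix (Fin 2) (Fin 2) ℝ :=
  Matrix.of fun i k => covariance (R G t i) (R G t k) (permNull a b)

/-- `(R₁(t), R₂(t))` minus its expectation under the permutation null distribution. -/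
def centered (t : ℕ) (σ : Equiv.Perm (Seg a b)) : Fin 2 → ℝ :=
  fun i => R G t i σ - ∫ ρ, R G t i ρ ∂(permNull a b)

/-- The generalized edge-count statistic `S^{[a,b]}(t)`, for the ordering of the observations
given by `σ` (the observed ordering is `σ = 1`). -/
def S (t : ℕ) (σ : Equiv.Perm (Seg a b)) : ℝ :=
  centered G t σ ⬝ᵥ Matrix.mulVec (covMatrix G t)⁻¹ (centered G t σ)

end Graph

/-- The assumptions on one interval: along a sequence of intervals `[a n, b n]` whose length tends
to infinity, the split points `t n` sit asymptotically at the fraction `u ∈ (0,1)` of the interval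
and the graphs `G n` satisfy the degree-moment conditions. The graphs eventually have an edge, so
that the `o(·)` conditions do not hold in the form `0 = o(0)`. -/
structure Regime (a b t : ℕ → ℕ) (G : ∀ n, SimpleGraph (Seg (a n) (b n))) (u : ℝ) : Prop where
  length : Tendsto (fun n => (b n : ℝ) - (a n : ℝ)) atTop atTop
  pos : 0 < u
  lt_one : u < 1
  split : Tendsto (fun n => ((t n : ℝ) - (a n : ℝ)) / ((b n : ℝ) - (a n : ℝ))) atTop (𝓝 u)
  nonempty : ∀ᶠ n in atTop, 0 < edgeCount (G n)
  sq : (fun n => ∑ i, (deg (G n) i : ℝ) ^ 2) =o[atTop]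
    fun n => (edgeCount (G n) : ℝ) ^ (3 / 2 : ℝ)
  sq_two : (fun n => ∑ i, (deg2 (G n) i : ℝ) ^ 2) =o[atTop]
    fun n => (edgeCount (G n) : ℝ) * degVar (G n)
  cube : (fun n => ∑ i, (deg (G n) i : ℝ) ^ 3) =o[atTop]
    fun n => degVar (G n) * √(min (edgeCount (G n) : ℝ) (degVar (G n)))

/-- The group of permutation null distributions: independent uniform permutations of the
intervals `[a j, b j]`. -/
abbrev permNulls {m : ℕ} (a b : Fin m → ℕ) : Measure (∀ j, Equiv.Perm (Seg (a j) (b j))) :=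
  Measure.pi fun j => permNull (a j) (b j)

/-- `∑ j, S^{[a_j,b_j]}(t_j)`. -/
def sumS {m : ℕ} {a b : Fin m → ℕ} (t : Fin m → ℕ) (G : ∀ j, SimpleGraph (Seg (a j) (b j)))
    (σ : ∀ j, Equiv.Perm (Seg (a j) (b j))) : ℝ :=
  ∑ j, S (G j) (t j) (σ j)

/-- The boundary points `η_0 = 0`, `η_k = ⌈(τ_k + τ_{k+1}) / 2⌉` for `1 ≤ k < m`, `η_m = N` of
candidate change-points `τ_1 < ⋯ < τ_m` in a sequence of length `N`. Here `τ_k` is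
`τ ⟨k - 1, _⟩`, and `⌈/⌉` is division rounded up. -/
def eta {m : ℕ} (N : ℕ) (τ : Fin m → ℕ) (k : ℕ) : ℕ :=
  if k = 0 then 0
  else if h : k < m then (τ ⟨k - 1, by omega⟩ + τ ⟨k, h⟩) ⌈/⌉ 2
  else N

/-- The left end `η_{j-1} + 1` of the interval that belongs to the `j`-th candidate. -/
def left {m : ℕ} (N : ℕ) (τ : Fin m → ℕ) (j : Fin m) : ℕ := eta N τ j + 1

/-- The right end `η_j` of the interval that belongs to the `j`-th candidate. -/
def right {m : ℕ} (N : ℕ) (τ : Fin m → ℕ) (j : Fin m) : ℕ := eta N τ (j + 1)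

/-- The adjacent-sum statistic `AS(τ) = ∑ j, S^{[η_{j-1}+1, η_j]}(τ_j)`. -/
def AS {m : ℕ} (N : ℕ) (τ : Fin m → ℕ)
    (G : ∀ j, SimpleGraph (Seg (left N τ j) (right N τ j)))
    (σ : ∀ j, Equiv.Perm (Seg (left N τ j) (right N τ j))) : ℝ :=
  ∑ j, S (G j) (τ j) (σ j)

/-- The chi-squared distribution with `k` degrees of freedom: the law of the sum of the squares of
`k` independent standard normal variables. -/
def chiSquared (k : ℕ) : Measure ℝ :=
  (Measure.pi fun _ : Fin k => gaussianReal 0 1).map fun x => ∑ i, x i ^ 2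

instance instIsProbabilityMeasureChiSquared (k : ℕ) : IsProbabilityMeasure (chiSquared k) :=
  Measure.isProbabilityMeasure_map
    (by exact Measurable.aemeasurable (by fun_prop))

end GraphCP

end

/-! Let `p` be the fraction of times up to `t`, and let `ξ_i` be the indicator that observation `i`
is placed at a time up to `t`, minus `p`. Since `∑ ξ_i = 0` under the permutation law, `(R₁, R₂)` is
an invertible affine image of two statistics: the linear one `∑ cdeg_i ξ_i`, with centred degrees,
and the quadratic one `∑ A_ij ξ_i ξ_j`, with `A` the adjacency matrix. `S` does not change under
such maps (`exists_R_eq`, `S_eq_of_affine`), so it is enough to study these two, standardized as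
`zstat`.

If the observations are selected independently with probability `p` instead, the two statistics are
centred, uncorrelated and of unit variance. A combination `W` of them is a polynomial of degree two
in independent variables. Stein's method, applied to its characteristic function `φ`, shows that
`φ'(t) ≈ -t v φ(t)`, with an explicit error (`norm_charFun_quadForm_sub_le`,
`IsAdj.norm_charFun_sub_le`). The degree conditions are what makes this error vanish: `|G_{i,2}|`
controls the interaction of the linear and the quadratic part, `|G_i|³` the third moments of the
linear part, and `|G_i|²` the quadratic part.

The passage to permutations is a coupling. Take a uniform permutation `σ` and an independent
binomial `K`: the observations that `σ` places at the first `K` times form an independent selection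
(`jexp_pre`), while those at the first `k₀ = t + 1 - a` times form the permutation selection. As `K
- k₀` has order `√N`, with `N` the number of observations, both statistics move by `o(1)` in mean
square (`gap_linear_le`, `gap_quadratic_le`). For the linear one this needs coefficients of sum
zero; for the quadratic one it follows from exchangeability.

Hence under permutation the covariance matrix tends to the identity, the characteristic functions
tend to the Gaussian one, and `S` differs by `o(1)` in mean from a sum of two squares of
asymptotically independent standard normals. For `m` independent intervals the characteristic
functions multiply, which gives `χ²_{2m}`. -/

noncomputable section

namespace GraphCP

set_option linter.unusedSectionVars false

/-! ### Moments of linear and bilinear forms in independent centred Bernoulli variables. -/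

section Bernoulli

variable {V : Type*} [Fintype V] [DecidableEq V]
variable {E : Type*} [NormedAddCommGroup E] [NormedSpace ℝ E]

/-- The weight of the set `s` when each element of `V` is selected independently with
probability `p`. -/
def bweight (p : ℝ) (s : Finset V) : ℝ := p ^ s.card * (1 - p) ^ (Fintype.card V - s.card)

/-- The expectation of `F s`, where `s` contains each element of `V` independently with
probability `p`. -/
def bexp (p : ℝ) (F : Finset V → E) : E := ∑ s, bweight p s • F s

/-- The centred indicator of `i ∈ s`. -/
def xi (p : ℝ) (s : Finset V) (i : V) : ℝ := (if i ∈ s then 1 else 0) - p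

/-- `g s` does not depend on whether `i` is in `s`. -/
def FreeOf {β : Type*} (i : V) (g : Finset V → β) : Prop := ∀ s, i ∉ s → g (insert i s) = g s

lemma bweight_nonneg {p : ℝ} (h0 : 0 ≤ p) (h1 : p ≤ 1) (s : Finset V) : 0 ≤ bweight p s :=
  mul_nonneg (pow_nonneg h0 _) (pow_nonneg (sub_nonneg.2 h1) _)

lemma sum_bweight (p : ℝ) : ∑ s : Finset V, bweight p s = 1 := by
  have := Fintype.sum_pow_mul_eq_add_pow V p (1 - p)
  simpa [bweight] using this

lemma bexp_const (p : ℝ) (c : E) : bexp (V := V) p (fun _ => c) = c := by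
  rw [bexp, ← Finset.sum_smul, sum_bweight, one_smul]

lemma bexp_add (p : ℝ) (F G : Finset V → E) :
    bexp p (fun s => F s + G s) = bexp p F + bexp p G := by
  simp [bexp, Finset.sum_add_distrib]

lemma bexp_sub (p : ℝ) (F G : Finset V → E) :
    bexp p (fun s => F s - G s) = bexp p F - bexp p G := by
  simp [bexp, smul_sub, Finset.sum_sub_distrib]

lemma bexp_sum {ι : Type*} (p : ℝ) (I : Finset ι) (F : ι → Finset V → E) :
    bexp p (fun s => ∑ i ∈ I, F i s) = ∑ i ∈ I, bexp p (F i) := by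
  simp only [bexp, Finset.smul_sum]
  exact Finset.sum_comm

lemma bexp_smul (p c : ℝ) (F : Finset V → E) :
    bexp p (fun s => c • F s) = c • bexp p F := by
  simp only [bexp, Finset.smul_sum]
  exact Finset.sum_congr rfl fun s _ => smul_comm _ _ _

lemma bexp_mul_left (p c : ℝ) (F : Finset V → ℝ) :
    bexp p (fun s => c * F s) = c * bexp p F := bexp_smul p c F

lemma bexp_cmul_left (p : ℝ) (c : ℂ) (F : Finset V → ℂ) :
    bexp p (fun s => c * F s) = c * bexp p F := by
  simp only [bexp, Finset.mul_sum, mul_smul_comm]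

lemma bexp_mono {p : ℝ} (h0 : 0 ≤ p) (h1 : p ≤ 1) {F G : Finset V → ℝ} (h : ∀ s, F s ≤ G s) :
    bexp p F ≤ bexp p G :=
  Finset.sum_le_sum fun s _ => mul_le_mul_of_nonneg_left (h s) (bweight_nonneg h0 h1 s)

lemma bexp_nonneg {p : ℝ} (h0 : 0 ≤ p) (h1 : p ≤ 1) {F : Finset V → ℝ} (h : ∀ s, 0 ≤ F s) :
    0 ≤ bexp p F :=
  Finset.sum_nonneg fun s _ => mul_nonneg (bweight_nonneg h0 h1 s) (h s)

lemma norm_bexp_le {p : ℝ} (h0 : 0 ≤ p) (h1 : p ≤ 1) (F : Finset V → E) :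
    ‖bexp p F‖ ≤ bexp p (fun s => ‖F s‖) := by
  refine (norm_sum_le _ _).trans (Finset.sum_le_sum fun s _ => ?_)
  rw [norm_smul, Real.norm_of_nonneg (bweight_nonneg h0 h1 s), smul_eq_mul]

lemma bexp_sq_le {p : ℝ} (h0 : 0 ≤ p) (h1 : p ≤ 1) (F : Finset V → ℝ) :
    bexp p F ^ 2 ≤ bexp p (fun s => F s ^ 2) := by
  have h : 0 ≤ bexp p (fun s => (F s - bexp p F) ^ 2) := bexp_nonneg h0 h1 fun s => sq_nonneg _
  have e : bexp p (fun s => (F s - bexp p F) ^ 2) = bexp p (fun s => F s ^ 2) - bexp p F ^ 2 := by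
    have : (fun s => (F s - bexp p F) ^ 2) =
        fun s => (F s ^ 2 - (2 * bexp p F) * F s) + bexp p F ^ 2 := by
      funext s; ring
    rw [this, bexp_add, bexp_sub, bexp_mul_left, bexp_const]
    ring
  linarith

lemma bexp_abs_le_sqrt {p : ℝ} (h0 : 0 ≤ p) (h1 : p ≤ 1) (F : Finset V → ℝ) :
    bexp p (fun s => |F s|) ≤ √(bexp p (fun s => F s ^ 2)) := by
  refine Real.le_sqrt_of_sq_le ?_
  simpa using bexp_sq_le h0 h1 (fun s => |F s|)

lemma sum_finset_split (i : V) (f : Finset V → E) :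
    ∑ s, f s = ∑ s with i ∉ s, (f s + f (insert i s)) := by
  rw [Finset.sum_add_distrib, ← Finset.sum_filter_add_sum_filter_not _ (fun s => i ∉ s) f]
  congr 1
  refine Finset.sum_nbij' (fun s => s.erase i) (fun s => insert i s) ?_ ?_ ?_ ?_ ?_
  all_goals simp +contextual [Finset.insert_erase]

/-- The coordinate `i` is independent of any function free of it: pairing `s` with `insert i s`
factors the weight. The case `a = b = 1` identifies the remaining sum with `bexp p g`. -/
lemma bexp_free (p : ℝ) (i : V) (a b : ℝ) {g : Finset V → E} (hg : FreeOf i g) :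
    bexp p (fun s => (if i ∈ s then a else b) • g s) = (p * a + (1 - p) * b) • bexp p g := by
  have key : ∀ a b : ℝ, bexp p (fun s => (if i ∈ s then a else b) • g s) =
      (p * a + (1 - p) * b) •
        ∑ s with i ∉ s, (p ^ s.card * (1 - p) ^ (Fintype.card V - 1 - s.card)) • g s := by
    intro a b
    rw [bexp, sum_finset_split i, Finset.smul_sum]
    refine Finset.sum_congr rfl fun s hs => ?_
    have hs : i ∉ s := by simpa using hs
    have hc : s.card + 1 ≤ Fintype.card V := by
      rw [← Finset.card_insert_of_notMem hs]; exact Finset.card_le_univ _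
    obtain ⟨r, hr⟩ := Nat.exists_eq_add_of_le hc
    simp only [hs, if_false, Finset.mem_insert_self, if_true, hg s hs, bweight,
      Finset.card_insert_of_notMem hs, smul_smul, ← add_smul, hr]
    congr 1
    have e1 : s.card + 1 + r - s.card = r + 1 := by omega
    have e2 : s.card + 1 + r - (s.card + 1) = r := by omega
    have e3 : s.card + 1 + r - 1 - s.card = r := by omega
    rw [e1, e2, e3]; ring
  have h1 := key 1 1
  simp only [ite_self, one_smul, mul_one, add_sub_cancel] at h1
  rw [key, show bexp p g = _ from h1]

lemma bexp_xi_smul (p : ℝ) (i : V) {g : Finset V → E} (hg : FreeOf i g) :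
    bexp p (fun s => xi p s i • g s) = 0 := by
  have h := bexp_free p i (1 - p) (0 - p) hg
  have e : (fun s => xi p s i • g s) = fun s => (if i ∈ s then 1 - p else 0 - p) • g s := by
    funext s; unfold xi; split_ifs <;> rfl
  rw [e, h, show p * (1 - p) + (1 - p) * (0 - p) = 0 by ring, zero_smul]

lemma bexp_xi_sq_smul (p : ℝ) (i : V) {g : Finset V → E} (hg : FreeOf i g) :
    bexp p (fun s => xi p s i ^ 2 • g s) = (p * (1 - p)) • bexp p g := by
  have h := bexp_free p i ((1 - p) ^ 2) ((0 - p) ^ 2) hg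
  have e : (fun s => xi p s i ^ 2 • g s) =
      fun s => (if i ∈ s then (1 - p) ^ 2 else (0 - p) ^ 2) • g s := by
    funext s; unfold xi; split_ifs <;> rfl
  rw [e, h]
  congr 1; ring

lemma xi_sq (p : ℝ) (s : Finset V) (i : V) :
    xi p s i ^ 2 = p * (1 - p) + (1 - 2 * p) * xi p s i := by
  unfold xi; split_ifs <;> ring

lemma abs_xi_le {p : ℝ} (h0 : 0 ≤ p) (h1 : p ≤ 1) (s : Finset V) (i : V) : |xi p s i| ≤ 1 := by
  unfold xi; split_ifs <;> rw [abs_le] <;> constructor <;> linarith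

lemma xi_insert_of_ne (p : ℝ) {i j : V} (h : j ≠ i) (s : Finset V) :
    xi p (insert i s) j = xi p s j := by
  simp [xi, h]

lemma freeOf_xi (p : ℝ) {i j : V} (h : j ≠ i) : FreeOf i (fun s => xi p s j) :=
  fun s _ => xi_insert_of_ne p h s

lemma bexp_xi (p : ℝ) (i : V) : bexp p (fun s => xi p s i) = 0 := by
  simpa using bexp_xi_smul p i (g := fun _ => (1 : ℝ)) (fun _ _ => rfl)

lemma bexp_xi_mul_xi (p : ℝ) (i j : V) :
    bexp p (fun s => xi p s i * xi p s j) = if i = j then p * (1 - p) else 0 := by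
  split_ifs with h
  · subst h
    have := bexp_xi_sq_smul p i (g := fun _ => (1 : ℝ)) (fun _ _ => rfl)
    simpa [bexp_const, sq] using this
  · simpa using bexp_xi_smul p i (freeOf_xi p (Ne.symm h))

/-- Some index occurs exactly once, namely `k` if `i = j` and `j` otherwise, and its factor averages
to zero. This is why linear and off-diagonal bilinear forms are uncorrelated. -/
lemma bexp_xi_mul_xi_mul_xi (p : ℝ) {i j k : V} (hjk : j ≠ k) :
    bexp p (fun s => xi p s i * (xi p s j * xi p s k)) = 0 := by
  by_cases hj : i = j
  · subst hj
    have := bexp_xi_smul p k (g := fun s => xi p s i * xi p s i)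
      (fun s hs => by simp only [xi_insert_of_ne p hjk])
    rw [← this]; congr 1; funext s; rw [smul_eq_mul]; ring
  · have := bexp_xi_smul p j (g := fun s => xi p s i * xi p s k)
      (fun s hs => by simp only [xi_insert_of_ne p hj, xi_insert_of_ne p (Ne.symm hjk)])
    rw [← this]; congr 1; funext s; rw [smul_eq_mul]; ring

/-- A product survives only if every index occurs twice. For two off-diagonal pairs this means that
they agree up to order, and at most one of the two orders can match. -/
lemma bexp_xi_four (p : ℝ) {i j k l : V} (hij : i ≠ j) (hkl : k ≠ l) :
    bexp p (fun s => (xi p s i * xi p s j) * (xi p s k * xi p s l)) =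
      (p * (1 - p)) ^ 2 * ((if i = k ∧ j = l then 1 else 0) + (if i = l ∧ j = k then 1 else 0)) := by
  have two : ∀ i j : V, i ≠ j →
      bexp p (fun s => (xi p s i * xi p s j) * (xi p s i * xi p s j)) = (p * (1 - p)) ^ 2 := by
    intro i j hij
    have h1 := bexp_xi_sq_smul p i (g := fun s => xi p s j * xi p s j)
      (fun s hs => by simp only [xi_insert_of_ne p hij.symm])
    rw [bexp_xi_mul_xi, if_pos rfl] at h1
    rw [sq (p * (1 - p)), ← smul_eq_mul (p * (1 - p)), ← h1]
    congr 1; funext s; rw [smul_eq_mul]; ring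
  have single : ∀ a b c d : V, b ≠ a → c ≠ a → d ≠ a →
      bexp p (fun s => (xi p s a * xi p s b) * (xi p s c * xi p s d)) = 0 := by
    intro a b c d hb hc hd
    have := bexp_xi_smul p a (g := fun s => xi p s b * (xi p s c * xi p s d))
      (fun s hs => by simp only [xi_insert_of_ne p hb, xi_insert_of_ne p hc, xi_insert_of_ne p hd])
    rw [← this]; congr 1; funext s; rw [smul_eq_mul]; ring
  by_cases h1 : i = k
  · subst h1
    by_cases h2 : j = l
    · subst h2
      simp [two i j hij, hij]
    · have := single j i l i hij (Ne.symm h2) hij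
      simp only [h2, and_false, if_false, hkl, false_and, add_zero, mul_zero]
      rw [← this]; congr 1; funext s; ring
  · by_cases h2 : i = l
    · subst h2
      by_cases h3 : j = k
      · subst h3
        simp only [h1, false_and, if_false, and_self, if_true, zero_add, mul_one]
        rw [← two i j hij]; congr 1; funext s; ring
      · have := single j i k i hij (Ne.symm h3) hij
        simp only [h1, h3, and_false, if_false, false_and, add_zero, mul_zero]
        rw [← this]; congr 1; funext s; ring
    · have := single i j k l hij.symm (Ne.symm h1) (Ne.symm h2)
      simpa [h1, h2] using this

lemma bexp_linear_sq (p : ℝ) (a : V → ℝ) :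
    bexp p (fun s => (∑ i, a i * xi p s i) ^ 2) = p * (1 - p) * ∑ i, a i ^ 2 := by
  have : (fun s => (∑ i, a i * xi p s i) ^ 2) =
      fun s => ∑ i, ∑ j, (a i * a j) * (xi p s i * xi p s j) := by
    funext s
    rw [sq, Finset.sum_mul_sum]
    exact Finset.sum_congr rfl fun i _ => Finset.sum_congr rfl fun j _ => by ring
  rw [this, bexp_sum, Finset.mul_sum]
  refine Finset.sum_congr rfl fun i _ => ?_
  rw [bexp_sum]
  simp only [bexp_mul_left, bexp_xi_mul_xi, mul_ite, mul_zero]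
  simp; ring

lemma bexp_linear_mul_bilinear (p : ℝ) (a : V → ℝ) (M : V → V → ℝ) (hM : ∀ i, M i i = 0) :
    bexp p (fun s => (∑ i, a i * xi p s i) * ∑ j, ∑ k, M j k * (xi p s j * xi p s k)) = 0 := by
  have : (fun s => (∑ i, a i * xi p s i) * ∑ j, ∑ k, M j k * (xi p s j * xi p s k)) =
      fun s => ∑ i, ∑ j, ∑ k, (a i * M j k) * (xi p s i * (xi p s j * xi p s k)) := by
    funext s
    rw [Finset.sum_mul_sum]
    refine Finset.sum_congr rfl fun i _ => Finset.sum_congr rfl fun j _ => ?_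
    rw [Finset.mul_sum]
    exact Finset.sum_congr rfl fun k _ => by ring
  rw [this, bexp_sum]
  refine Finset.sum_eq_zero fun i _ => ?_
  rw [bexp_sum]
  refine Finset.sum_eq_zero fun j _ => ?_
  rw [bexp_sum]
  refine Finset.sum_eq_zero fun k _ => ?_
  rw [bexp_mul_left]
  by_cases h : j = k
  · simp [h, hM]
  · rw [bexp_xi_mul_xi_mul_xi p h, mul_zero]

lemma bexp_bilinear (p : ℝ) (M : V → V → ℝ) (hM : ∀ i, M i i = 0) :
    bexp p (fun s => ∑ j, ∑ k, M j k * (xi p s j * xi p s k)) = 0 := by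
  rw [bexp_sum]
  refine Finset.sum_eq_zero fun j _ => ?_
  rw [bexp_sum]
  refine Finset.sum_eq_zero fun k _ => ?_
  rw [bexp_mul_left, bexp_xi_mul_xi]
  split_ifs with h
  · simp [h, hM]
  · simp

/-- The pair `(i, j)` is matched by itself and by `(j, i)`. `M` need not be symmetric, hence the
factor `M i j + M j i`. -/
lemma bexp_bilinear_sq (p : ℝ) (M : V → V → ℝ) (hM : ∀ i, M i i = 0) :
    bexp p (fun s => (∑ i, ∑ j, M i j * (xi p s i * xi p s j)) ^ 2) =
      (p * (1 - p)) ^ 2 * ∑ i, ∑ j, M i j * (M i j + M j i) := by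
  have : (fun s => (∑ i, ∑ j, M i j * (xi p s i * xi p s j)) ^ 2) =
      fun s => ∑ i, ∑ j, ∑ k, ∑ l, (M i j * M k l) *
        ((xi p s i * xi p s j) * (xi p s k * xi p s l)) := by
    funext s
    rw [sq, Finset.sum_mul]
    refine Finset.sum_congr rfl fun i _ => ?_
    rw [Finset.sum_mul]
    refine Finset.sum_congr rfl fun j _ => ?_
    rw [Finset.mul_sum]
    refine Finset.sum_congr rfl fun k _ => ?_
    rw [Finset.mul_sum]
    exact Finset.sum_congr rfl fun l _ => by ring
  rw [this, bexp_sum, Finset.mul_sum]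
  refine Finset.sum_congr rfl fun i _ => ?_
  rw [bexp_sum, Finset.mul_sum]
  refine Finset.sum_congr rfl fun j _ => ?_
  have h4 : ∀ k l, bexp p (fun s => (M i j * M k l) *
        ((xi p s i * xi p s j) * (xi p s k * xi p s l))) = (p * (1 - p)) ^ 2 * (M i j *
        ((if i = k then if j = l then M k l else 0 else 0) +
          (if i = l then if j = k then M k l else 0 else 0))) := by
    intro k l
    rw [bexp_mul_left]
    by_cases hij : i = j
    · simp [hij, hM]
    by_cases hkl : k = l
    · simp [hkl, hM]
    rw [bexp_xi_four p hij hkl]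
    split_ifs <;> simp_all <;> ring
  rw [bexp_sum]
  simp only [bexp_sum, h4, ← Finset.mul_sum, Finset.sum_add_distrib]
  congr 2
  congr 1
  · rw [Finset.sum_eq_single i] <;> simp +contextual [eq_comm]
  · rw [Finset.sum_eq_single j]
    · simp
    · intro k _ hk
      refine Finset.sum_eq_zero fun l _ => ?_
      simp [hk.symm]
    · simp

end Bernoulli

/-! ### Stein's method for characteristic functions of polynomials of degree two. -/

section Stein

open Complex

variable {V : Type*} [Fintype V] [DecidableEq V]

lemma norm_exp_mul_I_sub_one_le (x : ℝ) : ‖cexp (x * I) - 1‖ ≤ |x| := by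
  have := Real.norm_exp_I_mul_ofReal_sub_one_le (x := x)
  rwa [mul_comm, Real.norm_eq_abs] at this

/-- The constant `2` makes one bound serve all `x`: for `|x| > 1` the trivial estimate `2|x|` is
already below `2x²`. -/
lemma norm_exp_mul_I_sub_one_sub_le (x : ℝ) : ‖cexp (x * I) - 1 - x * I‖ ≤ 2 * x ^ 2 := by
  have hn : ‖(x : ℂ) * I‖ = |x| := by simp
  by_cases h : |x| ≤ 1
  · have := Complex.norm_exp_sub_one_sub_id_le (x := (x : ℂ) * I) (by rw [hn]; exact h)
    rw [hn, sq_abs] at this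
    nlinarith [sq_nonneg x]
  · have h3 : ‖cexp (x * I) - 1 - x * I‖ ≤ ‖cexp (x * I) - 1‖ + ‖(x : ℂ) * I‖ := norm_sub_le _ _
    have h4 := norm_exp_mul_I_sub_one_le x
    rw [hn] at h3
    rw [← sq_abs]
    nlinarith

/-- One coordinate of the Stein expansion of `E[ξ_i g exp(i s W)]`, where `W = W₀ + ξ_i D` and
`W₀`, `D`, `g` do not depend on the coordinate `i`. -/
lemma norm_stein_coord_le {p : ℝ} (h0 : 0 ≤ p) (h1 : p ≤ 1) (i : V) (t : ℝ)
    {W₀ D g W : Finset V → ℝ} (hW₀ : FreeOf i W₀) (hD : FreeOf i D) (hg : FreeOf i g)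
    (hW : ∀ s, W s = W₀ s + xi p s i * D s) :
    ‖bexp p (fun s => ((xi p s i * g s : ℝ) : ℂ) * cexp ((t * W s : ℝ) * I)) -
      t * I * bexp p (fun s => ((p * (1 - p) * (g s * D s) : ℝ) : ℂ) * cexp ((t * W s : ℝ) * I))‖
      ≤ 3 * t ^ 2 * bexp p (fun s => |g s| * D s ^ 2) := by
  set e : Finset V → ℂ := fun s => cexp ((t * W s : ℝ) * I) with he
  set e₀ : Finset V → ℂ := fun s => cexp ((t * W₀ s : ℝ) * I) with he₀
  have hfe : FreeOf i e₀ := fun s hs => by simp only [he₀, hW₀ s hs]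
  have z1 : bexp p (fun s => xi p s i • (((g s : ℝ) : ℂ) * e₀ s)) = 0 :=
    bexp_xi_smul p i fun s hs => by simp only [hg s hs, hfe s hs]
  have z2 : bexp p (fun s => xi p s i ^ 2 • ((t * I) * (((g s * D s : ℝ) : ℂ) * e₀ s))) =
      (p * (1 - p)) • ((t * I) * bexp p (fun s => ((g s * D s : ℝ) : ℂ) * e₀ s)) := by
    rw [bexp_xi_sq_smul p i fun s hs => by simp only [hg s hs, hD s hs, hfe s hs],
      bexp_cmul_left]
  have hee : ∀ s, e s = e₀ s * cexp ((t * (xi p s i * D s) : ℝ) * I) := by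
    intro s
    simp only [he, he₀, ← Complex.exp_add, hW]
    congr 1; push_cast; ring
  have hn : ∀ s, ‖e₀ s‖ = 1 := fun s => Complex.norm_exp_ofReal_mul_I _
  have hpq : |p * (1 - p)| ≤ 1 := by
    rw [abs_of_nonneg (mul_nonneg h0 (by linarith))]; nlinarith
  -- With `e₀` in place of `e`, the zeroth-order term has mean zero and `ξ_i²` may be replaced by
  -- its mean `p(1-p)`, so the first-order terms cancel. What remains is the second-order remainder
  -- of `e` (constant 2) and the error of replacing `e` by `e₀` in the subtracted term (constant 1);
  -- together they give the factor 3.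
  have key : bexp p (fun s => ((xi p s i * g s : ℝ) : ℂ) * e s) -
      t * I * bexp p (fun s => ((p * (1 - p) * (g s * D s) : ℝ) : ℂ) * e s) =
      bexp p (fun s => ((xi p s i * g s : ℝ) : ℂ) * e₀ s *
          (cexp ((t * (xi p s i * D s) : ℝ) * I) - 1 - (t * (xi p s i * D s) : ℝ) * I) -
        (t * I) * (((p * (1 - p) * (g s * D s) : ℝ) : ℂ) * (e₀ s *
          (cexp ((t * (xi p s i * D s) : ℝ) * I) - 1)))) := by
    rw [← bexp_cmul_left, ← bexp_sub]
    have z3 : bexp p (fun s => xi p s i • (((g s : ℝ) : ℂ) * e₀ s) +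
        (xi p s i ^ 2 • ((t * I) * (((g s * D s : ℝ) : ℂ) * e₀ s)) -
        (p * (1 - p)) • ((t * I) * (((g s * D s : ℝ) : ℂ) * e₀ s)))) = 0 := by
      rw [bexp_add, bexp_sub, z1, z2, bexp_smul, bexp_cmul_left, sub_self, zero_add]
    rw [← sub_eq_zero, ← bexp_sub, ← z3]
    congr 1; funext s
    rw [hee]
    simp only [real_smul]
    push_cast
    ring
  rw [key, ← bexp_mul_left]
  refine (norm_bexp_le h0 h1 _).trans (bexp_mono h0 h1 fun s => ?_)
  have hx := abs_xi_le h0 h1 s i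
  have hx2 : xi p s i ^ 2 ≤ 1 := by rw [← sq_abs]; nlinarith [abs_nonneg (xi p s i)]
  have a1 := norm_exp_mul_I_sub_one_sub_le (t * (xi p s i * D s))
  have a2 := norm_exp_mul_I_sub_one_le (t * (xi p s i * D s))
  refine (norm_sub_le _ _).trans ?_
  have b1 : ‖((xi p s i * g s : ℝ) : ℂ) * e₀ s *
      (cexp ((t * (xi p s i * D s) : ℝ) * I) - 1 - (t * (xi p s i * D s) : ℝ) * I)‖ ≤
      2 * (t ^ 2 * (|g s| * D s ^ 2)) := by
    rw [norm_mul, norm_mul, hn, mul_one, Complex.norm_real, Real.norm_eq_abs, abs_mul]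
    calc |xi p s i| * |g s| * _ ≤ 1 * |g s| * (2 * (t * (xi p s i * D s)) ^ 2) := by gcongr
      _ = 2 * (t ^ 2 * (|g s| * D s ^ 2)) * xi p s i ^ 2 := by ring
      _ ≤ 2 * (t ^ 2 * (|g s| * D s ^ 2)) * 1 := by gcongr
      _ = _ := mul_one _
  have b2 : ‖(t * I) * (((p * (1 - p) * (g s * D s) : ℝ) : ℂ) * (e₀ s *
          (cexp ((t * (xi p s i * D s) : ℝ) * I) - 1)))‖ ≤ t ^ 2 * (|g s| * D s ^ 2) := by
    rw [norm_mul, norm_mul, norm_mul, norm_mul, hn, one_mul, Complex.norm_real, Complex.norm_real,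
      Complex.norm_I, mul_one, Real.norm_eq_abs, Real.norm_eq_abs, abs_mul (p * (1 - p)),
      abs_mul (g s)]
    calc |t| * (|p * (1 - p)| * (|g s| * |D s|) * _)
        ≤ |t| * (1 * (|g s| * |D s|) * |t * (xi p s i * D s)|) := by gcongr
      _ = |t| ^ 2 * (|g s| * |D s| ^ 2) * |xi p s i| := by rw [abs_mul, abs_mul]; ring
      _ ≤ |t| ^ 2 * (|g s| * |D s| ^ 2) * 1 := by gcongr
      _ = _ := by rw [mul_one, sq_abs, sq_abs]
  linarith

/-- A function that almost solves the differential equation `φ' = -s v φ` of the Gaussian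
characteristic function is close to it. -/
lemma norm_sub_exp_le_of_deriv {φ φ' : ℝ → ℂ} {v B : ℝ} (hv : 0 ≤ v) (hB : 0 ≤ B)
    (hφ : ∀ t, HasDerivAt φ (φ' t) t)
    (h0 : φ 0 = 1) (h : ∀ t ∈ Set.Icc (0 : ℝ) 1, ‖φ' t + t * v * φ t‖ ≤ B) :
    ‖φ 1 - Real.exp (-v / 2)‖ ≤ B := by
  -- Integrating factor: `ψ' = (φ' + t v φ) e^{v t²/2}` has norm at most `B e^{v/2}` on `[0, 1)`,
  -- and dividing by `e^{v/2}` at the end leaves `B`.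
  set ψ : ℝ → ℂ := fun t => φ t * (Real.exp (v * t ^ 2 / 2) : ℝ)
  have hE : ∀ t : ℝ, HasDerivAt (fun t : ℝ => ((Real.exp (v * t ^ 2 / 2) : ℝ) : ℂ))
      ((Real.exp (v * t ^ 2 / 2) * (v * t) : ℝ) : ℂ) t := by
    intro t
    apply HasDerivAt.ofReal_comp
    have : HasDerivAt (fun t : ℝ => v * t ^ 2 / 2) (v * t) t := by
      refine (((hasDerivAt_pow 2 t).const_mul v).div_const 2).congr_deriv ?_
      push_cast; ring
    exact this.exp
  have hψ : ∀ t, HasDerivAt ψ ((φ' t + t * v * φ t) * (Real.exp (v * t ^ 2 / 2) : ℝ)) t := by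
    intro t
    refine ((hφ t).mul (hE t)).congr_deriv ?_
    push_cast; ring
  have hb : ∀ t ∈ Set.Ico (0 : ℝ) 1,
      ‖(φ' t + t * v * φ t) * (Real.exp (v * t ^ 2 / 2) : ℝ)‖ ≤ B * Real.exp (v / 2) := by
    intro t ht
    rw [norm_mul, Complex.norm_real, Real.norm_of_nonneg (Real.exp_pos _).le]
    refine mul_le_mul (h t ⟨ht.1, ht.2.le⟩) ?_ (Real.exp_pos _).le hB
    apply Real.exp_le_exp.2
    have : t ^ 2 ≤ 1 := by nlinarith [ht.1, ht.2]
    nlinarith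
  have := norm_image_sub_le_of_norm_deriv_le_segment_01'
    (fun t _ => (hψ t).hasDerivWithinAt) hb
  have e1 : φ 1 - Real.exp (-v / 2) = (ψ 1 - ψ 0) * (Real.exp (-v / 2) : ℝ) := by
    simp only [ψ, h0, sub_mul, mul_assoc, ← Complex.ofReal_mul, ← Real.exp_add]
    norm_num
    ring_nf
    simp
  rw [e1, norm_mul, Complex.norm_real, Real.norm_of_nonneg (Real.exp_pos _).le]
  calc _ ≤ B * Real.exp (v / 2) * Real.exp (-v / 2) := by gcongr
    _ = B := by rw [mul_assoc, ← Real.exp_add]; ring_nf; simp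

/-- A linear plus a quadratic form in independent centred Bernoulli variables. -/
def quadForm (p : ℝ) (ℓ : V → ℝ) (M : V → V → ℝ) (s : Finset V) : ℝ :=
  ∑ i, ℓ i * xi p s i + 2⁻¹ * ∑ i, ∑ j, M i j * (xi p s i * xi p s j)

/-- The `i`-th partial derivative of the quadratic part of `quadForm`. -/
def rowForm (p : ℝ) (M : V → V → ℝ) (i : V) (s : Finset V) : ℝ := ∑ j, M i j * xi p s j

lemma freeOf_rowForm (p : ℝ) {M : V → V → ℝ} (hM : ∀ i, M i i = 0) (i : V) :
    FreeOf i (rowForm p M i) := by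
  intro s _
  refine Finset.sum_congr rfl fun j _ => ?_
  by_cases h : j = i
  · simp [h, hM]
  · rw [xi_insert_of_ne p h]

/-- The factor `2⁻¹` stays in front of `rowForm` because each quadratic term is shared between its
two indices. The partial derivative `ℓ i + rowForm p M i` does not carry it; this is the source of
the asymmetric product in `steinVar`. -/
lemma quadForm_eq_sum (p : ℝ) (ℓ : V → ℝ) (M : V → V → ℝ) (s : Finset V) :
    quadForm p ℓ M s = ∑ i, xi p s i * (ℓ i + 2⁻¹ * rowForm p M i s) := by
  simp only [quadForm, rowForm, Finset.mul_sum, ← Finset.sum_add_distrib, mul_add]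
  refine Finset.sum_congr rfl fun i _ => ?_
  congr 1
  · ring
  · exact Finset.sum_congr rfl fun j _ => by ring

/-- With zero diagonal the form is affine in each variable `ξ_i`, and by symmetry of `M` its slope
is `ℓ i + rowForm p M i`. This provides the decomposition `W = W₀ + ξ_i D` that the Stein expansion
requires. -/
lemma freeOf_quadForm_sub (p : ℝ) (ℓ : V → ℝ) {M : V → V → ℝ} (hM : ∀ i, M i i = 0)
    (hs : ∀ i j, M i j = M j i) (i : V) :
    FreeOf i (fun s => quadForm p ℓ M s - xi p s i * (ℓ i + rowForm p M i s)) := by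
  have e : ∀ s, quadForm p ℓ M s - xi p s i * (ℓ i + rowForm p M i s) =
      ∑ j ∈ Finset.univ.erase i, ℓ j * xi p s j +
        2⁻¹ * ∑ j ∈ Finset.univ.erase i, ∑ k ∈ Finset.univ.erase i,
          M j k * (xi p s j * xi p s k) := by
    intro s
    have er : rowForm p M i s = ∑ k ∈ Finset.univ.erase i, M i k * xi p s k := by
      rw [rowForm, ← Finset.add_sum_erase _ _ (Finset.mem_univ i), hM]; ring
    have e1 : ∑ k, M i k * (xi p s i * xi p s k) = xi p s i * rowForm p M i s := by
      rw [rowForm, Finset.mul_sum]; exact Finset.sum_congr rfl fun k _ => by ring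
    have e2 : ∀ j, ∑ k, M j k * (xi p s j * xi p s k) = M j i * (xi p s j * xi p s i) +
        ∑ k ∈ Finset.univ.erase i, M j k * (xi p s j * xi p s k) := fun j =>
      (Finset.add_sum_erase _ _ (Finset.mem_univ i)).symm
    have e3 : ∑ j ∈ Finset.univ.erase i, M j i * (xi p s j * xi p s i) =
        xi p s i * rowForm p M i s := by
      rw [er, Finset.mul_sum]; exact Finset.sum_congr rfl fun k _ => by rw [hs]; ring
    rw [quadForm, ← Finset.add_sum_erase _ (fun j => ℓ j * xi p s j) (Finset.mem_univ i),
      ← Finset.add_sum_erase _ (fun j => ∑ k, M j k * (xi p s j * xi p s k)) (Finset.mem_univ i),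
      e1, Finset.sum_congr rfl fun j _ => e2 j, Finset.sum_add_distrib, e3]
    ring
  intro s _
  simp only [e]
  congr 1
  · exact Finset.sum_congr rfl fun j hj => by
      rw [xi_insert_of_ne p (Finset.ne_of_mem_erase hj)]
  · congr 1
    exact Finset.sum_congr rfl fun j hj => Finset.sum_congr rfl fun k hk => by
      rw [xi_insert_of_ne p (Finset.ne_of_mem_erase hj),
        xi_insert_of_ne p (Finset.ne_of_mem_erase hk)]

/-- The random variable whose concentration around the variance makes `quadForm` nearly normal. -/
def steinVar (p : ℝ) (ℓ : V → ℝ) (M : V → V → ℝ) (s : Finset V) : ℝ :=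
  ∑ i, p * (1 - p) * ((ℓ i + 2⁻¹ * rowForm p M i s) * (ℓ i + rowForm p M i s))

/-- A quantitative central limit theorem for `quadForm`, on the level of characteristic
functions. -/
theorem norm_charFun_quadForm_sub_le {p : ℝ} (h0 : 0 ≤ p) (h1 : p ≤ 1) (ℓ : V → ℝ)
    {M : V → V → ℝ} (hM : ∀ i, M i i = 0) (hs : ∀ i j, M i j = M j i) {v : ℝ} (hv : 0 ≤ v) :
    ‖bexp p (fun s => cexp (quadForm p ℓ M s * I)) - Real.exp (-v / 2)‖ ≤
      bexp p (fun s => |steinVar p ℓ M s - v|) +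
      3 * ∑ i, bexp p (fun s => |ℓ i + 2⁻¹ * rowForm p M i s| * (ℓ i + rowForm p M i s) ^ 2) := by
  set W := quadForm p ℓ M with hW
  set φ : ℝ → ℂ := fun t => bexp p (fun s => cexp ((t * W s : ℝ) * I)) with hφdef
  set φ' : ℝ → ℂ := fun t => bexp p (fun s => (W s * I) * cexp ((t * W s : ℝ) * I)) with hφ'
  set K := ∑ i, bexp p (fun s => |ℓ i + 2⁻¹ * rowForm p M i s| * (ℓ i + rowForm p M i s) ^ 2)
    with hK
  have hK0 : 0 ≤ K := Finset.sum_nonneg fun i _ => bexp_nonneg h0 h1 fun s => by positivity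
  have hT0 : 0 ≤ bexp p (fun s => |steinVar p ℓ M s - v|) :=
    bexp_nonneg h0 h1 fun s => abs_nonneg _
  have hder : ∀ t, HasDerivAt φ (φ' t) t := by
    intro t
    refine HasDerivAt.fun_sum fun s _ => HasDerivAt.const_smul _ ?_
    have : HasDerivAt (fun t : ℝ => ((t * W s : ℝ) : ℂ) * I) ((W s : ℂ) * I) t := by
      apply HasDerivAt.mul_const
      apply HasDerivAt.ofReal_comp
      simpa using (hasDerivAt_id t).mul_const (W s)
    exact this.cexp.congr_deriv (mul_comm _ _)
  have hφ0 : φ 0 = 1 := by simp [hφdef, bexp_const]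
  have main : ∀ t ∈ Set.Icc (0 : ℝ) 1, ‖φ' t + t * v * φ t‖ ≤
      bexp p (fun s => |steinVar p ℓ M s - v|) + 3 * K := by
    intro t ht
    have e1 : φ' t = I * ∑ i, bexp p (fun s =>
        ((xi p s i * (ℓ i + 2⁻¹ * rowForm p M i s) : ℝ) : ℂ) * cexp ((t * W s : ℝ) * I)) := by
      rw [← bexp_sum, ← bexp_cmul_left]
      refine congrArg (bexp p) (funext fun s => ?_)
      rw [← Finset.sum_mul, ← Complex.ofReal_sum, ← quadForm_eq_sum]
      ring
    -- The subtracted terms sum to `t I E[steinVar · e^{itW}]`. Multiplied by `I` they become `-t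
    -- E[steinVar · e^{itW}]`, so only the deviation of `steinVar` from `v` is left besides the
    -- coordinatewise errors.
    have e2 : φ' t + t * v * φ t = I * ∑ i, (bexp p (fun s =>
        ((xi p s i * (ℓ i + 2⁻¹ * rowForm p M i s) : ℝ) : ℂ) * cexp ((t * W s : ℝ) * I)) -
        t * I * bexp p (fun s => ((p * (1 - p) * ((ℓ i + 2⁻¹ * rowForm p M i s) *
          (ℓ i + rowForm p M i s)) : ℝ) : ℂ) * cexp ((t * W s : ℝ) * I))) -
        t * bexp p (fun s => ((steinVar p ℓ M s - v : ℝ) : ℂ) * cexp ((t * W s : ℝ) * I)) := by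
      have e3 : ∑ i, bexp p (fun s => ((p * (1 - p) * ((ℓ i + 2⁻¹ * rowForm p M i s) *
          (ℓ i + rowForm p M i s)) : ℝ) : ℂ) * cexp ((t * W s : ℝ) * I)) =
          bexp p (fun s => ((steinVar p ℓ M s : ℝ) : ℂ) * cexp ((t * W s : ℝ) * I)) := by
        rw [← bexp_sum]
        refine congrArg (bexp p) (funext fun s => ?_)
        rw [← Finset.sum_mul, ← Complex.ofReal_sum, steinVar]
      have e4 : bexp p (fun s => ((steinVar p ℓ M s - v : ℝ) : ℂ) * cexp ((t * W s : ℝ) * I)) =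
          bexp p (fun s => ((steinVar p ℓ M s : ℝ) : ℂ) * cexp ((t * W s : ℝ) * I)) - v * φ t := by
        rw [hφdef, ← bexp_cmul_left, ← bexp_sub]
        refine congrArg (bexp p) (funext fun s => ?_)
        push_cast; ring
      rw [Finset.sum_sub_distrib, ← Finset.mul_sum, e3, e4, e1]
      linear_combination (t * bexp p (fun s => ((steinVar p ℓ M s : ℝ) : ℂ) *
        cexp ((t * W s : ℝ) * I))) * I_sq
    have ht1 : |t| ≤ 1 := abs_le.2 ⟨by linarith [ht.1], ht.2⟩
    have ht2 : t ^ 2 ≤ 1 := by nlinarith [ht.1, ht.2]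
    rw [e2]
    refine (norm_sub_le _ _).trans ?_
    rw [norm_mul, norm_mul, Complex.norm_I, one_mul, Complex.norm_real, Real.norm_eq_abs, add_comm]
    refine add_le_add ?_ ?_
    · calc |t| * _ ≤ 1 * bexp p (fun s => |steinVar p ℓ M s - v|) := by
            gcongr
            refine (norm_bexp_le h0 h1 _).trans (bexp_mono h0 h1 fun s => le_of_eq ?_)
            rw [norm_mul, Complex.norm_exp_ofReal_mul_I, mul_one, Complex.norm_real,
              Real.norm_eq_abs]
        _ = _ := one_mul _
    · refine (norm_sum_le _ _).trans ?_
      rw [hK, Finset.mul_sum]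
      refine Finset.sum_le_sum fun i _ => ?_
      have hfr := freeOf_rowForm p hM i
      refine (norm_stein_coord_le h0 h1 i t (freeOf_quadForm_sub p ℓ hM hs i)
        (D := fun s => ℓ i + rowForm p M i s) (g := fun s => ℓ i + 2⁻¹ * rowForm p M i s)
        (fun s hs => by simp only [hfr s hs]) (fun s hs => by simp only [hfr s hs])
        (fun s => by ring)).trans ?_
      have : 0 ≤ bexp p (fun s => |ℓ i + 2⁻¹ * rowForm p M i s| * (ℓ i + rowForm p M i s) ^ 2) :=
        bexp_nonneg h0 h1 fun s => by positivity
      nlinarith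
  have := norm_sub_exp_le_of_deriv hv (by positivity) hder hφ0 main
  simpa [hφdef] using this

end Stein

/-! ### Error bounds in terms of the degrees of a graph. -/

section AdjacencyBounds

variable {V : Type*} [Fintype V] [DecidableEq V]

lemma mul_one_sub_nonneg {p : ℝ} (h0 : 0 ≤ p) (h1 : p ≤ 1) : 0 ≤ p * (1 - p) :=
  mul_nonneg h0 (sub_nonneg.2 h1)

lemma mul_one_sub_le_one (p : ℝ) : p * (1 - p) ≤ 1 := by nlinarith [sq_nonneg (p - 2⁻¹)]

/-- The square of the linear form splits into a diagonal part, at most `∑ a_i²` pointwise, and an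
off-diagonal bilinear form with second moment at most `2 (∑ a_i²)²`. Squaring the sum costs a factor
2 on each part, and `2 + 2 · 2 = 6`. -/
lemma bexp_linear_pow_four_le {p : ℝ} (h0 : 0 ≤ p) (h1 : p ≤ 1) (a : V → ℝ) :
    bexp p (fun s => (∑ i, a i * xi p s i) ^ 4) ≤ 6 * (∑ i, a i ^ 2) ^ 2 := by
  set M : V → V → ℝ := fun i j => if i = j then 0 else a i * a j with hM
  have hdec : ∀ s, (∑ i, a i * xi p s i) ^ 2 =
      ∑ i, a i ^ 2 * xi p s i ^ 2 + ∑ i, ∑ j, M i j * (xi p s i * xi p s j) := by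
    intro s
    rw [sq, Finset.sum_mul_sum, ← Finset.sum_add_distrib]
    refine Finset.sum_congr rfl fun i _ => ?_
    rw [← Finset.add_sum_erase _ _ (Finset.mem_univ i),
      ← Finset.add_sum_erase _ (fun j => M i j * (xi p s i * xi p s j)) (Finset.mem_univ i)]
    simp only [hM, if_true, zero_mul, zero_add]
    congr 1
    · ring
    · refine Finset.sum_congr rfl fun j hj => ?_
      rw [if_neg (Finset.ne_of_mem_erase hj).symm]; ring
  have hx2 : ∀ (s : Finset V) i, xi p s i ^ 2 ≤ 1 := fun s i => by
    have := abs_xi_le h0 h1 s i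
    rw [← sq_abs]; nlinarith [abs_nonneg (xi p s i)]
  have hb : ∀ s, (∑ i, a i * xi p s i) ^ 4 ≤
      2 * (∑ i, a i ^ 2) ^ 2 + 2 * (∑ i, ∑ j, M i j * (xi p s i * xi p s j)) ^ 2 := by
    intro s
    have d1 : ∑ i, a i ^ 2 * xi p s i ^ 2 ≤ ∑ i, a i ^ 2 :=
      Finset.sum_le_sum fun i _ => mul_le_of_le_one_right (sq_nonneg _) (hx2 s i)
    have d0 : 0 ≤ ∑ i, a i ^ 2 * xi p s i ^ 2 := Finset.sum_nonneg fun i _ => by positivity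
    have : (∑ i, a i * xi p s i) ^ 4 = ((∑ i, a i * xi p s i) ^ 2) ^ 2 := by ring
    rw [this, hdec]
    have := pow_le_pow_left₀ d0 d1 2
    nlinarith [sq_nonneg (∑ i, a i ^ 2 * xi p s i ^ 2 -
      ∑ i, ∑ j, M i j * (xi p s i * xi p s j))]
  refine (bexp_mono h0 h1 hb).trans ?_
  rw [bexp_add, bexp_const, bexp_mul_left, bexp_bilinear_sq p M (by simp [hM])]
  have hMM : ∑ i, ∑ j, M i j * (M i j + M j i) ≤ 2 * (∑ i, a i ^ 2) ^ 2 := by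
    rw [sq, Finset.sum_mul_sum, Finset.mul_sum]
    refine Finset.sum_le_sum fun i _ => ?_
    rw [Finset.mul_sum]
    refine Finset.sum_le_sum fun j _ => ?_
    by_cases h : i = j
    · simp only [hM, h, if_true, zero_mul]; positivity
    · simp only [hM, h, Ne.symm h, if_false]
      nlinarith
  have hMM0 : 0 ≤ ∑ i, ∑ j, M i j * (M i j + M j i) := by
    refine Finset.sum_nonneg fun i _ => Finset.sum_nonneg fun j _ => ?_
    by_cases h : i = j
    · simp [hM, h]
    · simp only [hM, h, Ne.symm h, if_false]
      nlinarith [sq_nonneg (a i * a j)]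
  have hpq : (p * (1 - p)) ^ 2 ≤ 1 :=
    pow_le_one₀ (mul_one_sub_nonneg h0 h1) (mul_one_sub_le_one p)
  have := mul_le_mul_of_nonneg_right hpq hMM0
  linarith

/-- A symmetric matrix with entries in `{0, 1}` and zero diagonal. -/
structure IsAdj (A : V → V → ℝ) : Prop where
  diag : ∀ i, A i i = 0
  symm : ∀ i j, A i j = A j i
  zero_or_one : ∀ i j, A i j = 0 ∨ A i j = 1

/-- The row sums of a matrix. -/
def rowSum (A : V → V → ℝ) (i : V) : ℝ := ∑ j, A i j

namespace IsAdj

variable {A : V → V → ℝ} (hA : IsAdj A)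
include hA

lemma nonneg (i j : V) : 0 ≤ A i j := by
  rcases hA.zero_or_one i j with h | h <;> simp [h]

lemma le_one (i j : V) : A i j ≤ 1 := by
  rcases hA.zero_or_one i j with h | h <;> simp [h]

lemma sq_eq (i j : V) : A i j ^ 2 = A i j := by
  rcases hA.zero_or_one i j with h | h <;> simp [h]

lemma rowSum_nonneg (i : V) : 0 ≤ rowSum A i := Finset.sum_nonneg fun j _ => hA.nonneg i j

lemma rowSum_le_sq (i : V) : rowSum A i ≤ rowSum A i ^ 2 := by
  have : rowSum A i = ∑ j, A i j ^ 2 := by simp [rowSum, hA.sq_eq]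
  rw [this]
  conv_rhs => rw [← this, rowSum, sq, Finset.sum_mul]
  refine Finset.sum_le_sum fun j _ => ?_
  rw [sq]
  exact mul_le_mul_of_nonneg_left
    (Finset.single_le_sum (f := fun k => A i k) (fun k _ => hA.nonneg i k) (Finset.mem_univ j))
    (hA.nonneg i j)

lemma sum_mul_rowSum (f : V → ℝ) : ∑ i, ∑ j, A i j * f i = ∑ i, rowSum A i * f i := by
  simp [rowSum, Finset.sum_mul]

lemma sum_mul_rowSum' (f : V → ℝ) : ∑ i, ∑ j, A i j * f j = ∑ i, rowSum A i * f i := by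
  rw [Finset.sum_comm, ← hA.sum_mul_rowSum f]
  exact Finset.sum_congr rfl fun i _ => Finset.sum_congr rfl fun j _ => by rw [hA.symm]

/-- The number of closed walks of length four is at most `√(2 |G|) ∑ dᵢ²`. -/
lemma sum_codeg_sq_le :
    ∑ j, ∑ k, (∑ i, A i j * A i k) ^ 2 ≤ √(∑ i, rowSum A i) * ∑ i, rowSum A i ^ 2 := by
  set S := ∑ i, rowSum A i with hS
  have hS0 : 0 ≤ S := Finset.sum_nonneg fun i _ => hA.rowSum_nonneg i
  set R : V → V → ℝ := fun i j => ∑ k, ∑ l, A i k * (A l j * A l k) with hR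
  have hR0 : ∀ i j, 0 ≤ R i j := fun i j => Finset.sum_nonneg fun k _ => Finset.sum_nonneg
    fun l _ => mul_nonneg (hA.nonneg _ _) (mul_nonneg (hA.nonneg _ _) (hA.nonneg _ _))
  have e : ∑ j, ∑ k, (∑ i, A i j * A i k) ^ 2 = ∑ i, ∑ j, A i j * R i j := by
    have : ∀ j k, (∑ i, A i j * A i k) ^ 2 =
        ∑ i, A i j * ∑ l, A i k * (A l j * A l k) := by
      intro j k
      rw [sq, Finset.sum_mul]
      refine Finset.sum_congr rfl fun i _ => ?_
      rw [Finset.mul_sum, Finset.mul_sum]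
      exact Finset.sum_congr rfl fun l _ => by ring
    simp only [this]
    rw [Finset.sum_comm' (t' := Finset.univ) (s' := fun _ => Finset.univ) (by simp)]
    simp only [hR, Finset.mul_sum]
    rw [Finset.sum_comm]
    have h3 : ∀ j : V, ∑ k, ∑ i, ∑ l, A i j * (A i k * (A l j * A l k)) =
        ∑ i, ∑ k, ∑ l, A i j * (A i k * (A l j * A l k)) := fun j => Finset.sum_comm
    simp only [h3]
    exact Finset.sum_comm
  have b1 : ∀ i j, R i j ≤ rowSum A i * rowSum A j := by
    intro i j
    rw [rowSum, rowSum, Finset.sum_mul_sum]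
    refine Finset.sum_le_sum fun k _ => Finset.sum_le_sum fun l _ => ?_
    refine mul_le_mul_of_nonneg_left ?_ (hA.nonneg _ _)
    rw [hA.symm l j]
    exact mul_le_of_le_one_right (hA.nonneg _ _) (hA.le_one _ _)
  have b2 : ∀ i j, R i j ≤ S := by
    intro i j
    refine Finset.sum_le_sum fun k _ => Finset.sum_le_sum fun l _ => ?_
    rw [hA.symm l k]
    calc A i k * (A l j * A k l) ≤ 1 * (1 * A k l) := by
          gcongr
          · exact mul_nonneg (hA.nonneg _ _) (hA.nonneg _ _)
          · exact hA.le_one _ _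
          · exact hA.nonneg _ _
          · exact hA.le_one _ _
      _ = A k l := by ring
  -- `R i j` counts walks of length three from `i` to `j`. It is bounded by the product of the end
  -- degrees and, through the middle edge, by `S`; the geometric mean of the two bounds is used,
  -- with `√(d_i d_j) ≤ (d_i + d_j)/2`.
  have b3 : ∀ i j, R i j ≤ √S * (2⁻¹ * (rowSum A i + rowSum A j)) := by
    intro i j
    have hi := hA.rowSum_nonneg i
    have hj := hA.rowSum_nonneg j
    refine le_of_sq_le_sq ?_ (by positivity)
    rw [mul_pow, Real.sq_sqrt hS0]
    calc R i j ^ 2 ≤ S * (rowSum A i * rowSum A j) := by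
          rw [sq]; exact mul_le_mul (b2 i j) (b1 i j) (hR0 i j) hS0
      _ ≤ S * (2⁻¹ * (rowSum A i + rowSum A j)) ^ 2 := by
          gcongr
          nlinarith [sq_nonneg (rowSum A i - rowSum A j)]
  rw [e]
  calc ∑ i, ∑ j, A i j * R i j
      ≤ ∑ i, ∑ j, A i j * (√S * (2⁻¹ * (rowSum A i + rowSum A j))) :=
        Finset.sum_le_sum fun i _ => Finset.sum_le_sum fun j _ =>
          mul_le_mul_of_nonneg_left (b3 i j) (hA.nonneg _ _)
    _ = √S * 2⁻¹ * (∑ i, ∑ j, A i j * rowSum A i + ∑ i, ∑ j, A i j * rowSum A j) := by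
        simp only [← Finset.sum_add_distrib, Finset.mul_sum]
        exact Finset.sum_congr rfl fun i _ => Finset.sum_congr rfl fun j _ => by ring
    _ = _ := by
        rw [hA.sum_mul_rowSum, hA.sum_mul_rowSum']
        simp only [← sq]
        ring

/-- Interpolation `|x|³ ≤ (x² + x⁴)/2`: the second moment is at most `d_i ≤ d_i²` and the fourth at
most `6 d_i²`, where `d_i = rowSum A i`. -/
lemma bexp_abs_rowForm_cube_le {p : ℝ} (h0 : 0 ≤ p) (h1 : p ≤ 1) (i : V) :
    bexp p (fun s => |rowForm p A i s| ^ 3) ≤ 7 / 2 * rowSum A i ^ 2 := by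
  have e2 : bexp p (fun s => rowForm p A i s ^ 2) ≤ rowSum A i ^ 2 := by
    have := bexp_linear_sq p (A i)
    simp only [rowForm, this, hA.sq_eq]
    refine le_trans ?_ (hA.rowSum_le_sq i)
    exact mul_le_of_le_one_left (hA.rowSum_nonneg i) (mul_one_sub_le_one p)
  have e4 : bexp p (fun s => rowForm p A i s ^ 4) ≤ 6 * rowSum A i ^ 2 := by
    have := bexp_linear_pow_four_le h0 h1 (A i)
    simpa only [rowForm, rowSum, hA.sq_eq] using this
  have hb : ∀ s, |rowForm p A i s| ^ 3 ≤ 2⁻¹ * (rowForm p A i s ^ 2 + rowForm p A i s ^ 4) := by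
    intro s
    have e : rowForm p A i s ^ 4 = |rowForm p A i s| ^ 4 := (Even.pow_abs (by decide) _).symm
    rw [← sq_abs, e]
    nlinarith [sq_nonneg (|rowForm p A i s| * (|rowForm p A i s| - 1))]
  refine (bexp_mono h0 h1 hb).trans ?_
  rw [bexp_mul_left, bexp_add]
  linarith

/-- The diagonal of `A²` holds the degrees, and `ξ_i²` is its mean plus a multiple of `ξ_i`. This
separates the constant, linear and off-diagonal quadratic parts. -/
lemma sum_rowForm_sq (p : ℝ) (s : Finset V) :
    ∑ i, rowForm p A i s ^ 2 = p * (1 - p) * ∑ i, rowSum A i +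
      (1 - 2 * p) * ∑ i, rowSum A i * xi p s i +
      ∑ j, ∑ k, (if j = k then 0 else ∑ i, A i j * A i k) * (xi p s j * xi p s k) := by
  have h1 : ∑ i, rowForm p A i s ^ 2 =
      ∑ j, ∑ k, (∑ i, A i j * A i k) * (xi p s j * xi p s k) := by
    simp only [rowForm, sq, Finset.sum_mul, Finset.mul_sum]
    rw [Finset.sum_comm]
    refine Finset.sum_congr rfl fun j _ => ?_
    rw [Finset.sum_comm]
    exact Finset.sum_congr rfl fun k _ => Finset.sum_congr rfl fun i _ => by ring
  have h2 : ∀ j, ∑ k, (∑ i, A i j * A i k) * (xi p s j * xi p s k) =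
      rowSum A j * xi p s j ^ 2 +
        ∑ k, (if j = k then 0 else ∑ i, A i j * A i k) * (xi p s j * xi p s k) := by
    intro j
    rw [← Finset.add_sum_erase _ _ (Finset.mem_univ j), ← Finset.add_sum_erase _ (fun k =>
      (if j = k then 0 else ∑ i, A i j * A i k) * (xi p s j * xi p s k)) (Finset.mem_univ j)]
    simp only [if_true, zero_mul, zero_add]
    congr 1
    · simp only [← sq, hA.sq_eq, rowSum]
      congr 1
      exact Finset.sum_congr rfl fun i _ => hA.symm i j
    · refine Finset.sum_congr rfl fun k hk => ?_
      rw [if_neg (Finset.ne_of_mem_erase hk).symm]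
  rw [h1, Finset.sum_congr rfl fun j _ => h2 j, Finset.sum_add_distrib]
  congr 1
  rw [Finset.mul_sum, Finset.mul_sum, ← Finset.sum_add_distrib]
  exact Finset.sum_congr rfl fun j _ => by rw [xi_sq]; ring

lemma rowForm_const_mul (p b : ℝ) (i : V) (s : Finset V) :
    rowForm p (fun i j => b * A i j) i s = b * rowForm p A i s := by
  simp only [rowForm, Finset.mul_sum, mul_assoc]

/-- The constant subtracted is the mean of `steinVar`. The deviation is a sum of centred forms whose
second moments are known exactly. -/
lemma steinVar_sub_eq (p b : ℝ) (ℓ : V → ℝ) (s : Finset V) :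
    steinVar p ℓ (fun i j => b * A i j) s -
      (p * (1 - p) * ∑ i, ℓ i ^ 2 + 2⁻¹ * (p * (1 - p)) ^ 2 * b ^ 2 * ∑ i, rowSum A i) =
    p * (1 - p) * (3 / 2 * b * ∑ j, (∑ i, A j i * ℓ i) * xi p s j +
      2⁻¹ * b ^ 2 * (1 - 2 * p) * ∑ j, rowSum A j * xi p s j +
      2⁻¹ * b ^ 2 *
        ∑ j, ∑ k, (if j = k then 0 else ∑ i, A i j * A i k) * (xi p s j * xi p s k)) := by
  have e1 : ∑ i, ℓ i * rowForm p A i s = ∑ j, (∑ i, A j i * ℓ i) * xi p s j := by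
    simp only [rowForm, Finset.mul_sum, Finset.sum_mul]
    rw [Finset.sum_comm]
    exact Finset.sum_congr rfl fun j _ => Finset.sum_congr rfl fun i _ => by rw [hA.symm i j]; ring
  have e2 : steinVar p ℓ (fun i j => b * A i j) s = p * (1 - p) * (∑ i, ℓ i ^ 2 +
      3 / 2 * b * ∑ i, ℓ i * rowForm p A i s + 2⁻¹ * b ^ 2 * ∑ i, rowForm p A i s ^ 2) := by
    simp only [steinVar, hA.rowForm_const_mul, Finset.mul_sum, ← Finset.sum_add_distrib]
    exact Finset.sum_congr rfl fun i _ => by ring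
  rw [e2, hA.sum_rowForm_sq, e1]
  ring

lemma bexp_steinVar_sub_sq_le {p : ℝ} (h0 : 0 ≤ p) (h1 : p ≤ 1) (b : ℝ) (ℓ : V → ℝ) :
    bexp p (fun s => (steinVar p ℓ (fun i j => b * A i j) s -
      (p * (1 - p) * ∑ i, ℓ i ^ 2 + 2⁻¹ * (p * (1 - p)) ^ 2 * b ^ 2 * ∑ i, rowSum A i)) ^ 2) ≤
    9 * b ^ 2 * ∑ j, (∑ i, A j i * ℓ i) ^ 2 + b ^ 4 * ∑ i, rowSum A i ^ 2 +
      2 * b ^ 4 * (√(∑ i, rowSum A i) * ∑ i, rowSum A i ^ 2) := by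
  set C : V → V → ℝ := fun j k => if j = k then 0 else ∑ i, A i j * A i k with hC
  set P := p * (1 - p)
  have hP0 : 0 ≤ P := mul_one_sub_nonneg h0 h1
  have hP1 : P ≤ 1 := mul_one_sub_le_one p
  set U : Finset V → ℝ := fun s => ∑ j, (∑ i, A j i * ℓ i) * xi p s j
  set Y : Finset V → ℝ := fun s => ∑ j, rowSum A j * xi p s j
  set Z : Finset V → ℝ := fun s => ∑ j, ∑ k, C j k * (xi p s j * xi p s k)
  -- From `(x + y + z)² ≤ 3(x² + y² + z²)`: `27/4 = 3 · (3/2)²` and `3/4 = 3 · (1/2)²`. The final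
  -- constants 9, 1, 2 are rounded up.
  have hb : ∀ s, (steinVar p ℓ (fun i j => b * A i j) s -
      (P * ∑ i, ℓ i ^ 2 + 2⁻¹ * P ^ 2 * b ^ 2 * ∑ i, rowSum A i)) ^ 2 ≤
      27 / 4 * b ^ 2 * U s ^ 2 + 3 / 4 * b ^ 4 * Y s ^ 2 + 3 / 4 * b ^ 4 * Z s ^ 2 := by
    intro s
    rw [hA.steinVar_sub_eq, mul_pow]
    have hq : (1 - 2 * p) ^ 2 ≤ 1 := by nlinarith
    have hP2 : P ^ 2 ≤ 1 := pow_le_one₀ hP0 hP1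
    have t3 : ∀ x y z : ℝ, (x + y + z) ^ 2 ≤ 3 * x ^ 2 + 3 * y ^ 2 + 3 * z ^ 2 := fun x y z => by
      nlinarith [sq_nonneg (x - y), sq_nonneg (y - z), sq_nonneg (x - z)]
    refine (mul_le_of_le_one_left (sq_nonneg _) hP2).trans ((t3 _ _ _).trans ?_)
    have : b ^ 4 * Y s ^ 2 * (1 - 2 * p) ^ 2 ≤ b ^ 4 * Y s ^ 2 * 1 := by gcongr
    have e1 : (2⁻¹ * b ^ 2 * (1 - 2 * p) * Y s) ^ 2 =
      4⁻¹ * (b ^ 4 * Y s ^ 2 * (1 - 2 * p) ^ 2) := by ring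
    change 3 * (3 / 2 * b * U s) ^ 2 + 3 * (2⁻¹ * b ^ 2 * (1 - 2 * p) * Y s) ^ 2 +
      3 * (2⁻¹ * b ^ 2 * Z s) ^ 2 ≤ _
    rw [e1]
    nlinarith
  refine (bexp_mono h0 h1 hb).trans ?_
  rw [bexp_add, bexp_add, bexp_mul_left, bexp_mul_left, bexp_mul_left]
  have hU : bexp p (fun s => U s ^ 2) ≤ ∑ j, (∑ i, A j i * ℓ i) ^ 2 := by
    rw [bexp_linear_sq]
    exact mul_le_of_le_one_left (Finset.sum_nonneg fun _ _ => sq_nonneg _) hP1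
  have hY : bexp p (fun s => Y s ^ 2) ≤ ∑ j, rowSum A j ^ 2 := by
    rw [bexp_linear_sq]
    exact mul_le_of_le_one_left (Finset.sum_nonneg fun _ _ => sq_nonneg _) hP1
  have hZ : bexp p (fun s => Z s ^ 2) ≤ 2 * (√(∑ i, rowSum A i) * ∑ i, rowSum A i ^ 2) := by
    rw [bexp_bilinear_sq p C (by simp [hC])]
    have hCs : ∀ j k, C j k * (C j k + C k j) = 2 * C j k ^ 2 := by
      intro j k
      have : C k j = C j k := by
        simp only [hC, eq_comm]
        split_ifs
        · rfl
        · exact Finset.sum_congr rfl fun i _ => mul_comm _ _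
      rw [this]; ring
    simp only [hCs, ← Finset.mul_sum]
    have hCC : ∑ j, ∑ k, C j k ^ 2 ≤ √(∑ i, rowSum A i) * ∑ i, rowSum A i ^ 2 := by
      refine le_trans ?_ hA.sum_codeg_sq_le
      refine Finset.sum_le_sum fun j _ => Finset.sum_le_sum fun k _ => ?_
      simp only [hC]
      split_ifs
      · simpa using sq_nonneg (∑ i, A i j * A i k)
      · exact le_rfl
    have h0' : 0 ≤ ∑ j, ∑ k, C j k ^ 2 := by positivity
    have hP2 : P ^ 2 ≤ 1 := pow_le_one₀ hP0 hP1
    nlinarith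
  have n1 : 0 ≤ ∑ j, (∑ i, A j i * ℓ i) ^ 2 := by positivity
  have n2 : 0 ≤ ∑ j, rowSum A j ^ 2 := by positivity
  have n3 : 0 ≤ √(∑ i, rowSum A i) * ∑ i, rowSum A i ^ 2 := by positivity
  have m1 := mul_le_mul_of_nonneg_left hU (sq_nonneg b)
  have m2 := mul_le_mul_of_nonneg_left hY (by positivity : 0 ≤ b ^ 4)
  have m3 := mul_le_mul_of_nonneg_left hZ (by positivity : 0 ≤ b ^ 4)
  have := mul_nonneg (sq_nonneg b) n1
  have := mul_nonneg (by positivity : 0 ≤ b ^ 4) n2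
  have := mul_nonneg (by positivity : 0 ≤ b ^ 4) n3
  linarith

/-- The distance between the characteristic function of a linear plus a graph-quadratic form in
independent centred Bernoulli variables and that of the normal distribution. -/
theorem norm_charFun_sub_le {p : ℝ} (h0 : 0 ≤ p) (h1 : p ≤ 1) (b : ℝ) (ℓ : V → ℝ) {v : ℝ}
    (hv : v = p * (1 - p) * ∑ i, ℓ i ^ 2 +
      2⁻¹ * (p * (1 - p)) ^ 2 * b ^ 2 * ∑ i, rowSum A i) :
    ‖bexp p (fun s => Complex.exp (quadForm p ℓ (fun i j => b * A i j) s * Complex.I)) -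
      Real.exp (-v / 2)‖ ≤
    √(9 * b ^ 2 * ∑ j, (∑ i, A j i * ℓ i) ^ 2 + b ^ 4 * ∑ i, rowSum A i ^ 2 +
      2 * b ^ 4 * (√(∑ i, rowSum A i) * ∑ i, rowSum A i ^ 2)) +
    (12 * ∑ i, |ℓ i| ^ 3 + 42 * |b| ^ 3 * ∑ i, rowSum A i ^ 2) := by
  have hS0 : 0 ≤ ∑ i, rowSum A i := Finset.sum_nonneg fun i _ => hA.rowSum_nonneg i
  have hv0 : 0 ≤ v := by
    have := mul_one_sub_nonneg h0 h1
    rw [hv]; positivity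
  refine (norm_charFun_quadForm_sub_le h0 h1 ℓ (M := fun i j => b * A i j)
    (fun i => by simp [hA.diag]) (fun i j => by rw [hA.symm]) hv0).trans (add_le_add ?_ ?_)
  · refine (bexp_abs_le_sqrt h0 h1 _).trans (Real.sqrt_le_sqrt ?_)
    rw [hv]
    exact hA.bexp_steinVar_sub_sq_le h0 h1 b ℓ
  · have : ∀ i, bexp p (fun s => |ℓ i + 2⁻¹ * rowForm p (fun i j => b * A i j) i s| *
        (ℓ i + rowForm p (fun i j => b * A i j) i s) ^ 2) ≤
        4 * |ℓ i| ^ 3 + 14 * |b| ^ 3 * rowSum A i ^ 2 := by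
      intro i
      -- Both factors are controlled by `x + y` with `x = |ℓ i|` and `y = |b * rowForm p A i s|`,
      -- and `(x + y)³ ≤ 4x³ + 4y³`.
      have hb : ∀ s, |ℓ i + 2⁻¹ * rowForm p (fun i j => b * A i j) i s| *
          (ℓ i + rowForm p (fun i j => b * A i j) i s) ^ 2 ≤
          4 * |ℓ i| ^ 3 + 4 * |b| ^ 3 * |rowForm p A i s| ^ 3 := by
        intro s
        rw [hA.rowForm_const_mul]
        set x := |ℓ i|
        set y := |b * rowForm p A i s| with hy
        have hx : 0 ≤ x := abs_nonneg _
        have hy0 : 0 ≤ y := abs_nonneg _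
        have a1 : |ℓ i + 2⁻¹ * (b * rowForm p A i s)| ≤ x + y := by
          refine (abs_add_le _ _).trans ?_
          rw [abs_mul 2⁻¹, abs_of_pos (by norm_num : (0 : ℝ) < 2⁻¹)]
          linarith
        have a2 : (ℓ i + b * rowForm p A i s) ^ 2 ≤ (x + y) ^ 2 := by
          rw [← sq_abs]
          exact pow_le_pow_left₀ (abs_nonneg _) (abs_add_le _ _) 2
        calc _ ≤ (x + y) * (x + y) ^ 2 := by gcongr
          _ ≤ 4 * x ^ 3 + 4 * y ^ 3 := by
              nlinarith [mul_nonneg (add_nonneg hx hy0) (sq_nonneg (x - y))]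
          _ = _ := by rw [hy, abs_mul]; ring
      refine (bexp_mono h0 h1 hb).trans ?_
      rw [bexp_add, bexp_const, bexp_mul_left]
      have := mul_le_mul_of_nonneg_left (hA.bexp_abs_rowForm_cube_le h0 h1 i)
        (by positivity : 0 ≤ 4 * |b| ^ 3)
      linarith
    calc _ ≤ 3 * ∑ i, (4 * |ℓ i| ^ 3 + 14 * |b| ^ 3 * rowSum A i ^ 2) := by
          gcongr with i; exact this i
      _ = _ := by rw [Finset.sum_add_distrib, ← Finset.mul_sum, ← Finset.mul_sum]; ring

end IsAdj

end AdjacencyBounds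

/-! ### Moments of linear and quadratic statistics of a uniform permutation. -/

section Permutation

variable {V : Type*} [Fintype V] [DecidableEq V]
variable {E : Type*} [NormedAddCommGroup E] [NormedSpace ℝ E]

/-- The expectation under a uniformly distributed permutation. -/
def pexp (F : Equiv.Perm V → E) : E := ((Fintype.card V).factorial : ℝ)⁻¹ • ∑ σ, F σ

lemma pexp_const (c : E) : pexp (V := V) (fun _ => c) = c := by
  rw [pexp, Finset.sum_const, Finset.card_univ, Fintype.card_perm, ← Nat.cast_smul_eq_nsmul ℝ,
    smul_smul, inv_mul_cancel₀ (by positivity), one_smul]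

lemma pexp_add (F G : Equiv.Perm V → E) :
    pexp (fun σ => F σ + G σ) = pexp F + pexp G := by
  simp [pexp, Finset.sum_add_distrib]

lemma pexp_sub (F G : Equiv.Perm V → E) :
    pexp (fun σ => F σ - G σ) = pexp F - pexp G := by
  simp [pexp, smul_sub, Finset.sum_sub_distrib]

lemma pexp_sum {ι : Type*} (I : Finset ι) (F : ι → Equiv.Perm V → E) :
    pexp (fun σ => ∑ i ∈ I, F i σ) = ∑ i ∈ I, pexp (F i) := by
  simp only [pexp, ← Finset.smul_sum]
  rw [Finset.sum_comm]

lemma pexp_mul_left (c : ℝ) (F : Equiv.Perm V → ℝ) :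
    pexp (fun σ => c * F σ) = c * pexp F := by
  simp only [pexp, smul_eq_mul, ← Finset.mul_sum]; ring

lemma pexp_mono {F G : Equiv.Perm V → ℝ} (h : ∀ σ, F σ ≤ G σ) : pexp F ≤ pexp G := by
  simp only [pexp, smul_eq_mul]
  exact mul_le_mul_of_nonneg_left (Finset.sum_le_sum fun σ _ => h σ) (by positivity)

lemma pexp_nonneg {F : Equiv.Perm V → ℝ} (h : ∀ σ, 0 ≤ F σ) : 0 ≤ pexp F := by
  simpa [pexp_const] using pexp_mono (F := fun _ => 0) h

lemma norm_pexp_le (F : Equiv.Perm V → E) : ‖pexp F‖ ≤ pexp (fun σ => ‖F σ‖) := by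
  rw [pexp, norm_smul, Real.norm_of_nonneg (by positivity)]
  exact mul_le_mul_of_nonneg_left (norm_sum_le _ _) (by positivity)

lemma pexp_mul_right (F : Equiv.Perm V → E) (τ : Equiv.Perm V) :
    pexp (fun σ => F (σ * τ)) = pexp F := by
  rw [pexp, pexp]
  congr 1
  exact Equiv.sum_comp (Equiv.mulRight τ) F

lemma pexp_mul_perm_left (F : Equiv.Perm V → E) (τ : Equiv.Perm V) :
    pexp (fun σ => F (τ * σ)) = pexp F := by
  rw [pexp, pexp]
  congr 1
  exact Equiv.sum_comp (Equiv.mulLeft τ) F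

lemma exists_const_of_pairwise_eq {ι : Type*} {P : ι → Prop} {f : ι → ℝ}
    (h : ∀ x y, P x → P y → f x = f y) : ∃ c, ∀ x, P x → f x = c := by
  by_cases hx : ∃ x, P x
  · obtain ⟨x, hx⟩ := hx
    exact ⟨f x, fun y hy => h y x hy hx⟩
  · exact ⟨0, fun x hx' => (hx ⟨x, hx'⟩).elim⟩

/-- The expectation of a function of the images of `r` distinct points does not depend on the
points. -/
lemma exists_pexp_comp_eq {r : ℕ} (f : (Fin r → V) → ℝ) :
    ∃ c, ∀ x : Fin r → V, Function.Injective x → pexp (fun σ => f (σ ∘ x)) = c := by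
  refine exists_const_of_pairwise_eq fun x y hx hy => ?_
  obtain ⟨τ, hτ⟩ := Equiv.Perm.exists_smul_eq_embedding ⟨y, hy⟩ ⟨x, hx⟩
  have hτ' : x = τ ∘ y := by
    funext k
    have := DFunLike.congr_fun hτ k
    simpa using this.symm
  rw [← pexp_mul_right (fun σ => f (σ ∘ y)) τ]
  simp only [hτ', ← Function.comp_assoc, Equiv.Perm.coe_mul]

/-- The expectation does not depend on `i`, and the sum of `f (σ i)` over all `i` is not random. -/
lemma pexp_apply (f : V → ℝ) (i : V) :
    pexp (fun σ => f (σ i)) = (∑ v, f v) / Fintype.card V := by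
  obtain ⟨c, hc⟩ := exists_pexp_comp_eq (r := 1) (fun x : Fin 1 → V => f (x 0))
  have hc' : ∀ i, pexp (fun σ => f (σ i)) = c := fun i =>
    hc (fun _ => i) (Function.injective_of_subsingleton _)
  have h : ∑ i, pexp (fun σ => f (σ i)) = ∑ v, f v := by
    rw [← pexp_sum]
    simp only [Equiv.sum_comp, pexp_const]
  simp only [hc', Finset.sum_const, Finset.card_univ, nsmul_eq_mul] at h
  have : Nonempty V := ⟨i⟩
  rw [hc', ← h]
  field_simp

/-- The second moment of a linear statistic with coefficients of sum zero. -/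
lemma pexp_linear_sq_le (f : V → ℝ) {c : V → ℝ} (hc : ∑ i, c i = 0) :
    pexp (fun σ => (∑ i, c i * f (σ i)) ^ 2) ≤
      2 * (∑ i, c i ^ 2) * ((∑ v, f v ^ 2) / Fintype.card V) := by
  set e₀ := (∑ v, f v ^ 2) / Fintype.card V with he₀
  have h0 : ∀ i, pexp (fun σ => f (σ i) ^ 2) = e₀ := pexp_apply (fun v => f v ^ 2)
  obtain ⟨e₁, he₁⟩ := exists_pexp_comp_eq (r := 2) (fun x : Fin 2 → V => f (x 0) * f (x 1))
  have h1 : ∀ i j, i ≠ j → pexp (fun σ => f (σ i) * f (σ j)) = e₁ := by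
    intro i j hij
    simpa using he₁ ![i, j] (by
      intro a b hab
      fin_cases a <;> fin_cases b <;> simp_all)
  have h2 : ∀ i j, pexp (fun σ => f (σ i) * f (σ j)) = e₁ + (if i = j then e₀ - e₁ else 0) := by
    intro i j
    split_ifs with h
    · subst h
      rw [← h0 i]
      simp only [sq]; ring
    · rw [h1 i j h, add_zero]
  have e : pexp (fun σ => (∑ i, c i * f (σ i)) ^ 2) = (∑ i, c i ^ 2) * (e₀ - e₁) := by
    have : (fun σ : Equiv.Perm V => (∑ i, c i * f (σ i)) ^ 2) =
        fun σ => ∑ i, ∑ j, (c i * c j) * (f (σ i) * f (σ j)) := by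
      funext σ
      rw [sq, Finset.sum_mul_sum]
      exact Finset.sum_congr rfl fun i _ => Finset.sum_congr rfl fun j _ => by ring
    rw [this, pexp_sum]
    simp only [pexp_sum, pexp_mul_left, h2, mul_add, Finset.sum_add_distrib, mul_ite, mul_zero,
      Finset.sum_ite_eq, Finset.mem_univ, if_true]
    have : ∑ i, ∑ j, c i * c j * e₁ = (∑ i, c i) * (∑ j, c j) * e₁ := by
      rw [Finset.sum_mul_sum, Finset.sum_mul]
      exact Finset.sum_congr rfl fun i _ => by rw [Finset.sum_mul]
    rw [this, hc, Finset.sum_mul]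
    simp [sq]
  rw [e]
  -- Positivity of `E (f(σ i) + f(σ j))²` gives `e₁ ≥ -e₀`, so `e₀ - e₁ ≤ 2 e₀`. Without two
  -- distinct points the sum condition forces `c = 0`.
  by_cases hV : ∃ i j : V, i ≠ j
  · obtain ⟨i, j, hij⟩ := hV
    have : 0 ≤ pexp (fun σ : Equiv.Perm V => (f (σ i) + f (σ j)) ^ 2) :=
      pexp_nonneg fun σ => sq_nonneg _
    have e2 : pexp (fun σ : Equiv.Perm V => (f (σ i) + f (σ j)) ^ 2) = 2 * e₀ + 2 * e₁ := by
      have : (fun σ : Equiv.Perm V => (f (σ i) + f (σ j)) ^ 2) =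
          fun σ => (f (σ i) ^ 2 + f (σ j) ^ 2) + 2 * (f (σ i) * f (σ j)) := by
        funext σ; ring
      rw [this, pexp_add, pexp_add, pexp_mul_left, h0, h0, h1 i j hij]; ring
    have hs : 0 ≤ ∑ i, c i ^ 2 := by positivity
    nlinarith
  · push Not at hV
    have : ∀ i, c i = 0 := by
      intro i
      rw [← hc, Finset.sum_eq_single i (fun b _ hb => (hb (hV b i)).elim) (by simp)]
    simp [this]

/-- The values of `E[y_ij y_kl]` for an exchangeable array `y`. -/
def pairMoment (c₀ c₁ c₂ : ℝ) (i j k l : V) : ℝ :=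
  c₂ + (c₁ - c₂) * ((if i = k then 1 else 0) + (if i = l then 1 else 0) +
    (if j = k then 1 else 0) + (if j = l then 1 else 0)) +
  (c₀ - 2 * c₁ + c₂) * ((if i = k then if j = l then 1 else 0 else 0) +
    (if i = l then if j = k then 1 else 0 else 0))

lemma sum_pairMoment (c₀ c₁ c₂ : ℝ) {A : V → V → ℝ} (hA : ∀ i j, A i j = A j i) :
    ∑ i, ∑ j, ∑ k, ∑ l, A i j * A k l * pairMoment c₀ c₁ c₂ i j k l =
      c₂ * (∑ i, rowSum A i) ^ 2 + 4 * (c₁ - c₂) * ∑ i, rowSum A i ^ 2 +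
        2 * (c₀ - 2 * c₁ + c₂) * ∑ i, ∑ j, A i j ^ 2 := by
  have hcol : ∀ l, ∑ k, A k l = rowSum A l := fun l =>
    Finset.sum_congr rfl fun k _ => hA k l
  have key : ∀ i j, ∑ k, ∑ l, A i j * A k l * pairMoment c₀ c₁ c₂ i j k l =
      A i j * (c₂ * (∑ k, rowSum A k) + 2 * (c₁ - c₂) * (rowSum A i + rowSum A j) +
        2 * (c₀ - 2 * c₁ + c₂) * A i j) := by
    intro i j
    have s1 : ∑ k, ∑ l, A k l * (if i = k then 1 else 0) = rowSum A i := by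
      rw [Finset.sum_eq_single i] <;> simp +contextual [rowSum, eq_comm]
    have s1' : ∑ k, ∑ l, A k l * (if j = k then 1 else 0) = rowSum A j := by
      rw [Finset.sum_eq_single j] <;> simp +contextual [rowSum, eq_comm]
    have s2 : ∑ k, ∑ l, A k l * (if i = l then 1 else 0) = rowSum A i := by
      simp [hcol]
    have s2' : ∑ k, ∑ l, A k l * (if j = l then 1 else 0) = rowSum A j := by
      simp [hcol]
    have s3 : ∑ k, ∑ l, A k l * (if i = k then if j = l then 1 else 0 else 0) = A i j := by
      rw [Finset.sum_eq_single i] <;> simp +contextual [eq_comm]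
    have s4 : ∑ k, ∑ l, A k l * (if i = l then if j = k then 1 else 0 else 0) = A i j := by
      rw [Finset.sum_eq_single j]
      · simp [hA]
      · intro k _ hk
        simp [hk.symm]
      · simp
    have e : ∀ k l, A i j * A k l * pairMoment c₀ c₁ c₂ i j k l =
        A i j * (c₂ * A k l + (c₁ - c₂) * (A k l * (if i = k then 1 else 0) +
          A k l * (if i = l then 1 else 0) + A k l * (if j = k then 1 else 0) +
          A k l * (if j = l then 1 else 0)) +
        (c₀ - 2 * c₁ + c₂) * (A k l * (if i = k then if j = l then 1 else 0 else 0) +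
          A k l * (if i = l then if j = k then 1 else 0 else 0))) := by
      intro k l; unfold pairMoment; ring
    simp only [e, ← Finset.mul_sum, Finset.sum_add_distrib, s1, s1', s2, s2', s3, s4]
    rw [show ∑ k, ∑ l, A k l = ∑ k, rowSum A k from rfl]
    ring
  simp only [key]
  have e2 : ∀ i j, A i j * (c₂ * (∑ k, rowSum A k) + 2 * (c₁ - c₂) * (rowSum A i + rowSum A j) +
        2 * (c₀ - 2 * c₁ + c₂) * A i j) = c₂ * (∑ k, rowSum A k) * A i j +
        2 * (c₁ - c₂) * (A i j * rowSum A i) + 2 * (c₁ - c₂) * (A i j * rowSum A j) +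
        2 * (c₀ - 2 * c₁ + c₂) * A i j ^ 2 := by
    intro i j; ring
  simp only [e2, Finset.sum_add_distrib, ← Finset.mul_sum]
  have e3 : ∑ i, ∑ j, A i j * rowSum A i = ∑ i, rowSum A i ^ 2 :=
    Finset.sum_congr rfl fun i _ => by rw [← Finset.sum_mul, sq]; rfl
  have e4 : ∑ i, ∑ j, A i j * rowSum A j = ∑ i, rowSum A i ^ 2 := by
    rw [Finset.sum_comm]
    exact Finset.sum_congr rfl fun i _ => by rw [← Finset.sum_mul, sq, hcol]
  rw [show ∑ i, ∑ j, A i j = ∑ i, rowSum A i from rfl]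
  rw [e3, e4]
  ring

/-- The moments `E[y_ij y_kl]` of the array `y_ij = g (σ i) (σ j)`. -/
lemma exists_pexp_eq_pairMoment {g : V → V → ℝ} (hg : ∀ v w, g v w = g w v) :
    ∃ c₀ c₁ c₂ : ℝ, ∀ i j k l, i ≠ j → k ≠ l →
      pexp (fun σ => g (σ i) (σ j) * g (σ k) (σ l)) = pairMoment c₀ c₁ c₂ i j k l := by
  obtain ⟨c₀, h₀⟩ := exists_pexp_comp_eq (r := 2) (fun x : Fin 2 → V => g (x 0) (x 1) ^ 2)
  obtain ⟨c₁, h₁⟩ := exists_pexp_comp_eq (r := 3)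
    (fun x : Fin 3 → V => g (x 0) (x 1) * g (x 0) (x 2))
  obtain ⟨c₂, h₂⟩ := exists_pexp_comp_eq (r := 4)
    (fun x : Fin 4 → V => g (x 0) (x 1) * g (x 2) (x 3))
  -- `c₀`, `c₁`, `c₂` belong to pairs sharing two, one or no indices. In `pairMoment` two coinciding
  -- pairs trigger two of the four single indicators, which the coefficient `c₀ - 2c₁ + c₂`
  -- corrects.
  have h0 : ∀ i j, i ≠ j → pexp (fun σ => g (σ i) (σ j) * g (σ i) (σ j)) = c₀ := by
    intro i j hij
    rw [← h₀ ![i, j] (by intro a b hab; fin_cases a <;> fin_cases b <;> simp_all)]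
    simp [sq]
  have h1 : ∀ i j k, i ≠ j → i ≠ k → j ≠ k →
      pexp (fun σ => g (σ i) (σ j) * g (σ i) (σ k)) = c₁ := by
    intro i j k hij hik hjk
    rw [← h₁ ![i, j, k] (by intro a b hab; fin_cases a <;> fin_cases b <;> simp_all)]
    simp
  have h2 : ∀ i j k l, i ≠ j → i ≠ k → i ≠ l → j ≠ k → j ≠ l → k ≠ l →
      pexp (fun σ => g (σ i) (σ j) * g (σ k) (σ l)) = c₂ := by
    intro i j k l hij hik hil hjk hjl hkl
    rw [← h₂ ![i, j, k, l] (by intro a b hab; fin_cases a <;> fin_cases b <;> simp_all)]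
    simp
  refine ⟨c₀, c₁, c₂, fun i j k l hij hkl => ?_⟩
  unfold pairMoment
  by_cases hik : i = k
  · subst hik
    by_cases hjl : j = l
    · subst hjl
      rw [h0 i j hij]; simp [hij, hij.symm]; ring
    · rw [h1 i j l hij hkl hjl]; simp [hij.symm, hkl, hjl]
  · by_cases hil : i = l
    · subst hil
      have hs : (fun σ : Equiv.Perm V => g (σ i) (σ j) * g (σ k) (σ i)) =
          fun σ => g (σ i) (σ j) * g (σ i) (σ k) := by funext σ; rw [hg (σ k)]
      rw [hs]
      by_cases hjk : j = k
      · subst hjk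
        rw [h0 i j hij]; simp [hij, hij.symm]; ring
      · rw [h1 i j k hij hik hjk]; simp [hij.symm, hik, hjk]
    · by_cases hjk : j = k
      · subst hjk
        have hs : (fun σ : Equiv.Perm V => g (σ i) (σ j) * g (σ j) (σ l)) =
            fun σ => g (σ j) (σ i) * g (σ j) (σ l) := by funext σ; rw [hg (σ i)]
        rw [hs, h1 j i l hij.symm hkl hil]; simp [hij, hkl, hil]
      · by_cases hjl : j = l
        · subst hjl
          have hs : (fun σ : Equiv.Perm V => g (σ i) (σ j) * g (σ k) (σ j)) =
              fun σ => g (σ j) (σ i) * g (σ j) (σ k) := by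
            funext σ; rw [hg (σ i), hg (σ k)]
          rw [hs, h1 j i k hij.symm hjk hik]; simp [hij, hjk, hik]
        · rw [h2 i j k l hij hik hil hjk hjl hkl]; simp [hik, hil, hjk, hjl]

lemma pexp_quadratic_sq {g : V → V → ℝ} {c₀ c₁ c₂ : ℝ}
    (h : ∀ i j k l, i ≠ j → k ≠ l →
      pexp (fun σ => g (σ i) (σ j) * g (σ k) (σ l)) = pairMoment c₀ c₁ c₂ i j k l)
    {A : V → V → ℝ} (hA : ∀ i j, A i j = A j i) (hd : ∀ i, A i i = 0) :
    pexp (fun σ => (∑ i, ∑ j, A i j * g (σ i) (σ j)) ^ 2) =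
      c₂ * (∑ i, rowSum A i) ^ 2 + 4 * (c₁ - c₂) * ∑ i, rowSum A i ^ 2 +
        2 * (c₀ - 2 * c₁ + c₂) * ∑ i, ∑ j, A i j ^ 2 := by
  rw [← sum_pairMoment c₀ c₁ c₂ hA]
  have : (fun σ : Equiv.Perm V => (∑ i, ∑ j, A i j * g (σ i) (σ j)) ^ 2) =
      fun σ => ∑ i, ∑ j, ∑ k, ∑ l, (A i j * A k l) * (g (σ i) (σ j) * g (σ k) (σ l)) := by
    funext σ
    simp only [sq, Finset.sum_mul, Finset.mul_sum]
    exact Finset.sum_congr rfl fun i _ => Finset.sum_congr rfl fun j _ =>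
      Finset.sum_congr rfl fun k _ => Finset.sum_congr rfl fun l _ => by ring
  rw [this]
  simp only [pexp_sum, pexp_mul_left]
  refine Finset.sum_congr rfl fun i _ => Finset.sum_congr rfl fun j _ =>
      Finset.sum_congr rfl fun k _ => Finset.sum_congr rfl fun l _ => ?_
  by_cases hij : i = j
  · simp [hij, hd]
  by_cases hkl : k = l
  · simp [hkl, hd]
  rw [h i j k l hij hkl]

/-- This number counts ordered pairs of vertex-disjoint oriented edges, being `sum_pairMoment` for
`(c₀, c₁, c₂) = (0, 0, 1)`. -/
lemma IsAdj.disjoint_pairs_nonneg {A : V → V → ℝ} (hA : IsAdj A) :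
    0 ≤ (∑ i, rowSum A i) ^ 2 - 4 * ∑ i, rowSum A i ^ 2 + 2 * ∑ i, rowSum A i := by
  have h := sum_pairMoment 0 0 1 hA.symm
  simp only [hA.sq_eq] at h
  rw [show ∑ i, ∑ j, A i j = ∑ i, rowSum A i from rfl] at h
  have h' : 0 ≤ ∑ i, ∑ j, ∑ k, ∑ l, A i j * A k l * pairMoment 0 0 1 i j k l := by
    refine Finset.sum_nonneg fun i _ => Finset.sum_nonneg fun j _ => Finset.sum_nonneg fun k _ =>
      Finset.sum_nonneg fun l _ => ?_
    by_cases hij : i = j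
    · simp [hij, hA.diag]
    by_cases hkl : k = l
    · simp [hkl, hA.diag]
    refine mul_nonneg (mul_nonneg (hA.nonneg _ _) (hA.nonneg _ _)) ?_
    unfold pairMoment
    split_ifs <;> subst_vars <;> first | (exfalso; tauto) | norm_num
  linarith

end Permutation

/-! ### Effect of changing the set of selected times. -/

section Coupling

variable {V : Type*} [Fintype V] [DecidableEq V]
variable {E : Type*} [NormedAddCommGroup E] [NormedSpace ℝ E]

/-- The second moment of the sum of an exchangeable array over the edges of a graph, bounded by
the second moments of an entry, of a row sum and of the total sum of the array. -/
lemma pexp_quadratic_sq_le {g : V → V → ℝ} (hg : ∀ v w, g v w = g w v)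
    (hN : 6 ≤ Fintype.card V) {C ρ θ : ℝ}
    (hC : ∀ i j, i ≠ j → pexp (fun σ => g (σ i) (σ j) ^ 2) ≤ C)
    (hρ : ∀ i, pexp (fun σ => (∑ j ∈ Finset.univ.erase i, g (σ i) (σ j)) ^ 2) ≤ ρ)
    (hθ : pexp (fun σ => (∑ i, ∑ j ∈ Finset.univ.erase i, g (σ i) (σ j)) ^ 2) ≤ θ)
    {A : V → V → ℝ} (hA : IsAdj A) :
    pexp (fun σ => (∑ i, ∑ j, A i j * g (σ i) (σ j)) ^ 2) ≤
      4 * (θ + 2 * (Fintype.card V : ℝ) ^ 2 * C) / (Fintype.card V : ℝ) ^ 4 *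
        (∑ i, rowSum A i) ^ 2 +
      8 * ρ / (Fintype.card V : ℝ) ^ 2 * ∑ i, rowSum A i ^ 2 + 2 * C * ∑ i, rowSum A i := by
  obtain ⟨c₀, c₁, c₂, h⟩ := exists_pexp_eq_pairMoment hg
  set N : ℝ := (Fintype.card V : ℝ) with hNdef
  have hN6 : (6 : ℝ) ≤ N := by rw [hNdef]; exact_mod_cast hN
  obtain ⟨i₀, j₀, hij₀⟩ : ∃ i j : V, i ≠ j :=
    Fintype.exists_ne_of_one_lt_card (by omega) (Classical.choice
      (Fintype.card_pos_iff.1 (by omega))) |>.imp fun a ha => ⟨_, ha⟩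
  have hc₀ : pexp (fun σ => g (σ i₀) (σ j₀) ^ 2) = c₀ := by
    have := h i₀ j₀ i₀ j₀ hij₀ hij₀
    simp only [← sq] at this
    rw [this]; unfold pairMoment; simp [hij₀, hij₀.symm]; ring
  have c₀0 : 0 ≤ c₀ := hc₀ ▸ pexp_nonneg fun σ => sq_nonneg _
  have c₀C : c₀ ≤ C := hc₀ ▸ hC i₀ j₀ hij₀
  have cardE : ((Finset.univ.erase i₀).card : ℝ) = N - 1 := by
    rw [Finset.card_erase_of_mem (Finset.mem_univ _), Finset.card_univ,
      Nat.cast_sub (by omega), Nat.cast_one]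
  have row : pexp (fun σ => (∑ j ∈ Finset.univ.erase i₀, g (σ i₀) (σ j)) ^ 2) =
      (N - 1) * c₀ + (N - 1) * (N - 2) * c₁ := by
    have : (fun σ : Equiv.Perm V => (∑ j ∈ Finset.univ.erase i₀, g (σ i₀) (σ j)) ^ 2) =
        fun σ => ∑ j ∈ Finset.univ.erase i₀, ∑ k ∈ Finset.univ.erase i₀,
          g (σ i₀) (σ j) * g (σ i₀) (σ k) := by
      funext σ; rw [sq, Finset.sum_mul_sum]
    rw [this]
    simp only [pexp_sum]
    have : ∀ j ∈ Finset.univ.erase i₀, ∑ k ∈ Finset.univ.erase i₀,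
        pexp (fun σ => g (σ i₀) (σ j) * g (σ i₀) (σ k)) = (N - 1) * c₁ + (c₀ - c₁) := by
      intro j hj
      have e : ∀ k ∈ Finset.univ.erase i₀, pexp (fun σ => g (σ i₀) (σ j) * g (σ i₀) (σ k)) =
          c₁ + if j = k then c₀ - c₁ else 0 := by
        intro k hk
        have hj' := Finset.ne_of_mem_erase hj
        have hk' := Finset.ne_of_mem_erase hk
        rw [h i₀ j i₀ k hj'.symm hk'.symm]
        unfold pairMoment
        by_cases hjk : j = k
        · simp [hjk, hk', hk'.symm]; ring
        · simp [hjk, hk'.symm, hj']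
      rw [Finset.sum_congr rfl e, Finset.sum_add_distrib, Finset.sum_const, nsmul_eq_mul, cardE,
        Finset.sum_ite_eq, if_pos hj]
    rw [Finset.sum_congr rfl this, Finset.sum_const, nsmul_eq_mul, cardE]
    ring
  -- The total sum of the array is its sum over the complete graph, so the general formula expresses
  -- its second moment through `c₀`, `c₁`, `c₂`. Together with the row sum this yields upper bounds
  -- for `c₁` and `c₂`.
  set J : V → V → ℝ := fun i j => if i = j then 0 else 1 with hJ
  have rowJ : ∀ i, rowSum J i = N - 1 := by
    intro i
    have : ∀ j, J i j = 1 - if i = j then 1 else 0 := fun j => by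
      simp only [hJ]; split_ifs <;> norm_num
    simp [rowSum, this, hNdef]
  have tot := pexp_quadratic_sq h (A := J) (fun i j => by simp only [hJ, eq_comm])
    (fun i => by simp [hJ])
  have J2 : ∑ i, ∑ j, J i j ^ 2 = N * (N - 1) := by
    have : ∀ i j, J i j ^ 2 = J i j := fun i j => by simp only [hJ]; split_ifs <;> norm_num
    simp only [this]
    change ∑ i, rowSum J i = _
    simp [rowJ, hNdef]; ring
  have Jg : ∀ σ : Equiv.Perm V, ∑ i, ∑ j, J i j * g (σ i) (σ j) =
      ∑ i, ∑ j ∈ Finset.univ.erase i, g (σ i) (σ j) := by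
    intro σ
    refine Finset.sum_congr rfl fun i _ => ?_
    rw [← Finset.add_sum_erase _ _ (Finset.mem_univ i)]
    simp only [hJ, if_true, zero_mul, zero_add]
    refine Finset.sum_congr rfl fun j hj => ?_
    rw [if_neg (Finset.ne_of_mem_erase hj).symm, one_mul]
  simp only [Jg, J2, rowJ, Finset.sum_const, Finset.card_univ, nsmul_eq_mul] at tot
  rw [← hNdef] at tot
  have hρ' := hρ i₀
  rw [row] at hρ'
  have ρ0 : 0 ≤ ρ := (pexp_nonneg fun σ => sq_nonneg _).trans (hρ i₀)
  have θ0 : 0 ≤ θ := (pexp_nonneg fun σ => sq_nonneg _).trans hθ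
  rw [tot] at hθ
  have row0 : 0 ≤ (N - 1) * c₀ + (N - 1) * (N - 2) * c₁ := row ▸ pexp_nonneg fun σ => sq_nonneg _
  have hc₁ : c₁ ≤ 2 * ρ / N ^ 2 := by
    rw [le_div_iff₀ (by positivity)]
    by_cases hneg : c₁ ≤ 0
    · nlinarith [sq_nonneg N]
    · push Not at hneg
      have : N ^ 2 ≤ 2 * ((N - 1) * (N - 2)) := by nlinarith
      nlinarith [mul_nonneg (by linarith : 0 ≤ N - 1) c₀0]
  have hc₂ : c₂ ≤ 4 * (θ + 2 * N ^ 2 * C) / N ^ 4 := by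
    rw [le_div_iff₀ (by positivity)]
    by_cases hneg : c₂ ≤ 0
    · have : 0 ≤ 4 * (θ + 2 * N ^ 2 * C) := by
        have : 0 ≤ C := c₀0.trans c₀C
        positivity
      nlinarith [pow_nonneg (by linarith : (0:ℝ) ≤ N) 4]
    · push Not at hneg
      -- The total contains `4N(N-1)(N-2) c₁`, which `4N` times the nonnegative row moment bounds
      -- below by `-4N(N-1) c₀`.
      have h1 : N * (N - 1) * (N - 2) * (N - 3) * c₂ ≤ θ + 2 * N * (N - 1) * c₀ := by
        nlinarith [mul_nonneg (by linarith : 0 ≤ N) row0]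
      have h2 : 2 * N * (N - 1) * c₀ ≤ 2 * N ^ 2 * C := by
        calc 2 * N * (N - 1) * c₀ ≤ 2 * N * N * C := by gcongr; linarith
          _ = _ := by ring
      -- Among the integers `N > 3` this holds exactly from `N = 6` on, which explains the size
      -- assumption.
      have h3 : N ^ 4 ≤ 4 * (N * (N - 1) * (N - 2) * (N - 3)) := by
        have : N ^ 3 ≤ 4 * ((N - 1) * (N - 2) * (N - 3)) := by
          obtain ⟨x, hx⟩ : ∃ x, N = x + 6 := ⟨N - 6, by ring⟩
          have : 0 ≤ x := by linarith
          rw [hx]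
          nlinarith [pow_nonneg this 3, pow_nonneg this 2]
        nlinarith
      nlinarith
  have d2 : ∑ i, rowSum A i ≤ ∑ i, rowSum A i ^ 2 :=
    Finset.sum_le_sum fun i _ => hA.rowSum_le_sq i
  have S0 : 0 ≤ ∑ i, rowSum A i := Finset.sum_nonneg fun i _ => hA.rowSum_nonneg i
  rw [pexp_quadratic_sq h hA.symm hA.diag]
  simp only [hA.sq_eq]
  rw [show ∑ i, ∑ j, A i j = ∑ i, rowSum A i from rfl]
  set S := ∑ i, rowSum A i
  set Q := ∑ i, rowSum A i ^ 2
  -- The second moment regroups as `c₂(S² - 4Q + 2S) + 4c₁(Q - S) + 2c₀S`. All three multiplicities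
  -- are nonnegative, so upper bounds on the `c`'s suffice.
  have K2 : 0 ≤ S ^ 2 - 4 * Q + 2 * S := hA.disjoint_pairs_nonneg
  set C₂ := 4 * (θ + 2 * N ^ 2 * C) / N ^ 4
  set C₁ := 2 * ρ / N ^ 2 with hC₁
  have C₂0 : 0 ≤ C₂ := by
    have : 0 ≤ C := c₀0.trans c₀C
    positivity
  have C₁0 : 0 ≤ C₁ := by positivity
  have e : 8 * ρ / N ^ 2 = 4 * C₁ := by rw [hC₁]; ring
  rw [e]
  have m2 : c₂ * (S ^ 2 - 4 * Q + 2 * S) ≤ C₂ * S ^ 2 :=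
    calc _ ≤ C₂ * (S ^ 2 - 4 * Q + 2 * S) := by gcongr
      _ ≤ C₂ * S ^ 2 := by gcongr; linarith
  have m1 : c₁ * (Q - S) ≤ C₁ * Q :=
    calc _ ≤ C₁ * (Q - S) := mul_le_mul_of_nonneg_right hc₁ (by linarith)
      _ ≤ C₁ * Q := by gcongr; linarith
  have m0 : c₀ * S ≤ C * S := by gcongr
  linarith

lemma sum_xi (p : ℝ) (B : Finset V) : ∑ i, xi p B i = B.card - p * Fintype.card V := by
  simp only [xi, Finset.sum_sub_distrib, Finset.sum_ite_mem, Finset.univ_inter, Finset.sum_const,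
    Finset.card_univ, nsmul_eq_mul, mul_one]
  ring

lemma sum_xi_sq (p : ℝ) (B : Finset V) :
    ∑ i, xi p B i ^ 2 = Fintype.card V * (p * (1 - p)) + (1 - 2 * p) * ∑ i, xi p B i := by
  simp only [xi_sq, Finset.sum_add_distrib, Finset.sum_const, Finset.card_univ, nsmul_eq_mul,
    ← Finset.mul_sum]

/-- For nested sets the difference of the indicators has one sign and absolute value 0 or 1, so its
square is its absolute value. -/
lemma sum_xi_sub_sq {p : ℝ} {B B' : Finset V} (h : B ⊆ B' ∨ B' ⊆ B) :
    ∑ i, (xi p B' i - xi p B i) ^ 2 = |∑ i, xi p B' i - ∑ i, xi p B i| := by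
  wlog hs : B ⊆ B' generalizing B B'
  · rw [abs_sub_comm, ← this h.symm (h.resolve_left hs)]
    exact Finset.sum_congr rfl fun i _ => by ring
  have : ∀ i, (xi p B' i - xi p B i) ^ 2 = xi p B' i - xi p B i := by
    intro i
    unfold xi
    by_cases h1 : i ∈ B
    · simp [h1, hs h1]
    · by_cases h2 : i ∈ B' <;> simp [h1, h2]
  have h0 : 0 ≤ ∑ i, (xi p B' i - xi p B i) ^ 2 := by positivity
  rw [← Finset.sum_sub_distrib]
  simp only [this] at h0 ⊢
  rw [abs_of_nonneg h0]

/-- Replacing the selected times `B` by a comparable set `B'` changes a linear statistic little. -/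
lemma pexp_linear_change_sq_le {p : ℝ} {B B' : Finset V} (h : B ⊆ B' ∨ B' ⊆ B)
    (hB : ∑ i, xi p B i = 0) {c : V → ℝ} (hc : ∑ i, c i = 0) :
    pexp (fun σ => (∑ i, c i * xi p B' (σ i) - ∑ i, c i * xi p B (σ i)) ^ 2) ≤
      2 * (∑ i, c i ^ 2) * (|∑ i, xi p B' i| / Fintype.card V) := by
  have := pexp_linear_sq_le (fun v => xi p B' v - xi p B v) hc
  rw [sum_xi_sub_sq h, hB, sub_zero] at this
  simpa only [← Finset.sum_sub_distrib, ← mul_sub] using this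

/-- Replacing the selected times `B` by a comparable set `B'` changes a quadratic statistic
little. -/
lemma pexp_quadratic_change_sq_le {p : ℝ} (h0 : 0 ≤ p) (h1 : p ≤ 1) {B B' : Finset V}
    (h : B ⊆ B' ∨ B' ⊆ B) (hB : ∑ i, xi p B i = 0) (hN : 6 ≤ Fintype.card V)
    {A : V → V → ℝ} (hA : IsAdj A) :
    pexp (fun σ => (∑ i, ∑ j, A i j * (xi p B' (σ i) * xi p B' (σ j)) -
        ∑ i, ∑ j, A i j * (xi p B (σ i) * xi p B (σ j))) ^ 2) ≤
      4 * ((2 * (∑ i, xi p B' i) ^ 4 + 2 * (∑ i, xi p B' i) ^ 2) +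
        2 * (Fintype.card V : ℝ) ^ 2 * (4 * |∑ i, xi p B' i| / Fintype.card V)) /
        (Fintype.card V : ℝ) ^ 4 * (∑ i, rowSum A i) ^ 2 +
      8 * (2 * (∑ i, xi p B' i) ^ 2 + 8) / (Fintype.card V : ℝ) ^ 2 * ∑ i, rowSum A i ^ 2 +
      2 * (4 * |∑ i, xi p B' i| / Fintype.card V) * ∑ i, rowSum A i := by
  set f := xi p B with hf
  set f' := xi p B' with hf'
  set m := ∑ i, f' i with hm
  have bf : ∀ v, |f v| ≤ 1 := abs_xi_le h0 h1 B
  have bf' : ∀ v, |f' v| ≤ 1 := abs_xi_le h0 h1 B'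
  set g : V → V → ℝ := fun v w => f' v * f' w - f v * f w with hg
  -- As `∑ f = 0`, a full row of `g` is just `f'(σ i) m`; the other terms remove the diagonal entry.
  -- Row sums are thus of size `|m| + 2`, and the total sum is `m² - (1 - 2p) m`.
  have rowg : ∀ (σ : Equiv.Perm V) i, ∑ j ∈ Finset.univ.erase i, g (σ i) (σ j) =
      f' (σ i) * m - f' (σ i) ^ 2 + f (σ i) ^ 2 := by
    intro σ i
    have e := Finset.add_sum_erase Finset.univ (fun j => g (σ i) (σ j)) (Finset.mem_univ i)
    have e2 : ∑ j, g (σ i) (σ j) = f' (σ i) * m := by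
      simp only [hg, Finset.sum_sub_distrib, ← Finset.mul_sum, Equiv.sum_comp, hB, mul_zero,
        sub_zero, hm]
    have e3 : g (σ i) (σ i) = f' (σ i) ^ 2 - f (σ i) ^ 2 := by simp only [hg]; ring
    rw [e2] at e
    linarith
  have key := pexp_quadratic_sq_le (g := g) (fun v w => by simp only [hg]; ring) hN
    (C := 4 * |m| / Fintype.card V) (ρ := 2 * m ^ 2 + 8) (θ := 2 * m ^ 4 + 2 * m ^ 2)
    ?_ ?_ ?_ hA
  · simpa only [hg, mul_sub, Finset.sum_sub_distrib] using key
  · intro i j _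
    have hb : ∀ σ : Equiv.Perm V, g (σ i) (σ j) ^ 2 ≤
        2 * (f' (σ i) - f (σ i)) ^ 2 + 2 * (f' (σ j) - f (σ j)) ^ 2 := by
      intro σ
      have e : g (σ i) (σ j) = (f' (σ i) - f (σ i)) * f' (σ j) + f (σ i) * (f' (σ j) - f (σ j)) := by
        simp only [hg]; ring
      have b1 : f' (σ j) ^ 2 ≤ 1 := by
        rw [← sq_abs]; exact pow_le_one₀ (abs_nonneg _) (bf' _)
      have b2 : f (σ i) ^ 2 ≤ 1 := by
        rw [← sq_abs]; exact pow_le_one₀ (abs_nonneg _) (bf _)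
      have q1 := mul_le_mul_of_nonneg_left b1 (sq_nonneg (f' (σ i) - f (σ i)))
      have q2 := mul_le_mul_of_nonneg_left b2 (sq_nonneg (f' (σ j) - f (σ j)))
      rw [e]
      nlinarith [sq_nonneg ((f' (σ i) - f (σ i)) * f' (σ j) - f (σ i) * (f' (σ j) - f (σ j)))]
    refine (pexp_mono hb).trans (le_of_eq ?_)
    rw [pexp_add, pexp_mul_left, pexp_mul_left, pexp_apply (fun v => (f' v - f v) ^ 2),
      pexp_apply (fun v => (f' v - f v) ^ 2), sum_xi_sub_sq h, hB, sub_zero]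
    ring
  · intro i
    rw [← pexp_const (V := V) (2 * m ^ 2 + 8)]
    refine pexp_mono fun σ => ?_
    rw [rowg, ← sq_abs]
    have b : |f' (σ i) * m - f' (σ i) ^ 2 + f (σ i) ^ 2| ≤ |m| + 2 := by
      refine (abs_add_le _ _).trans ?_
      have a1 := abs_sub (f' (σ i) * m) (f' (σ i) ^ 2)
      have a2 : |f' (σ i) * m| ≤ |m| := by
        rw [abs_mul]; exact mul_le_of_le_one_left (abs_nonneg _) (bf' _)
      have a3 : |f' (σ i) ^ 2| ≤ 1 := by
        rw [abs_pow]; exact pow_le_one₀ (abs_nonneg _) (bf' _)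
      have a4 : |f (σ i) ^ 2| ≤ 1 := by
        rw [abs_pow]; exact pow_le_one₀ (abs_nonneg _) (bf _)
      linarith
    refine (pow_le_pow_left₀ (abs_nonneg _) b 2).trans ?_
    nlinarith [sq_abs m, sq_nonneg (|m| - 2)]
  · rw [← pexp_const (V := V) (2 * m ^ 4 + 2 * m ^ 2)]
    refine pexp_mono fun σ => ?_
    have e : ∑ i, ∑ j ∈ Finset.univ.erase i, g (σ i) (σ j) = m ^ 2 - (1 - 2 * p) * m := by
      simp only [rowg, Finset.sum_add_distrib, Finset.sum_sub_distrib, ← Finset.sum_mul]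
      rw [Equiv.sum_comp σ f', Equiv.sum_comp σ (fun v => f' v ^ 2),
        Equiv.sum_comp σ (fun v => f v ^ 2), hf, hf', sum_xi_sq, sum_xi_sq, ← hf, ← hf', hB, ← hm]
      ring
    rw [e]
    have hq : (1 - 2 * p) ^ 2 ≤ 1 := by nlinarith
    have := mul_le_mul_of_nonneg_left hq (sq_nonneg m)
    nlinarith [sq_nonneg (m ^ 2 + (1 - 2 * p) * m)]

end Coupling

/-! ### The coupling of independent selection with permutation selection. -/

section JointLaw

variable {V : Type*} [Fintype V] [DecidableEq V]
variable {E : Type*} [NormedAddCommGroup E] [NormedSpace ℝ E]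

/-- The binomial weights. -/
def binWeight (V : Type*) [Fintype V] (p : ℝ) (k : ℕ) : ℝ :=
  (Fintype.card V).choose k * (p ^ k * (1 - p) ^ (Fintype.card V - k))

/-- The expectation under a uniform permutation `σ` and an independent binomial variable `k`. -/
def jexp (p : ℝ) (F : Equiv.Perm V → ℕ → E) : E :=
  ∑ k ∈ Finset.range (Fintype.card V + 1), binWeight V p k • pexp (fun σ => F σ k)

/-- The set of observations that the permutation `σ` places into `B`. -/
def pre (σ : Equiv.Perm V) (B : Finset V) : Finset V := Finset.univ.filter fun i => σ i ∈ B

lemma mem_pre {σ : Equiv.Perm V} {B : Finset V} {i : V} : i ∈ pre σ B ↔ σ i ∈ B := by simp [pre]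

lemma xi_pre (p : ℝ) (σ : Equiv.Perm V) (B : Finset V) (i : V) :
    xi p (pre σ B) i = xi p B (σ i) := by
  simp [xi, mem_pre]

lemma card_pre (σ : Equiv.Perm V) (B : Finset V) : (pre σ B).card = B.card := by
  refine Finset.card_bij (fun i _ => σ i) (fun i hi => mem_pre.1 hi)
    (fun i _ j _ h => σ.injective h) (fun v hv => ⟨σ.symm v, ?_, by simp⟩)
  rw [mem_pre]; simpa using hv

/-- Some permutation maps `B` onto `B'`, and composing with it on the left preserves the uniform
law. -/
lemma pexp_pre_eq_of_card_eq (F : Finset V → E) {B B' : Finset V} (h : B.card = B'.card) :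
    pexp (fun σ => F (pre σ B)) = pexp (fun σ => F (pre σ B')) := by
  have e : {x // x ∈ B} ≃ {x // x ∈ B'} := Fintype.equivOfCardEq (by simpa using h)
  have hsub : pre e.extendSubtype B' = B := by
    symm
    refine Finset.eq_of_subset_of_card_le (fun x hx => ?_) (by rw [card_pre, h])
    rw [mem_pre]
    exact e.extendSubtype_mem x hx
  rw [← pexp_mul_perm_left (fun σ => F (pre σ B')) e.extendSubtype]
  refine congrArg pexp (funext fun σ => congrArg F ?_)
  ext i
  rw [mem_pre, mem_pre]
  conv_lhs => rw [← hsub]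
  rw [mem_pre]; rfl

/-- The preimage of `B` is a uniform set of its size: sum over all `B'` of that size, and note that
each fixed `σ` merely permutes these sets. -/
lemma card_smul_pexp_pre (F : Finset V → E) (B : Finset V) :
    ((Fintype.card V).choose B.card : ℝ) • pexp (fun σ => F (pre σ B)) =
      ∑ s with s.card = B.card, F s := by
  have h1 : ∑ B' : Finset V with B'.card = B.card, pexp (fun σ => F (pre σ B')) =
      ((Fintype.card V).choose B.card : ℝ) • pexp (fun σ => F (pre σ B)) := by
    rw [Finset.sum_congr rfl fun B' hB' =>
      pexp_pre_eq_of_card_eq F (by simpa using hB' : B'.card = B.card), Finset.sum_const,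
      Nat.cast_smul_eq_nsmul]
    congr 1
    rw [← Finset.card_univ, ← Finset.card_powersetCard]
    congr 1
    ext s; simp
  rw [← h1, ← pexp_sum]
  have h2 : ∀ σ : Equiv.Perm V, ∑ B' : Finset V with B'.card = B.card, F (pre σ B') =
      ∑ s : Finset V with s.card = B.card, F s := by
    intro σ
    refine Finset.sum_nbij' (fun s => pre σ s) (fun s => pre σ⁻¹ s) ?_ ?_ ?_ ?_ ?_
    · intro s hs; simpa [card_pre] using hs
    · intro s hs; simpa [card_pre] using hs
    · intro s _; ext i; simp [mem_pre]
    · intro s _; ext i; simp [mem_pre]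
    · intro s _; rfl
  simp only [h2, pexp_const]

/-- Selecting `σ⁻¹ (B k)` for a uniform permutation `σ` and an independent binomial `k` amounts to
selecting each point independently. -/
lemma jexp_pre (p : ℝ) {B : ℕ → Finset V} (hB : ∀ k ≤ Fintype.card V, (B k).card = k)
    (F : Finset V → E) : jexp p (fun σ k => F (pre σ (B k))) = bexp p F := by
  rw [jexp, bexp, ← Finset.sum_fiberwise_of_maps_to (s := Finset.univ)
    (t := Finset.range (Fintype.card V + 1)) (g := fun s : Finset V => s.card)
    (fun s _ => Finset.mem_range.2 (Nat.lt_succ_of_le (Finset.card_le_univ s)))]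
  refine Finset.sum_congr rfl fun k hk => ?_
  have hk' := hB k (Nat.lt_succ_iff.1 (Finset.mem_range.1 hk))
  have := card_smul_pexp_pre F (B k)
  rw [hk'] at this
  rw [binWeight, mul_comm, mul_smul, this, Finset.smul_sum]
  refine Finset.sum_congr rfl fun s hs => ?_
  have hs : s.card = k := by simpa using hs
  rw [bweight, hs]

lemma jexp_perm (p : ℝ) (F : Equiv.Perm V → E) : jexp p (fun σ _ => F σ) = pexp F := by
  have h : ∑ k ∈ Finset.range (Fintype.card V + 1), binWeight V p k = 1 := by
    have := add_pow p (1 - p) (Fintype.card V)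
    rw [add_sub_cancel, one_pow] at this
    rw [this]
    exact Finset.sum_congr rfl fun k _ => mul_comm _ _
  rw [jexp, ← Finset.sum_smul, h, one_smul]

lemma binWeight_nonneg {p : ℝ} (h0 : 0 ≤ p) (h1 : p ≤ 1) (k : ℕ) : 0 ≤ binWeight V p k := by
  have := sub_nonneg.2 h1
  unfold binWeight; positivity

lemma jexp_le_bexp_card {p : ℝ} (h0 : 0 ≤ p) (h1 : p ≤ 1) {B : ℕ → Finset V}
    (hB : ∀ k ≤ Fintype.card V, (B k).card = k) {F : Equiv.Perm V → ℕ → ℝ} {G : ℕ → ℝ}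
    (h : ∀ k ≤ Fintype.card V, pexp (fun σ => F σ k) ≤ G k) :
    jexp p F ≤ bexp (V := V) p (fun s => G s.card) := by
  rw [← jexp_pre p hB]
  refine Finset.sum_le_sum fun k hk => ?_
  have hk' := Nat.lt_succ_iff.1 (Finset.mem_range.1 hk)
  simp only [card_pre, hB k hk', pexp_const]
  exact mul_le_mul_of_nonneg_left (h k hk') (binWeight_nonneg h0 h1 k)

lemma jexp_mono {p : ℝ} (h0 : 0 ≤ p) (h1 : p ≤ 1) {F G : Equiv.Perm V → ℕ → ℝ}
    (h : ∀ σ k, F σ k ≤ G σ k) : jexp p F ≤ jexp p G :=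
  Finset.sum_le_sum fun k _ =>
    mul_le_mul_of_nonneg_left (pexp_mono fun σ => h σ k) (binWeight_nonneg h0 h1 k)

lemma jexp_add (p : ℝ) (F G : Equiv.Perm V → ℕ → E) :
    jexp p (fun σ k => F σ k + G σ k) = jexp p F + jexp p G := by
  simp only [jexp, pexp_add, smul_add, Finset.sum_add_distrib]

lemma jexp_sub (p : ℝ) (F G : Equiv.Perm V → ℕ → E) :
    jexp p (fun σ k => F σ k - G σ k) = jexp p F - jexp p G := by
  simp only [jexp, pexp_sub, smul_sub, Finset.sum_sub_distrib]

lemma jexp_mul_left (p c : ℝ) (F : Equiv.Perm V → ℕ → ℝ) :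
    jexp p (fun σ k => c * F σ k) = c * jexp p F := by
  simp only [jexp, pexp_mul_left, Finset.mul_sum, smul_eq_mul]
  exact Finset.sum_congr rfl fun k _ => by ring

lemma jexp_nonneg {p : ℝ} (h0 : 0 ≤ p) (h1 : p ≤ 1) {F : Equiv.Perm V → ℕ → ℝ}
    (h : ∀ σ k, 0 ≤ F σ k) : 0 ≤ jexp p F :=
  Finset.sum_nonneg fun k _ => mul_nonneg (binWeight_nonneg h0 h1 k) (pexp_nonneg fun σ => h σ k)

lemma norm_jexp_le {p : ℝ} (h0 : 0 ≤ p) (h1 : p ≤ 1) (F : Equiv.Perm V → ℕ → E) :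
    ‖jexp p F‖ ≤ jexp p (fun σ k => ‖F σ k‖) := by
  refine (norm_sum_le _ _).trans (Finset.sum_le_sum fun k _ => ?_)
  rw [norm_smul, Real.norm_of_nonneg (binWeight_nonneg h0 h1 k), smul_eq_mul]
  exact mul_le_mul_of_nonneg_left (norm_pexp_le _) (binWeight_nonneg h0 h1 k)

/-- The Cauchy-Schwarz inequality. -/
lemma abs_jexp_mul_le {p : ℝ} (h0 : 0 ≤ p) (h1 : p ≤ 1) (F G : Equiv.Perm V → ℕ → ℝ) :
    |jexp p (fun σ k => F σ k * G σ k)| ≤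
      √(jexp p (fun σ k => F σ k ^ 2)) * √(jexp p (fun σ k => G σ k ^ 2)) := by
  have hF : 0 ≤ jexp p (fun σ k => F σ k ^ 2) := jexp_nonneg h0 h1 fun _ _ => sq_nonneg _
  rw [← Real.sqrt_mul hF]
  refine Real.abs_le_sqrt ?_
  have h : ∀ x : ℝ, 0 ≤ jexp p (fun σ k => F σ k ^ 2) * (x * x) +
      (2 * jexp p (fun σ k => F σ k * G σ k)) * x + jexp p (fun σ k => G σ k ^ 2) := by
    intro x
    have hn : 0 ≤ jexp p (fun σ k => (x * F σ k + G σ k) ^ 2) :=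
      jexp_nonneg h0 h1 fun _ _ => sq_nonneg _
    have e : (fun (σ : Equiv.Perm V) k => (x * F σ k + G σ k) ^ 2) = fun σ k =>
        ((x * x) * F σ k ^ 2 + (2 * x) * (F σ k * G σ k)) + G σ k ^ 2 := by
      funext σ k; ring
    rw [e, jexp_add, jexp_add, jexp_mul_left, jexp_mul_left] at hn
    linarith
  have := discrim_le_zero h
  rw [discrim] at this
  linarith

lemma jexp_abs_le_sqrt {p : ℝ} (h0 : 0 ≤ p) (h1 : p ≤ 1) (F : Equiv.Perm V → ℕ → ℝ) :
    jexp p (fun σ k => |F σ k|) ≤ √(jexp p (fun σ k => F σ k ^ 2)) := by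
  have := abs_jexp_mul_le h0 h1 (fun σ k => |F σ k|) (fun _ _ => 1)
  have h : jexp (V := V) p (fun _ _ => (1 : ℝ)) = 1 := by rw [jexp_perm, pexp_const]
  simp only [mul_one, one_pow, h, Real.sqrt_one, sq_abs] at this
  exact (le_abs_self _).trans this

/-- The mean square difference between a statistic of the independent selection and the same
statistic of the permutation selection, under the coupling. -/
def gap (p : ℝ) (B : ℕ → Finset V) (k₀ : ℕ) (X : Finset V → ℝ) : ℝ :=
  jexp p (fun σ k => (X (pre σ (B k)) - X (pre σ (B k₀))) ^ 2)

variable {p : ℝ} {B : ℕ → Finset V}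

lemma gap_nonneg (h0 : 0 ≤ p) (h1 : p ≤ 1) (k₀ : ℕ) (X : Finset V → ℝ) : 0 ≤ gap p B k₀ X :=
  jexp_nonneg h0 h1 fun _ _ => sq_nonneg _

lemma gap_const_mul (k₀ : ℕ) (c : ℝ) (X : Finset V → ℝ) :
    gap p B k₀ (fun s => c * X s) = c ^ 2 * gap p B k₀ X := by
  rw [gap, gap, ← jexp_mul_left]
  simp only [← mul_sub, mul_pow]

lemma gap_add_le (h0 : 0 ≤ p) (h1 : p ≤ 1) (k₀ : ℕ) (X Y : Finset V → ℝ) :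
    gap p B k₀ (fun s => X s + Y s) ≤ 2 * gap p B k₀ X + 2 * gap p B k₀ Y := by
  rw [gap, gap, gap, ← jexp_mul_left, ← jexp_mul_left, ← jexp_add]
  refine jexp_mono h0 h1 fun σ k => ?_
  nlinarith [sq_nonneg ((X (pre σ (B k)) - X (pre σ (B k₀))) -
    (Y (pre σ (B k)) - Y (pre σ (B k₀))))]

lemma norm_charFun_pre_sub_le (h0 : 0 ≤ p) (h1 : p ≤ 1)
    (hB : ∀ k ≤ Fintype.card V, (B k).card = k) (k₀ : ℕ) (X : Finset V → ℝ) :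
    ‖pexp (fun σ => Complex.exp (X (pre σ (B k₀)) * Complex.I)) -
      bexp p (fun s => Complex.exp (X s * Complex.I))‖ ≤ √(gap p B k₀ X) := by
  rw [← jexp_pre p hB, ← jexp_perm p, ← jexp_sub]
  refine (norm_jexp_le h0 h1 _).trans ((jexp_mono h0 h1 fun σ k => ?_).trans
    (jexp_abs_le_sqrt h0 h1 fun σ k => X (pre σ (B k)) - X (pre σ (B k₀))))
  set x := X (pre σ (B k))
  set y := X (pre σ (B k₀))
  have e : Complex.exp (y * Complex.I) - Complex.exp (x * Complex.I) =
      -(Complex.exp (y * Complex.I) * (Complex.exp ((x - y : ℝ) * Complex.I) - 1)) := by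
    rw [mul_sub, ← Complex.exp_add, mul_one, neg_sub]
    congr 2; push_cast; ring
  rw [e, norm_neg, norm_mul, Complex.norm_exp_ofReal_mul_I, one_mul]
  exact norm_exp_mul_I_sub_one_le _

/-- With `x, y` from the independent and `x', y'` from the permutation selection, `xy - x'y' = x(y -
y') + (x - x')y - (x - x')(y - y')`; then Cauchy-Schwarz. Thus second moments under independent
selection and the gaps control permutation covariances. -/
lemma abs_pexp_mul_sub_le (h0 : 0 ≤ p) (h1 : p ≤ 1)
    (hB : ∀ k ≤ Fintype.card V, (B k).card = k) (k₀ : ℕ) (X Y : Finset V → ℝ) :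
    |pexp (fun σ => X (pre σ (B k₀)) * Y (pre σ (B k₀))) - bexp p (fun s => X s * Y s)| ≤
      √(bexp p (fun s => X s ^ 2)) * √(gap p B k₀ Y) +
      √(gap p B k₀ X) * √(bexp p (fun s => Y s ^ 2)) + √(gap p B k₀ X) * √(gap p B k₀ Y) := by
  have e : bexp p (fun s => X s * Y s) - pexp (fun σ => X (pre σ (B k₀)) * Y (pre σ (B k₀))) =
      jexp p (fun σ k => X (pre σ (B k)) * (Y (pre σ (B k)) - Y (pre σ (B k₀)))) +
      jexp p (fun σ k => (X (pre σ (B k)) - X (pre σ (B k₀))) * Y (pre σ (B k))) -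
      jexp p (fun σ k => (X (pre σ (B k)) - X (pre σ (B k₀))) *
        (Y (pre σ (B k)) - Y (pre σ (B k₀)))) := by
    rw [← jexp_pre p hB, ← jexp_perm p, ← jexp_sub, ← jexp_add, ← jexp_sub]
    refine congrArg (jexp p) (funext fun σ => funext fun k => ?_)
    ring
  have a1 := abs_jexp_mul_le h0 h1 (fun σ k => X (pre σ (B k)))
    (fun σ k => Y (pre σ (B k)) - Y (pre σ (B k₀)))
  have a2 := abs_jexp_mul_le h0 h1 (fun σ k => X (pre σ (B k)) - X (pre σ (B k₀)))
    (fun σ k => Y (pre σ (B k)))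
  have a3 := abs_jexp_mul_le h0 h1 (fun σ k => X (pre σ (B k)) - X (pre σ (B k₀)))
    (fun σ k => Y (pre σ (B k)) - Y (pre σ (B k₀)))
  rw [jexp_pre p hB (fun s => X s ^ 2)] at a1
  rw [jexp_pre p hB (fun s => Y s ^ 2)] at a2
  rw [abs_sub_comm, e]
  refine (abs_sub _ _).trans (add_le_add ((abs_add_le _ _).trans (add_le_add a1 a2)) a3)

lemma bexp_sum_xi_sq_le (p : ℝ) :
    bexp (V := V) p (fun s => (∑ i, xi p s i) ^ 2) ≤ Fintype.card V := by
  have := bexp_linear_sq (V := V) p (fun _ => 1)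
  simp only [one_mul, one_pow, Finset.sum_const, Finset.card_univ, nsmul_eq_mul, mul_one] at this
  rw [this]
  exact mul_le_of_le_one_left (Nat.cast_nonneg _) (mul_one_sub_le_one p)

lemma bexp_abs_sum_xi_le (h0 : 0 ≤ p) (h1 : p ≤ 1) :
    bexp (V := V) p (fun s => |∑ i, xi p s i|) ≤ √(Fintype.card V) :=
  (bexp_abs_le_sqrt h0 h1 _).trans (Real.sqrt_le_sqrt (bexp_sum_xi_sq_le p))

lemma bexp_sum_xi_pow_four_le (h0 : 0 ≤ p) (h1 : p ≤ 1) :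
    bexp (V := V) p (fun s => (∑ i, xi p s i) ^ 4) ≤ 6 * (Fintype.card V : ℝ) ^ 2 := by
  have := bexp_linear_pow_four_le (V := V) h0 h1 (fun _ => 1)
  simpa only [one_mul, one_pow, Finset.sum_const, Finset.card_univ, nsmul_eq_mul, mul_one]
    using this

/-- A linear statistic of the permutation selection is close to that of the independent
selection. -/
lemma gap_linear_le (h0 : 0 ≤ p) (h1 : p ≤ 1) (hB : ∀ k ≤ Fintype.card V, (B k).card = k)
    (hmono : Monotone B) {k₀ : ℕ} (hk₀ : ∑ i, xi p (B k₀) i = 0) {c : V → ℝ}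
    (hc : ∑ i, c i = 0) :
    gap p B k₀ (fun s => ∑ i, c i * xi p s i) ≤ 2 * (∑ i, c i ^ 2) / √(Fintype.card V) := by
  set N : ℝ := (Fintype.card V : ℝ) with hN
  have step : gap p B k₀ (fun s => ∑ i, c i * xi p s i) ≤
      bexp (V := V) p (fun s => 2 * (∑ i, c i ^ 2) * (|(s.card : ℝ) - p * N| / N)) := by
    refine jexp_le_bexp_card h0 h1 hB (G := fun k => 2 * (∑ i, c i ^ 2) * (|(k : ℝ) - p * N| / N))
      fun k hk => ?_
    have := pexp_linear_change_sq_le (p := p) (B := B k₀) (B' := B k)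
      ((le_total k₀ k).imp (fun h => hmono h) (fun h => hmono h)) hk₀ hc
    rw [sum_xi, hB k hk] at this
    simpa only [xi_pre] using this
  refine step.trans ?_
  simp only [hN, ← sum_xi]
  rw [bexp_mul_left, div_eq_mul_inv (2 * ∑ i, c i ^ 2)]
  refine mul_le_mul_of_nonneg_left ?_ (by positivity)
  simp only [div_eq_inv_mul]
  rw [bexp_mul_left]
  have hi : 0 ≤ ((Fintype.card V : ℝ))⁻¹ := by positivity
  refine (mul_le_mul_of_nonneg_left (bexp_abs_sum_xi_le h0 h1) hi).trans ?_
  rw [← div_eq_inv_mul, Real.sqrt_div_self]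

/-- A quadratic statistic of the permutation selection is close to that of the independent
selection. -/
lemma gap_quadratic_le (h0 : 0 ≤ p) (h1 : p ≤ 1) (hB : ∀ k ≤ Fintype.card V, (B k).card = k)
    (hmono : Monotone B) {k₀ : ℕ} (hk₀ : ∑ i, xi p (B k₀) i = 0) (hN : 6 ≤ Fintype.card V)
    {A : V → V → ℝ} (hA : IsAdj A) :
    gap p B k₀ (fun s => ∑ i, ∑ j, A i j * (xi p s i * xi p s j)) ≤
      88 * (∑ i, rowSum A i) ^ 2 / (Fintype.card V : ℝ) ^ 2 +
      32 * (∑ i, rowSum A i ^ 2) / Fintype.card V +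
      8 * (∑ i, rowSum A i) / √(Fintype.card V) := by
  set N : ℝ := (Fintype.card V : ℝ) with hNdef
  have hN6 : (6 : ℝ) ≤ N := by rw [hNdef]; exact_mod_cast hN
  have hN0 : 0 < N := by linarith
  set S := ∑ i, rowSum A i with hS
  set Q := ∑ i, rowSum A i ^ 2 with hQ
  have S0 : 0 ≤ S := Finset.sum_nonneg fun i _ => hA.rowSum_nonneg i
  have Q0 : 0 ≤ Q := by positivity
  -- The bound for a fixed number `k` of selected times, sorted by powers of `m = k - pN`. For
  -- binomial `k` the moments of `m⁴`, `m²`, `|m|` are at most `6N²`, `N`, `√N`.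
  set G : ℝ → ℝ := fun m => (8 * S ^ 2 / N ^ 4) * m ^ 4 +
    (8 * S ^ 2 / N ^ 4 + 16 * Q / N ^ 2) * m ^ 2 + (32 * S ^ 2 / N ^ 3 + 8 * S / N) * |m| +
    64 * Q / N ^ 2 with hG
  have step : gap p B k₀ (fun s => ∑ i, ∑ j, A i j * (xi p s i * xi p s j)) ≤
      bexp (V := V) p (fun s => G ((s.card : ℝ) - p * N)) := by
    refine jexp_le_bexp_card h0 h1 hB (G := fun k => G ((k : ℝ) - p * N)) fun k hk => ?_
    have := pexp_quadratic_change_sq_le h0 h1 (B := B k₀) (B' := B k)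
      ((le_total k₀ k).imp (fun h => hmono h) (fun h => hmono h)) hk₀ hN hA
    rw [sum_xi, hB k hk] at this
    simp only [xi_pre]
    refine this.trans (le_of_eq ?_)
    simp only [hG, ← hNdef, ← hS, ← hQ]
    field_simp
    ring
  refine step.trans ?_
  simp only [hNdef, ← sum_xi]
  simp only [hG, bexp_add, bexp_mul_left, bexp_const, ← hNdef]
  have m4 := bexp_sum_xi_pow_four_le (V := V) h0 h1
  have m2 := bexp_sum_xi_sq_le (V := V) p
  have m1 := bexp_abs_sum_xi_le (V := V) h0 h1
  rw [← hNdef] at m1 m2 m4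
  have hr : 0 < √N := Real.sqrt_pos.2 hN0
  have hr2 : √N * √N = N := Real.mul_self_sqrt hN0.le
  have hrN : √N ≤ N := by
    have : 1 ≤ √N := Real.one_le_sqrt.2 (by linarith)
    nlinarith
  calc _ ≤ (8 * S ^ 2 / N ^ 4) * (6 * N ^ 2) + (8 * S ^ 2 / N ^ 4 + 16 * Q / N ^ 2) * N +
        (32 * S ^ 2 / N ^ 3 + 8 * S / N) * √N + 64 * Q / N ^ 2 := by gcongr
    _ = 48 * S ^ 2 / N ^ 2 + 8 * S ^ 2 / N ^ 3 + 32 * S ^ 2 / N ^ 3 * √N + 16 * Q / N +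
        64 * Q / N ^ 2 + 8 * S * (√N / N) := by field_simp; ring
    _ ≤ 48 * S ^ 2 / N ^ 2 + 8 * S ^ 2 / N ^ 2 + 32 * S ^ 2 / N ^ 3 * N + 16 * Q / N +
        16 * Q / N + 8 * S * (√N / N) := by
        have hq : 64 * Q / N ^ 2 ≤ 16 * Q / N := by
          rw [div_le_div_iff₀ (by positivity) hN0]
          nlinarith [mul_nonneg (mul_nonneg Q0 hN0.le) (by linarith : 0 ≤ N - 4)]
        have hs : 8 * S ^ 2 / N ^ 3 ≤ 8 * S ^ 2 / N ^ 2 := by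
          gcongr
          · linarith
          · norm_num
        have hs' : 32 * S ^ 2 / N ^ 3 * √N ≤ 32 * S ^ 2 / N ^ 3 * N := by gcongr
        linarith
    _ = 88 * S ^ 2 / N ^ 2 + 32 * Q / N + 8 * S / √N := by
        rw [Real.sqrt_div_self']
        field_simp
        ring

end JointLaw

/-! ### Edge counts as quadratic forms in the adjacency matrix. -/

section GraphCounts

variable {V : Type*} [Fintype V] [DecidableEq V]

open Classical in
/-- The adjacency matrix, as a function. -/
def adj (H : SimpleGraph V) (i j : V) : ℝ := if H.Adj i j then 1 else 0

lemma isAdj_adj (H : SimpleGraph V) : IsAdj (adj H) where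
  diag i := by simp [adj]
  symm i j := by
    unfold adj
    by_cases h : H.Adj i j
    · simp [h, h.symm]
    · rw [if_neg h, if_neg fun h' => h h'.symm]
  zero_or_one i j := by unfold adj; split_ifs <;> simp

lemma rowSum_adj (H : SimpleGraph V) (i : V) :
    rowSum (adj H) i = ((H.incidenceSet i).ncard : ℝ) := by
  classical
  rw [rowSum, Set.ncard_eq_toFinset_card', Set.toFinset_card, H.card_incidenceSet_eq_degree,
    ← H.card_neighborFinset_eq_degree, SimpleGraph.neighborFinset_eq_filter]
  simp [adj]

lemma sum_rowSum_adj (H : SimpleGraph V) :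
    ∑ i, rowSum (adj H) i = 2 * (H.edgeSet.ncard : ℝ) := by
  classical
  have h := H.sum_degrees_eq_twice_card_edges
  have e : H.edgeSet.ncard = H.edgeFinset.card := by
    rw [Set.ncard_eq_toFinset_card']; rfl
  rw [e, ← Nat.cast_two, ← Nat.cast_mul, ← h, Nat.cast_sum]
  refine Finset.sum_congr rfl fun i _ => ?_
  rw [rowSum_adj, Set.ncard_eq_toFinset_card', Set.toFinset_card, H.card_incidenceSet_eq_degree]

/-- The number of edges with both ends in `s`, as a quadratic form. -/
lemma two_mul_ncard_edges_within (H : SimpleGraph V) (P : V → Prop) [DecidablePred P] :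
    2 * (({e | e ∈ H.edgeSet ∧ ∀ v ∈ e, P v} : Set (Sym2 V)).ncard : ℝ) =
      ∑ i, ∑ j, adj H i j * ((if P i then 1 else 0) * (if P j then 1 else 0)) := by
  -- The edges inside `P` form a graph of their own, to which the handshake lemma applies.
  let K : SimpleGraph V :=
    { Adj := fun i j => H.Adj i j ∧ P i ∧ P j
      symm := ⟨fun i j h => ⟨h.1.symm, h.2.2, h.2.1⟩⟩
      loopless := ⟨fun i h => H.loopless.irrefl i h.1⟩ }
  have e : ({e | e ∈ H.edgeSet ∧ ∀ v ∈ e, P v} : Set (Sym2 V)) = K.edgeSet := by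
    ext e
    induction e with
    | _ x y => simp [K]
  rw [e, ← sum_rowSum_adj]
  refine Finset.sum_congr rfl fun i _ => Finset.sum_congr rfl fun j _ => ?_
  classical
  unfold adj
  change @ite ℝ (H.Adj i j ∧ P i ∧ P j) (Classical.propDecidable _) 1 0 = _
  by_cases h1 : H.Adj i j <;> by_cases h2 : P i <;> by_cases h3 : P j <;> simp [h1, h2, h3]

end GraphCounts

/-! ### Reduction of `S` to the linear and the quadratic statistic. -/

section Segment

variable {a b : ℕ} (G : SimpleGraph (Seg a b))

lemma rowSum_adj_eq_deg (i : Seg a b) : rowSum (adj G) i = deg G i := rowSum_adj G i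

lemma sum_rowSum_adj_eq : ∑ i, rowSum (adj G) i = 2 * (edgeCount G : ℝ) := sum_rowSum_adj G

/-- The left side counts oriented edges that start at a neighbour of `i`. All of them touch an
endpoint of an edge at `i`, and an edge has two orientations. -/
lemma sum_adj_mul_deg_le (i : Seg a b) :
    ∑ j, adj G i j * rowSum (adj G) j ≤ 2 * (deg2 G i : ℝ) := by
  classical
  let Q : Seg a b → Prop := fun v => ∃ f ∈ G.incidenceSet i, v ∈ f
  let K : SimpleGraph (Seg a b) :=
    { Adj := fun j k => G.Adj j k ∧ (Q j ∨ Q k)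
      symm := ⟨fun j k h => ⟨h.1.symm, h.2.symm⟩⟩
      loopless := ⟨fun j h => G.loopless.irrefl j h.1⟩ }
  have e : ({e | e ∈ G.edgeSet ∧ ∃ v ∈ e, ∃ f ∈ G.incidenceSet i, v ∈ f} : Set (Sym2 (Seg a b))) =
      K.edgeSet := by
    ext e
    induction e with
    | _ x y =>
      simp only [Set.mem_ofPred_eq, SimpleGraph.mem_edgeSet, Sym2.mem_iff, K, Q]
      refine and_congr_right fun _ => ⟨?_, ?_⟩
      · rintro ⟨v, rfl | rfl, h⟩
        · exact Or.inl h
        · exact Or.inr h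
      · rintro (h | h)
        · exact ⟨x, Or.inl rfl, h⟩
        · exact ⟨y, Or.inr rfl, h⟩
  rw [deg2, e, ← sum_rowSum_adj]
  refine Finset.sum_le_sum fun j _ => ?_
  rw [rowSum, rowSum, Finset.mul_sum]
  refine Finset.sum_le_sum fun k _ => ?_
  by_cases h1 : G.Adj i j
  · by_cases h2 : G.Adj j k
    · have : K.Adj j k := ⟨h2, Or.inl ⟨s(i, j), ⟨h1, by simp⟩, by simp⟩⟩
      simp [adj, h1, h2, this]
    · simp only [adj, h2, if_false, mul_zero]; split_ifs <;> norm_num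
  · simp only [adj, h1, if_false, zero_mul]; split_ifs <;> norm_num

lemma integral_permNull {E : Type*} [NormedAddCommGroup E] [NormedSpace ℝ E] [CompleteSpace E]
    (F : Equiv.Perm (Seg a b) → E) : ∫ σ, F σ ∂(permNull a b) = pexp F := by
  rw [PMF.integral_eq_sum]
  simp [pexp, Finset.smul_sum, Fintype.card_perm]

/-- The first `k` time points of the segment. -/
def firstTimes (a b k : ℕ) : Finset (Seg a b) := Finset.univ.filter fun v => (v : ℕ) < a + k

lemma card_seg : Fintype.card (Seg a b) = b + 1 - a := by simp

lemma card_firstTimes {k : ℕ} (hk : k ≤ Fintype.card (Seg a b)) :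
    (firstTimes a b k).card = k := by
  rw [card_seg] at hk
  have : (firstTimes a b k).map (Function.Embedding.subtype _) = Finset.Ico a (a + k) := by
    ext x
    simp only [firstTimes, Finset.mem_map, Finset.mem_filter, Finset.mem_univ, true_and,
      Function.Embedding.subtype_apply, Subtype.exists, exists_and_right, exists_eq_right,
      Finset.mem_Icc, Finset.mem_Ico]
    constructor
    · rintro ⟨h1, h2⟩; exact ⟨h1.1, h2⟩
    · rintro ⟨h1, h2⟩; exact ⟨⟨h1, by omega⟩, h2⟩
  rw [← Finset.card_map (Function.Embedding.subtype _), this]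
  simp

lemma monotone_firstTimes : Monotone (firstTimes a b) := by
  intro k l hkl v hv
  simp only [firstTimes, Finset.mem_filter, Finset.mem_univ, true_and] at hv ⊢
  omega

/-- The fraction of time points up to `t`. -/
def frac (a b t : ℕ) : ℝ := ((t + 1 - a : ℕ) : ℝ) / ((b + 1 - a : ℕ) : ℝ)

/-- The centred degree. -/
def cdeg (i : Seg a b) : ℝ := deg G i - 2 * (edgeCount G : ℝ) / ((b + 1 - a : ℕ) : ℝ)

lemma sum_deg : ∑ i, (deg G i : ℝ) = 2 * (edgeCount G : ℝ) := by
  rw [← sum_rowSum_adj_eq]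
  simp only [rowSum_adj_eq_deg]

lemma sum_cdeg (hab : a ≤ b) : ∑ i, cdeg G i = 0 := by
  have h0 : ((b + 1 - a : ℕ) : ℝ) ≠ 0 := by
    have : b + 1 - a ≠ 0 := by omega
    exact_mod_cast this
  simp only [cdeg, Finset.sum_sub_distrib, sum_deg, Finset.sum_const, Finset.card_univ, card_seg,
    nsmul_eq_mul]
  field_simp
  ring

lemma sum_cdeg_sq (hab : a ≤ b) : ∑ i, cdeg G i ^ 2 = degVar G := by
  have h0 : ((b + 1 - a : ℕ) : ℝ) ≠ 0 := by
    have : b + 1 - a ≠ 0 := by omega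
    exact_mod_cast this
  have hN : ((b + 1 - a : ℕ) : ℝ) = (b : ℝ) - a + 1 := by
    rw [Nat.cast_sub (by omega)]; push_cast; ring
  have e : ∀ i, cdeg G i ^ 2 = (deg G i : ℝ) ^ 2 -
      2 * (2 * (edgeCount G : ℝ) / ((b + 1 - a : ℕ) : ℝ)) * deg G i +
      (2 * (edgeCount G : ℝ) / ((b + 1 - a : ℕ) : ℝ)) ^ 2 := by
    intro i; unfold cdeg; ring
  simp only [e, Finset.sum_add_distrib, Finset.sum_sub_distrib, ← Finset.mul_sum, sum_deg,
    Finset.sum_const, Finset.card_univ, card_seg, nsmul_eq_mul, degVar]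
  rw [← hN]
  field_simp
  ring

/-- The linear and the quadratic statistic, standardized for independent selection. -/
def zstat (p : ℝ) (j : Fin 2) (s : Finset (Seg a b)) : ℝ :=
  ![(√(degVar G * (p * (1 - p))))⁻¹ * ∑ i, cdeg G i * xi p s i,
    (2 * (p * (1 - p)) * √(edgeCount G))⁻¹ * ∑ i, ∑ k, adj G i k * (xi p s i * xi p s k)] j

/-- Expanding the product gives the degrees as linear coefficients. As the `ξ_i` sum to zero, the
degrees may be centred, which the coupling requires. `R₁` is the case `c = p, d = 1` and `R₂` the
case `c = 1 - p, d = -1`. -/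
lemma sum_adj_mul_add_mul_add (p c d : ℝ) (s : Finset (Seg a b)) (hs : ∑ i, xi p s i = 0) :
    ∑ i, ∑ k, adj G i k * ((c + d * xi p s i) * (c + d * xi p s k)) =
      c ^ 2 * (2 * (edgeCount G : ℝ)) + 2 * (c * d) * ∑ i, cdeg G i * xi p s i +
        d ^ 2 * ∑ i, ∑ k, adj G i k * (xi p s i * xi p s k) := by
  have e : ∀ i k, adj G i k * ((c + d * xi p s i) * (c + d * xi p s k)) =
      c ^ 2 * adj G i k + c * d * (adj G i k * xi p s i) + c * d * (adj G i k * xi p s k) +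
        d ^ 2 * (adj G i k * (xi p s i * xi p s k)) := by
    intro i k; ring
  have e2 : ∑ i, cdeg G i * xi p s i = ∑ i, rowSum (adj G) i * xi p s i := by
    simp only [cdeg, sub_mul, Finset.sum_sub_distrib, ← Finset.mul_sum, hs, mul_zero, sub_zero,
      rowSum_adj_eq_deg]
  simp only [e, Finset.sum_add_distrib, ← Finset.mul_sum]
  rw [(isAdj_adj G).sum_mul_rowSum, (isAdj_adj G).sum_mul_rowSum', e2,
    show ∑ i, ∑ k, adj G i k = ∑ i, rowSum (adj G) i from rfl, sum_rowSum_adj_eq]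
  ring

/-- `(R₁, R₂)` is an affine function of the standardized statistics. -/
lemma exists_R_eq {t : ℕ} (hat : a ≤ t) (htb : t < b) (hG : 0 < edgeCount G)
    (hV : 0 < degVar G) :
    ∃ (κ : Fin 2 → ℝ) (M : Matrix (Fin 2) (Fin 2) ℝ), IsUnit M.det ∧ ∀ i σ,
      R G t i σ = κ i + ∑ j, M i j *
        zstat G (frac a b t) j (pre σ (firstTimes a b (t + 1 - a))) := by
  set p := frac a b t with hp
  have hN : (0 : ℝ) < ((b + 1 - a : ℕ) : ℝ) := by
    have : 0 < b + 1 - a := by omega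
    exact_mod_cast this
  have hp0 : 0 < p := by
    have : (0 : ℝ) < ((t + 1 - a : ℕ) : ℝ) := by
      have : 0 < t + 1 - a := by omega
      exact_mod_cast this
    rw [hp]; unfold frac; positivity
  have hp1 : p < 1 := by
    rw [hp, frac, div_lt_one hN]
    have : t + 1 - a < b + 1 - a := by omega
    exact_mod_cast this
  have hq0 : 0 < 1 - p := by linarith
  have hE : (0 : ℝ) < edgeCount G := by exact_mod_cast hG
  set r₁ := √(degVar G * (p * (1 - p))) with hr₁
  set r₂ := 2 * (p * (1 - p)) * √(edgeCount G) with hr₂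
  have r₁0 : 0 < r₁ := Real.sqrt_pos.2 (by positivity)
  have r₂0 : 0 < r₂ := by
    have := Real.sqrt_pos.2 hE
    positivity
  refine ⟨![p ^ 2 * edgeCount G, (1 - p) ^ 2 * edgeCount G],
    !![p * r₁, 2⁻¹ * r₂; -(1 - p) * r₁, 2⁻¹ * r₂], ?_, ?_⟩
  · rw [Matrix.det_fin_two_of, isUnit_iff_ne_zero]
    have : p * r₁ * (2⁻¹ * r₂) - 2⁻¹ * r₂ * (-(1 - p) * r₁) = 2⁻¹ * (r₁ * r₂) := by ring
    rw [this]; positivity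
  · intro i σ
    set s := pre σ (firstTimes a b (t + 1 - a)) with hs
    have hs0 : ∑ i, xi p s i = 0 := by
      rw [sum_xi, hs, card_pre, card_firstTimes (by rw [card_seg]; omega), card_seg, hp, frac]
      field_simp
      ring
    have hmem : ∀ v, v ∈ s ↔ (σ v : ℕ) ≤ t := by
      intro v
      simp only [hs, mem_pre, firstTimes, Finset.mem_filter, Finset.mem_univ, true_and]
      omega
    fin_cases i
    · have h := two_mul_ncard_edges_within G (fun v => (σ v : ℕ) ≤ t)
      have e : ∀ v, (if (σ v : ℕ) ≤ t then (1 : ℝ) else 0) = p + 1 * xi p s v := by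
        intro v; simp only [xi, hmem]; ring
      simp only [e] at h
      rw [sum_adj_mul_add_mul_add G p p 1 s hs0] at h
      rw [Fin.sum_univ_two]
      change (R1 G t σ : ℝ) = p ^ 2 * edgeCount G + (p * r₁ * (r₁⁻¹ * ∑ i, cdeg G i * xi p s i) +
        2⁻¹ * r₂ * (r₂⁻¹ * ∑ i, ∑ k, adj G i k * (xi p s i * xi p s k)))
      rw [mul_assoc p, mul_inv_cancel_left₀ r₁0.ne', mul_assoc 2⁻¹, mul_inv_cancel_left₀ r₂0.ne',
        R1]
      linarith
    · have h := two_mul_ncard_edges_within G (fun v => t < (σ v : ℕ))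
      have e : ∀ v, (if t < (σ v : ℕ) then (1 : ℝ) else 0) = (1 - p) + (-1) * xi p s v := by
        intro v
        by_cases h : (σ v : ℕ) ≤ t
        · simp [xi, hmem, h]
        · simp [xi, hmem, h, not_le.1 h]
      simp only [e] at h
      rw [sum_adj_mul_add_mul_add G p (1 - p) (-1) s hs0] at h
      rw [Fin.sum_univ_two]
      change (R2 G t σ : ℝ) = (1 - p) ^ 2 * edgeCount G +
        (-(1 - p) * r₁ * (r₁⁻¹ * ∑ i, cdeg G i * xi p s i) +
        2⁻¹ * r₂ * (r₂⁻¹ * ∑ i, ∑ k, adj G i k * (xi p s i * xi p s k)))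
      rw [mul_assoc (-(1 - p)), mul_inv_cancel_left₀ r₁0.ne', mul_assoc 2⁻¹,
        mul_inv_cancel_left₀ r₂0.ne', R2]
      linarith

/-- The statistic `S` is invariant under invertible affine changes of `(R₁, R₂)`. -/
lemma S_eq_of_affine {t : ℕ} {z : Fin 2 → Equiv.Perm (Seg a b) → ℝ} {κ : Fin 2 → ℝ}
    {M : Matrix (Fin 2) (Fin 2) ℝ} (hM : IsUnit M.det)
    (h : ∀ i σ, R G t i σ = κ i + ∑ j, M i j * z j σ) (σ : Equiv.Perm (Seg a b)) :
    S G t σ = (fun j => z j σ - pexp (z j)) ⬝ᵥ Matrix.mulVec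
      (Matrix.of fun j k => pexp fun ρ => (z j ρ - pexp (z j)) * (z k ρ - pexp (z k)))⁻¹
      (fun j => z j σ - pexp (z j)) := by
  set C : Matrix (Fin 2) (Fin 2) ℝ :=
    Matrix.of fun j k => pexp fun ρ => (z j ρ - pexp (z j)) * (z k ρ - pexp (z k)) with hC
  have hcen : ∀ ρ, centered G t ρ = M.mulVec (fun j => z j ρ - pexp (z j)) := by
    intro ρ
    funext i
    have hmean : ∫ ρ, R G t i ρ ∂(permNull a b) = κ i + ∑ j, M i j * pexp (z j) := by
      rw [integral_permNull, show R G t i = fun σ => κ i + ∑ j, M i j * z j σ from funext (h i),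
        pexp_add, pexp_const, pexp_sum]
      simp only [pexp_mul_left]
    rw [centered, hmean, h, Matrix.mulVec, dotProduct]
    simp only [mul_sub, Finset.sum_sub_distrib]
    ring
  have hcov : covMatrix G t = M * C * M.transpose := by
    ext i k
    have e : covMatrix G t i k = pexp (fun ρ => centered G t ρ i * centered G t ρ k) := by
      rw [covMatrix, Matrix.of_apply, covariance, integral_permNull]
      rfl
    rw [e]
    simp only [hcen, Matrix.mulVec, dotProduct, Matrix.mul_apply, Matrix.transpose_apply, hC,
      Matrix.of_apply]
    simp only [Fin.sum_univ_two]
    have e2 : ∀ ρ, (M i 0 * (z 0 ρ - pexp (z 0)) + M i 1 * (z 1 ρ - pexp (z 1))) *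
        (M k 0 * (z 0 ρ - pexp (z 0)) + M k 1 * (z 1 ρ - pexp (z 1))) =
        M i 0 * M k 0 * ((z 0 ρ - pexp (z 0)) * (z 0 ρ - pexp (z 0))) +
        M i 1 * M k 0 * ((z 1 ρ - pexp (z 1)) * (z 0 ρ - pexp (z 0))) +
        M i 0 * M k 1 * ((z 0 ρ - pexp (z 0)) * (z 1 ρ - pexp (z 1))) +
        M i 1 * M k 1 * ((z 1 ρ - pexp (z 1)) * (z 1 ρ - pexp (z 1))) := by
      intro ρ; ring
    simp only [e2, pexp_add, pexp_mul_left]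
    ring
  have hMT : IsUnit M.transpose.det := by rwa [Matrix.det_transpose]
  -- Only `M` has to be invertible: `Matrix.mul_inv_rev` also holds for singular `C`, where the
  -- inverses are zero by convention.
  rw [S, hcen, hcov, Matrix.mul_inv_rev, Matrix.mul_inv_rev, Matrix.mulVec_mulVec,
    Matrix.mul_assoc, Matrix.mul_assoc, Matrix.nonsing_inv_mul _ hM, Matrix.mul_one,
    Matrix.dotProduct_mulVec, Matrix.dotProduct_mulVec, ← Matrix.vecMul_transpose,
    Matrix.vecMul_vecMul, ← Matrix.mul_assoc, Matrix.mul_nonsing_inv _ hMT, Matrix.one_mul]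

end Segment

/-! ### Quantitative bounds for the standardized statistics. -/

section Standardized

variable {a b : ℕ} (G : SimpleGraph (Seg a b))

lemma four_mul_edgeCount_sq_le (G : SimpleGraph (Seg a b)) :
    4 * (edgeCount G : ℝ) ^ 2 ≤ ((b + 1 - a : ℕ) : ℝ) * ∑ i, (deg G i : ℝ) ^ 2 := by
  have := sq_sum_le_card_mul_sum_sq (s := Finset.univ) (f := fun i => (deg G i : ℝ))
  rw [sum_deg, Finset.card_univ, card_seg] at this
  linarith

lemma edgeCount_le_sum_cube (G : SimpleGraph (Seg a b)) :
    2 * (edgeCount G : ℝ) ≤ ∑ i, (deg G i : ℝ) ^ 3 := by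
  rw [← sum_deg]
  refine Finset.sum_le_sum fun i _ => ?_
  have : deg G i ≤ deg G i ^ 3 := Nat.le_self_pow three_ne_zero _
  exact_mod_cast this

/-- Centring costs only a constant: `|d - m|³ ≤ 4d³ + 4m³`, and the cube of the mean degree `m` is
at most the mean of the cubes. -/
lemma sum_abs_cdeg_cube_le (hab : a ≤ b) :
    ∑ i, |cdeg G i| ^ 3 ≤ 8 * ∑ i, (deg G i : ℝ) ^ 3 := by
  set N : ℝ := ((b + 1 - a : ℕ) : ℝ) with hN
  have hN0 : 0 < N := by
    have : 0 < b + 1 - a := by omega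
    rw [hN]; exact_mod_cast this
  set m := 2 * (edgeCount G : ℝ) / N with hm
  have hm0 : 0 ≤ m := by positivity
  have h1 : ∀ i, |cdeg G i| ^ 3 ≤ 4 * (deg G i : ℝ) ^ 3 + 4 * m ^ 3 := by
    intro i
    have hd : (0 : ℝ) ≤ deg G i := Nat.cast_nonneg _
    have : |cdeg G i| ≤ deg G i + m := by
      rw [cdeg, ← hm, abs_le]; constructor <;> linarith
    refine (pow_le_pow_left₀ (abs_nonneg _) this 3).trans ?_
    nlinarith [mul_nonneg (add_nonneg hd hm0) (sq_nonneg ((deg G i : ℝ) - m))]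
  have h2 : N * m ^ 3 ≤ ∑ i, (deg G i : ℝ) ^ 3 := by
    have h := pow_sum_div_card_le_sum_pow (s := Finset.univ) (f := fun i => (deg G i : ℝ))
      (fun i _ => Nat.cast_nonneg _) 2
    rw [sum_deg, Finset.card_univ, card_seg, ← hN] at h
    refine le_trans (le_of_eq ?_) h
    rw [hm]; field_simp; ring
  refine (Finset.sum_le_sum fun i _ => h1 i).trans ?_
  rw [Finset.sum_add_distrib, ← Finset.mul_sum, Finset.sum_const, Finset.card_univ, card_seg,
    nsmul_eq_mul, ← hN]
  linarith

/-- With `m` the mean degree and `Q = ∑ d²`, the centring contributes `m² Q`, and this is absorbed: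
`m² ≤ Q/N` and `Q² = (∑ (Ad)_j)² ≤ N ∑ (Ad)_j²`, both by Cauchy-Schwarz. -/
lemma sum_adj_mul_cdeg_sq_le (hab : a ≤ b) :
    ∑ j, (∑ i, adj G j i * cdeg G i) ^ 2 ≤ 16 * ∑ i, (deg2 G i : ℝ) ^ 2 := by
  set N : ℝ := ((b + 1 - a : ℕ) : ℝ) with hN
  have hN0 : 0 < N := by
    have : 0 < b + 1 - a := by omega
    rw [hN]; exact_mod_cast this
  set m := 2 * (edgeCount G : ℝ) / N with hm
  set Ad : Seg a b → ℝ := fun j => ∑ i, adj G j i * rowSum (adj G) i with hAd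
  set Q := ∑ i, (deg G i : ℝ) ^ 2 with hQ
  have hA := isAdj_adj G
  have hAd0 : ∀ j, 0 ≤ Ad j := fun j => Finset.sum_nonneg fun i _ =>
    mul_nonneg (hA.nonneg _ _) (hA.rowSum_nonneg _)
  have e1 : ∀ j, ∑ i, adj G j i * cdeg G i = Ad j - m * deg G j := by
    intro j
    simp only [hAd, cdeg, ← hN, ← hm, mul_sub, Finset.sum_sub_distrib, ← rowSum_adj_eq_deg,
      ← Finset.sum_mul]
    rw [show ∑ i, adj G j i = rowSum (adj G) j from rfl]; ring
  have h1 : ∀ j, (∑ i, adj G j i * cdeg G i) ^ 2 ≤ 2 * Ad j ^ 2 + 2 * m ^ 2 * (deg G j : ℝ) ^ 2 := by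
    intro j
    rw [e1]
    nlinarith [sq_nonneg (Ad j + m * deg G j)]
  have hQsum : ∑ j, Ad j = Q := by
    simp only [hAd, hA.sum_mul_rowSum']
    simp only [hQ, rowSum_adj_eq_deg, sq]
  have hQ2 : Q ^ 2 ≤ N * ∑ j, Ad j ^ 2 := by
    have := sq_sum_le_card_mul_sum_sq (s := Finset.univ) (f := Ad)
    rwa [hQsum, Finset.card_univ, card_seg, ← hN] at this
  have hQ0 : 0 ≤ Q := by positivity
  have hmQ : m ^ 2 ≤ Q / N := by
    have := four_mul_edgeCount_sq_le G
    rw [← hN, ← hQ] at this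
    rw [hm, div_pow, div_le_div_iff₀ (by positivity) hN0]
    nlinarith
  have hmQ2 : m ^ 2 * Q ≤ ∑ j, Ad j ^ 2 := by
    calc m ^ 2 * Q ≤ Q / N * Q := by gcongr
      _ = Q ^ 2 / N := by ring
      _ ≤ _ := by rw [div_le_iff₀ hN0]; linarith
  have h4 : ∑ j, Ad j ^ 2 ≤ 4 * ∑ i, (deg2 G i : ℝ) ^ 2 := by
    rw [Finset.mul_sum]
    refine Finset.sum_le_sum fun j _ => ?_
    have := pow_le_pow_left₀ (hAd0 j) (sum_adj_mul_deg_le G j) 2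
    refine this.trans (le_of_eq (by ring))
  refine (Finset.sum_le_sum fun j _ => h1 j).trans ?_
  rw [Finset.sum_add_distrib, ← Finset.mul_sum, ← Finset.mul_sum, ← hQ]
  linarith

variable {p : ℝ}

lemma zstat_zero (s : Finset (Seg a b)) :
    zstat G p 0 s = (√(degVar G * (p * (1 - p))))⁻¹ * ∑ i, cdeg G i * xi p s i := rfl

lemma zstat_one (s : Finset (Seg a b)) :
    zstat G p 1 s = (2 * (p * (1 - p)) * √(edgeCount G))⁻¹ *
      ∑ i, ∑ k, adj G i k * (xi p s i * xi p s k) := rfl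

lemma bexp_zstat (j : Fin 2) : bexp p (zstat G p j) = 0 := by
  fin_cases j
  · change bexp p (fun s => _ * ∑ i, cdeg G i * xi p s i) = 0
    rw [bexp_mul_left, bexp_sum]
    simp [bexp_mul_left, bexp_xi]
  · change bexp p (fun s => _ * ∑ i, ∑ k, adj G i k * (xi p s i * xi p s k)) = 0
    rw [bexp_mul_left, bexp_bilinear p _ (isAdj_adj G).diag, mul_zero]

lemma bexp_zstat_mul (hab : a ≤ b) (hp0 : 0 < p) (hp1 : p < 1) (hG : 0 < edgeCount G)
    (hV : 0 < degVar G) (j k : Fin 2) :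
    bexp p (fun s => zstat G p j s * zstat G p k s) = if j = k then 1 else 0 := by
  have hE : (0 : ℝ) < edgeCount G := by exact_mod_cast hG
  have hP : 0 < p * (1 - p) := mul_pos hp0 (by linarith)
  have h01 : bexp p (fun s => zstat G p 0 s * zstat G p 1 s) = 0 := by
    have e : (fun s => zstat G p 0 s * zstat G p 1 s) = fun s =>
        ((√(degVar G * (p * (1 - p))))⁻¹ * (2 * (p * (1 - p)) * √(edgeCount G))⁻¹) *
        ((∑ i, cdeg G i * xi p s i) * ∑ i, ∑ k, adj G i k * (xi p s i * xi p s k)) := by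
      funext s; rw [zstat_zero, zstat_one]; ring
    rw [e, bexp_mul_left, bexp_linear_mul_bilinear p _ _ (isAdj_adj G).diag, mul_zero]
  fin_cases j <;> fin_cases k
  · have e : (fun s => zstat G p 0 s * zstat G p 0 s) = fun s =>
        ((√(degVar G * (p * (1 - p)))) ^ 2)⁻¹ * (∑ i, cdeg G i * xi p s i) ^ 2 := by
      funext s; rw [zstat_zero]; ring
    change bexp p (fun s => zstat G p 0 s * zstat G p 0 s) = 1
    rw [e, bexp_mul_left, bexp_linear_sq, sum_cdeg_sq G hab, Real.sq_sqrt (by positivity)]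
    have := hP.ne'
    have hq : 1 - p ≠ 0 := (sub_pos.2 hp1).ne'
    field_simp
  · exact h01
  · change bexp p (fun s => zstat G p 1 s * zstat G p 0 s) = 0
    rw [← h01]
    simp only [mul_comm]
  · have e : (fun s => zstat G p 1 s * zstat G p 1 s) = fun s =>
        ((2 * (p * (1 - p)) * √(edgeCount G)) ^ 2)⁻¹ *
          (∑ i, ∑ k, adj G i k * (xi p s i * xi p s k)) ^ 2 := by
      funext s; rw [zstat_one, ← sq, mul_pow, inv_pow]
    change bexp p (fun s => zstat G p 1 s * zstat G p 1 s) = 1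
    have e2 : ∑ i, ∑ j, adj G i j * (adj G i j + adj G j i) = 4 * (edgeCount G : ℝ) := by
      have : ∀ i j, adj G i j * (adj G i j + adj G j i) = 2 * adj G i j := by
        intro i j
        rw [(isAdj_adj G).symm j i, ← two_mul]
        nlinarith [(isAdj_adj G).sq_eq i j]
      simp only [this, ← Finset.mul_sum]
      rw [show ∑ i, ∑ j, adj G i j = ∑ i, rowSum (adj G) i from rfl, sum_rowSum_adj_eq]
      ring
    rw [e, bexp_mul_left, bexp_bilinear_sq p _ (isAdj_adj G).diag, e2, mul_pow,
      Real.sq_sqrt hE.le]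
    have := hP.ne'
    have := hE.ne'
    have hq : 1 - p ≠ 0 := (sub_pos.2 hp1).ne'
    field_simp
    ring

/-- The characteristic function of the standardized statistics under independent selection. -/
lemma norm_charFun_zstat_sub_le (hab : a ≤ b) (hp0 : 0 < p) (hp1 : p < 1) (hG : 0 < edgeCount G)
    (hV : 0 < degVar G) (α β : ℝ) :
    ‖bexp p (fun s => Complex.exp ((α * zstat G p 0 s + β * zstat G p 1 s : ℝ) * Complex.I)) -
      Real.exp (-(α ^ 2 + β ^ 2) / 2)‖ ≤
    √(144 * α ^ 2 * β ^ 2 / (p * (1 - p)) ^ 3 *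
        ((∑ i, (deg2 G i : ℝ) ^ 2) / (edgeCount G * degVar G)) +
      β ^ 4 / (p * (1 - p)) ^ 4 * ((∑ i, (deg G i : ℝ) ^ 2) / (edgeCount G : ℝ) ^ 2) +
      2 * β ^ 4 / (p * (1 - p)) ^ 4 *
        (√(2 * edgeCount G) * (∑ i, (deg G i : ℝ) ^ 2) / (edgeCount G : ℝ) ^ 2)) +
    (96 * |α| ^ 3 / √(p * (1 - p)) ^ 3 * ((∑ i, (deg G i : ℝ) ^ 3) / √(degVar G) ^ 3) +
      42 * |β| ^ 3 / (p * (1 - p)) ^ 3 * ((∑ i, (deg G i : ℝ) ^ 2) / √(edgeCount G) ^ 3)) := by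
  set P := p * (1 - p) with hPdef
  have hP : 0 < P := mul_pos hp0 (by linarith)
  set e : ℝ := (edgeCount G : ℝ) with he
  have he0 : 0 < e := by rw [he]; exact_mod_cast hG
  set r₁ := √(degVar G * P) with hr₁
  have r₁0 : 0 < r₁ := Real.sqrt_pos.2 (by positivity)
  have r₁2 : r₁ ^ 2 = degVar G * P := Real.sq_sqrt (by positivity)
  have se0 : 0 < √e := Real.sqrt_pos.2 he0
  have se2 : √e ^ 2 = e := Real.sq_sqrt he0.le
  have hA := isAdj_adj G
  set ℓ : Seg a b → ℝ := fun i => α / r₁ * cdeg G i with hℓ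
  -- The factor 2 in the normalization of the quadratic statistic is taken up by the `2⁻¹` in
  -- `quadForm`. With these coefficients the variance is exactly `α² + β²`.
  set β' := β / (P * √e) with hβ'
  have hq : ∀ s, α * zstat G p 0 s + β * zstat G p 1 s =
      quadForm p ℓ (fun i j => β' * adj G i j) s := by
    intro s
    rw [zstat_zero, zstat_one, ← hPdef, ← hr₁, ← he]
    simp only [quadForm, hℓ, hβ', mul_assoc, ← Finset.mul_sum]
    generalize ∑ i, cdeg G i * xi p s i = x
    generalize ∑ i, ∑ k, adj G i k * (xi p s i * xi p s k) = y
    clear_value P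
    field_simp
  have hv : α ^ 2 + β ^ 2 = p * (1 - p) * ∑ i, ℓ i ^ 2 +
      2⁻¹ * (p * (1 - p)) ^ 2 * β' ^ 2 * ∑ i, rowSum (adj G) i := by
    rw [sum_rowSum_adj_eq, ← he, ← hPdef]
    simp only [hℓ, mul_pow, ← Finset.mul_sum, sum_cdeg_sq G hab, hβ', div_pow, r₁2, se2]
    have := hV.ne'
    field_simp
  have key := hA.norm_charFun_sub_le hp0.le hp1.le β' ℓ hv
  simp only [← hq] at key
  refine key.trans ?_
  have hd : ∑ i, rowSum (adj G) i ^ 2 = ∑ i, (deg G i : ℝ) ^ 2 := by simp only [rowSum_adj_eq_deg]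
  rw [hd, sum_rowSum_adj_eq, ← he]
  have b2 : β' ^ 2 = β ^ 2 / (P ^ 2 * e) := by rw [hβ', div_pow, mul_pow, se2]
  have b4 : β' ^ 4 = β ^ 4 / (P ^ 4 * e ^ 2) := by
    rw [show β' ^ 4 = (β' ^ 2) ^ 2 by ring, b2, div_pow, mul_pow, ← pow_mul, ← pow_mul]
  have b3 : |β'| ^ 3 = |β| ^ 3 / (P ^ 3 * √e ^ 3) := by
    rw [hβ', abs_div, abs_of_pos (by positivity : 0 < P * √e), div_pow, mul_pow]
  refine add_le_add (Real.sqrt_le_sqrt (add_le_add (add_le_add ?_ ?_) ?_)) (add_le_add ?_ ?_)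
  · have h1 : ∑ j, (∑ i, adj G j i * ℓ i) ^ 2 =
        (α / r₁) ^ 2 * ∑ j, (∑ i, adj G j i * cdeg G i) ^ 2 := by
      rw [Finset.mul_sum]
      refine Finset.sum_congr rfl fun j _ => ?_
      rw [← mul_pow, Finset.mul_sum]
      congr 1
      exact Finset.sum_congr rfl fun i _ => by simp only [hℓ]; ring
    rw [h1, b2, div_pow, r₁2]
    calc _ ≤ 9 * (β ^ 2 / (P ^ 2 * e)) *
          (α ^ 2 / (degVar G * P) * (16 * ∑ i, (deg2 G i : ℝ) ^ 2)) := by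
          gcongr; exact sum_adj_mul_cdeg_sq_le G hab
      _ = _ := by have := hV.ne'; field_simp; ring
  · rw [b4]; exact le_of_eq (by field_simp)
  · rw [b4]; exact le_of_eq (by field_simp)
  · have h3 : ∑ i, |ℓ i| ^ 3 = |α| ^ 3 / r₁ ^ 3 * ∑ i, |cdeg G i| ^ 3 := by
      rw [Finset.mul_sum]
      refine Finset.sum_congr rfl fun i _ => ?_
      simp only [hℓ, abs_mul, abs_div, abs_of_pos r₁0]; ring
    have hr : r₁ ^ 3 = √(degVar G) ^ 3 * √P ^ 3 := by
      rw [hr₁, Real.sqrt_mul hV.le]; ring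
    rw [h3]
    have sV : 0 < √(degVar G) := Real.sqrt_pos.2 hV
    have sP : 0 < √P := Real.sqrt_pos.2 hP
    calc _ ≤ 12 * (|α| ^ 3 / r₁ ^ 3 * (8 * ∑ i, (deg G i : ℝ) ^ 3)) := by
          gcongr; exact sum_abs_cdeg_cube_le G hab
      _ = _ := by rw [hr]; field_simp; ring
  · rw [b3]; exact le_of_eq (by field_simp)

lemma frac_mem {t : ℕ} (hat : a ≤ t) (htb : t < b) : 0 < frac a b t ∧ frac a b t < 1 := by
  have hN : (0 : ℝ) < ((b + 1 - a : ℕ) : ℝ) := by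
    have : 0 < b + 1 - a := by omega
    exact_mod_cast this
  have h0 : (0 : ℝ) < ((t + 1 - a : ℕ) : ℝ) := by
    have : 0 < t + 1 - a := by omega
    exact_mod_cast this
  refine ⟨div_pos h0 hN, (div_lt_one hN).2 ?_⟩
  have : t + 1 - a < b + 1 - a := by omega
  exact_mod_cast this

lemma sum_xi_firstTimes {t : ℕ} (hat : a ≤ t) (htb : t < b) :
    ∑ i, xi (frac a b t) (firstTimes a b (t + 1 - a)) i = 0 := by
  have hN : ((b + 1 - a : ℕ) : ℝ) ≠ 0 := by
    have : b + 1 - a ≠ 0 := by omega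
    exact_mod_cast this
  rw [sum_xi, card_firstTimes (by rw [card_seg]; omega), card_seg, frac]
  field_simp
  ring

/-- The mean square distance of the standardized statistics under the coupling. -/
lemma gap_zstat_zero_le {t : ℕ} (hat : a ≤ t) (htb : t < b) (hV : 0 < degVar G) :
    gap (frac a b t) (firstTimes a b) (t + 1 - a) (zstat G (frac a b t) 0) ≤
      2 / (frac a b t * (1 - frac a b t)) / √((b + 1 - a : ℕ) : ℝ) := by
  obtain ⟨hp0, hp1⟩ := frac_mem hat htb
  set p := frac a b t with hp
  have hP : 0 < p * (1 - p) := mul_pos hp0 (by linarith)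
  have h := gap_linear_le hp0.le hp1.le (fun k hk => card_firstTimes hk) monotone_firstTimes
    (sum_xi_firstTimes hat htb) (sum_cdeg G (by omega))
  rw [card_seg, sum_cdeg_sq G (by omega)] at h
  change gap p _ _ (fun s => (√(degVar G * (p * (1 - p))))⁻¹ * ∑ i, cdeg G i * xi p s i) ≤ _
  rw [gap_const_mul, inv_pow, Real.sq_sqrt (by positivity)]
  refine (mul_le_mul_of_nonneg_left h (by positivity)).trans (le_of_eq ?_)
  have := hV.ne'
  have := hP.ne'
  field_simp

lemma gap_zstat_one_le {t : ℕ} (hat : a ≤ t) (htb : t < b) (hG : 0 < edgeCount G)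
    (hN : 6 ≤ b + 1 - a) :
    gap (frac a b t) (firstTimes a b) (t + 1 - a) (zstat G (frac a b t) 1) ≤
      1 / (frac a b t * (1 - frac a b t)) ^ 2 *
        (88 * (edgeCount G / ((b + 1 - a : ℕ) : ℝ) ^ 2) +
          8 * ((∑ i, (deg G i : ℝ) ^ 2) / (edgeCount G * ((b + 1 - a : ℕ) : ℝ))) +
          4 / √((b + 1 - a : ℕ) : ℝ)) := by
  obtain ⟨hp0, hp1⟩ := frac_mem hat htb
  set p := frac a b t with hp
  have hP : 0 < p * (1 - p) := mul_pos hp0 (by linarith)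
  have hE : (0 : ℝ) < edgeCount G := by exact_mod_cast hG
  have h := gap_quadratic_le hp0.le hp1.le (fun k hk => card_firstTimes hk) monotone_firstTimes
    (sum_xi_firstTimes hat htb) (by rw [card_seg]; exact hN) (isAdj_adj G)
  rw [card_seg, sum_rowSum_adj_eq] at h
  simp only [rowSum_adj_eq_deg] at h
  change gap p _ _ (fun s => (2 * (p * (1 - p)) * √(edgeCount G))⁻¹ *
    ∑ i, ∑ k, adj G i k * (xi p s i * xi p s k)) ≤ _
  rw [gap_const_mul, inv_pow, mul_pow, Real.sq_sqrt hE.le]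
  refine (mul_le_mul_of_nonneg_left h (by positivity)).trans (le_of_eq ?_)
  have hN0 : (0 : ℝ) < ((b + 1 - a : ℕ) : ℝ) := by
    have : 0 < b + 1 - a := by omega
    exact_mod_cast this
  have hs : 0 < √((b + 1 - a : ℕ) : ℝ) := Real.sqrt_pos.2 hN0
  have := hP.ne'
  field_simp
  ring

end Standardized

/-! ### Asymptotics of the error terms, and normality under independent selection. -/

namespace Regime

variable {a b t : ℕ → ℕ} {G : ∀ n, SimpleGraph (Seg (a n) (b n))} {u : ℝ}

/-- A limit fraction strictly inside `(0, 1)` keeps both sides of the split nonempty, and length at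
least 5 provides the six points that the quadratic bound needs. -/
lemma eventually_split (h : Regime a b t G u) :
    ∀ᶠ n in atTop, a n ≤ t n ∧ t n < b n ∧ 6 ≤ b n + 1 - a n := by
  filter_upwards [h.length.eventually_ge_atTop 5, h.split.eventually_lt_const h.lt_one,
    h.split.eventually_const_lt h.pos] with n h1 h2 h3
  have hpos : (0 : ℝ) < (b n : ℝ) - a n := by linarith
  rw [div_lt_one hpos] at h2
  have h3' : (0 : ℝ) < (t n : ℝ) - a n := by
    by_contra hc
    exact absurd h3 (not_lt.2 (div_nonpos_of_nonpos_of_nonneg (not_lt.1 hc) hpos.le))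
  have c1 : a n < t n := by
    have : (a n : ℝ) < t n := by linarith
    exact_mod_cast this
  have c2 : t n < b n := by
    have : (t n : ℝ) < b n := by linarith
    exact_mod_cast this
  have c3 : a n + 5 ≤ b n := by
    have : (a n : ℝ) + 5 ≤ b n := by linarith
    exact_mod_cast this
  exact ⟨c1.le, c2, by omega⟩

lemma tendsto_card (h : Regime a b t G u) :
    Tendsto (fun n => ((b n + 1 - a n : ℕ) : ℝ)) atTop atTop := by
  refine tendsto_atTop_mono' _ ?_ h.length
  filter_upwards [h.eventually_split] with n hn
  rw [Nat.cast_sub (by omega)]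
  push_cast; linarith

lemma tendsto_frac (h : Regime a b t G u) :
    Tendsto (fun n => frac (a n) (b n) (t n)) atTop (𝓝 u) := by
  have h1 : Tendsto (fun n => 1 / ((b n : ℝ) - a n)) atTop (𝓝 0) := by
    exact h.length.const_div_atTop 1
  have h2 : Tendsto (fun n => (((t n : ℝ) - a n) / ((b n : ℝ) - a n) + 1 / ((b n : ℝ) - a n)) /
      (1 + 1 / ((b n : ℝ) - a n))) atTop (𝓝 ((u + 0) / (1 + 0))) :=
    (h.split.add h1).div (tendsto_const_nhds.add h1) (by norm_num)
  rw [add_zero, add_zero, div_one] at h2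
  refine h2.congr' ?_
  filter_upwards [h.eventually_split, h.length.eventually_ge_atTop 5] with n hn h5
  have hpos : (0 : ℝ) < (b n : ℝ) - a n := by linarith
  have e1 : ((t n + 1 - a n : ℕ) : ℝ) = (t n : ℝ) - a n + 1 := by
    rw [Nat.cast_sub (by omega)]; push_cast; ring
  have e2 : ((b n + 1 - a n : ℕ) : ℝ) = (b n : ℝ) - a n + 1 := by
    rw [Nat.cast_sub (by omega)]; push_cast; ring
  rw [frac, e1, e2]
  field_simp

/-- If `V_G` vanished, the cubic condition would force `∑ |G_i|³ = 0`; but this sum is at least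
`2|G| > 0`. -/
lemma eventually_degVar_pos (h : Regime a b t G u) : ∀ᶠ n in atTop, 0 < degVar (G n) := by
  filter_upwards [h.eventually_split, h.nonempty, h.cube.bound (c := 1) one_pos] with n hn hG hc
  have hE : (0 : ℝ) < edgeCount (G n) := by exact_mod_cast hG
  have h0 : 0 ≤ degVar (G n) := by
    rw [← sum_cdeg_sq (G n) (by omega)]; positivity
  refine lt_of_le_of_ne h0 fun h0' => ?_
  rw [← h0', zero_mul, norm_zero, mul_zero] at hc
  have := edgeCount_le_sum_cube (G n)
  have := (Real.le_norm_self _).trans hc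
  linarith

lemma tendsto_sq (h : Regime a b t G u) :
    Tendsto (fun n => (∑ i, (deg (G n) i : ℝ) ^ 2) / √(edgeCount (G n)) ^ 3) atTop (𝓝 0) := by
  refine h.sq.tendsto_div_nhds_zero.congr fun n => ?_
  congr 1
  rw [Real.sqrt_eq_rpow, ← Real.rpow_natCast, ← Real.rpow_mul (Nat.cast_nonneg _)]
  norm_num

lemma tendsto_sq_div_sq (h : Regime a b t G u) :
    Tendsto (fun n => (∑ i, (deg (G n) i : ℝ) ^ 2) / (edgeCount (G n) : ℝ) ^ 2) atTop (𝓝 0) := by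
  refine squeeze_zero' (Eventually.of_forall fun n => by positivity) ?_ h.tendsto_sq
  filter_upwards [h.nonempty] with n hG
  have hE : (1 : ℝ) ≤ edgeCount (G n) := by exact_mod_cast hG
  have hs : 1 ≤ √(edgeCount (G n) : ℝ) := Real.one_le_sqrt.2 hE
  have h2 : (edgeCount (G n) : ℝ) ^ 2 = √(edgeCount (G n)) ^ 4 := by
    rw [show √(edgeCount (G n) : ℝ) ^ 4 = (√(edgeCount (G n)) ^ 2) ^ 2 by ring,
      Real.sq_sqrt (by linarith)]
  rw [h2]
  exact div_le_div_of_nonneg_left (Finset.sum_nonneg fun _ _ => sq_nonneg _)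
    (pow_pos (one_pos.trans_le hs) 3) (pow_le_pow_right₀ hs (by norm_num))

lemma tendsto_sqrt_mul_sq (h : Regime a b t G u) :
    Tendsto (fun n => √(2 * edgeCount (G n)) * (∑ i, (deg (G n) i : ℝ) ^ 2) /
      (edgeCount (G n) : ℝ) ^ 2) atTop (𝓝 0) := by
  have := h.tendsto_sq.const_mul √2
  rw [mul_zero] at this
  refine this.congr' ?_
  filter_upwards [h.nonempty] with n hG
  have hE : (0 : ℝ) < edgeCount (G n) := by exact_mod_cast hG
  have hs : 0 < √(edgeCount (G n) : ℝ) := Real.sqrt_pos.2 hE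
  have h2 : (edgeCount (G n) : ℝ) ^ 2 = √(edgeCount (G n)) ^ 4 := by
    rw [show √(edgeCount (G n) : ℝ) ^ 4 = (√(edgeCount (G n)) ^ 2) ^ 2 by ring,
      Real.sq_sqrt hE.le]
  rw [h2, Real.sqrt_mul (by norm_num)]
  field_simp

lemma tendsto_cube (h : Regime a b t G u) :
    Tendsto (fun n => (∑ i, (deg (G n) i : ℝ) ^ 3) / √(degVar (G n)) ^ 3) atTop (𝓝 0) := by
  refine squeeze_zero' (Eventually.of_forall fun n => by positivity) ?_
    h.cube.tendsto_div_nhds_zero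
  filter_upwards [h.nonempty, h.eventually_degVar_pos] with n hG hV
  have hE : (0 : ℝ) < edgeCount (G n) := by exact_mod_cast hG
  have hm : 0 < √(min (edgeCount (G n) : ℝ) (degVar (G n))) := Real.sqrt_pos.2 (lt_min hE hV)
  have e : √(degVar (G n)) ^ 3 = degVar (G n) * √(degVar (G n)) := by
    rw [pow_succ, Real.sq_sqrt hV.le]
  rw [e]
  exact div_le_div_of_nonneg_left (Finset.sum_nonneg fun _ _ => by positivity) (mul_pos hV hm)
    (mul_le_mul_of_nonneg_left (Real.sqrt_le_sqrt (min_le_right _ _)) hV.le)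

/-- The graphs are sparse: `4|G|² ≤ N ∑ |G_i|²` by Cauchy-Schwarz, so `√|G| / N` is dominated by `∑
|G_i|² / |G|^{3/2}`. -/
lemma tendsto_sqrt_div_card (h : Regime a b t G u) :
    Tendsto (fun n => √(edgeCount (G n)) / ((b n + 1 - a n : ℕ) : ℝ)) atTop (𝓝 0) := by
  refine squeeze_zero' (Eventually.of_forall fun n => by positivity) ?_ h.tendsto_sq
  filter_upwards [h.nonempty, h.eventually_split] with n hG hn
  have hE : (0 : ℝ) < edgeCount (G n) := by exact_mod_cast hG
  have hs : 0 < √(edgeCount (G n) : ℝ) := Real.sqrt_pos.2 hE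
  have hN : (0 : ℝ) < ((b n + 1 - a n : ℕ) : ℝ) := by
    have : 0 < b n + 1 - a n := by omega
    exact_mod_cast this
  have h4 := four_mul_edgeCount_sq_le (G n)
  have h2 : (edgeCount (G n) : ℝ) ^ 2 = √(edgeCount (G n)) ^ 4 := by
    rw [show √(edgeCount (G n) : ℝ) ^ 4 = (√(edgeCount (G n)) ^ 2) ^ 2 by ring,
      Real.sq_sqrt hE.le]
  rw [div_le_div_iff₀ hN (by positivity)]
  rw [h2] at h4
  nlinarith [pow_pos hs 4]

lemma tendsto_var_frac (h : Regime a b t G u) :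
    Tendsto (fun n => frac (a n) (b n) (t n) * (1 - frac (a n) (b n) (t n))) atTop
      (𝓝 (u * (1 - u))) :=
  h.tendsto_frac.mul (tendsto_const_nhds.sub h.tendsto_frac)

lemma tendsto_inv_sqrt_card (h : Regime a b t G u) (c : ℝ) :
    Tendsto (fun n => c / √((b n + 1 - a n : ℕ) : ℝ)) atTop (𝓝 0) :=
  (Real.tendsto_sqrt_atTop.comp h.tendsto_card).const_div_atTop c

lemma tendsto_gap_zero (h : Regime a b t G u) :
    Tendsto (fun n => gap (frac (a n) (b n) (t n)) (firstTimes (a n) (b n)) (t n + 1 - a n)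
      (zstat (G n) (frac (a n) (b n) (t n)) 0)) atTop (𝓝 0) := by
  have hu : u * (1 - u) ≠ 0 := (mul_pos h.pos (sub_pos.2 h.lt_one)).ne'
  have lim : Tendsto (fun n => 2 / (frac (a n) (b n) (t n) * (1 - frac (a n) (b n) (t n))) /
      √((b n + 1 - a n : ℕ) : ℝ)) atTop (𝓝 0) := by
    have := ((tendsto_const_nhds (x := (2 : ℝ))).div h.tendsto_var_frac hu).mul
      (h.tendsto_inv_sqrt_card 1)
    rw [mul_zero] at this
    exact this.congr fun n => by rw [mul_one_div]; rfl
  refine squeeze_zero' ?_ ?_ lim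
  · filter_upwards [h.eventually_split] with n hn
    obtain ⟨h0, h1⟩ := frac_mem hn.1 hn.2.1
    exact gap_nonneg h0.le h1.le _ _
  · filter_upwards [h.eventually_split, h.eventually_degVar_pos] with n hn hV
    exact gap_zstat_zero_le (G n) hn.1 hn.2.1 hV

lemma tendsto_gap_one (h : Regime a b t G u) :
    Tendsto (fun n => gap (frac (a n) (b n) (t n)) (firstTimes (a n) (b n)) (t n + 1 - a n)
      (zstat (G n) (frac (a n) (b n) (t n)) 1)) atTop (𝓝 0) := by
  have hu : (u * (1 - u)) ^ 2 ≠ 0 := pow_ne_zero _ (mul_pos h.pos (sub_pos.2 h.lt_one)).ne'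
  have l1 : Tendsto (fun n => (edgeCount (G n) : ℝ) / ((b n + 1 - a n : ℕ) : ℝ) ^ 2) atTop
      (𝓝 0) := by
    have := h.tendsto_sqrt_div_card.pow 2
    rw [zero_pow two_ne_zero] at this
    exact this.congr fun n => by rw [div_pow, Real.sq_sqrt (Nat.cast_nonneg _)]
  have l2 : Tendsto (fun n => (∑ i, (deg (G n) i : ℝ) ^ 2) /
      (edgeCount (G n) * ((b n + 1 - a n : ℕ) : ℝ))) atTop (𝓝 0) := by
    have := h.tendsto_sq.mul h.tendsto_sqrt_div_card
    rw [mul_zero] at this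
    refine this.congr' ?_
    filter_upwards [h.nonempty] with n hG
    have hE : (0 : ℝ) < edgeCount (G n) := by exact_mod_cast hG
    have hs : 0 < √(edgeCount (G n) : ℝ) := Real.sqrt_pos.2 hE
    have e : √(edgeCount (G n) : ℝ) ^ 3 = edgeCount (G n) * √(edgeCount (G n)) := by
      rw [pow_succ, Real.sq_sqrt hE.le]
    rw [e, div_mul_div_comm, mul_right_comm _ √_, mul_div_mul_right _ _ hs.ne']
  have lim := ((tendsto_const_nhds (x := (1 : ℝ))).div (h.tendsto_var_frac.pow 2) hu).mul
    (((l1.const_mul 88).add (l2.const_mul 8)).add (h.tendsto_inv_sqrt_card 4))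
  simp only [mul_zero, add_zero] at lim
  refine squeeze_zero' ?_ ?_ lim
  · filter_upwards [h.eventually_split] with n hn
    obtain ⟨h0, h1⟩ := frac_mem hn.1 hn.2.1
    exact gap_nonneg h0.le h1.le _ _
  · filter_upwards [h.eventually_split, h.nonempty] with n hn hG
    exact gap_zstat_one_le (G n) hn.1 hn.2.1 hG hn.2.2

lemma tendsto_gap (h : Regime a b t G u) (j : Fin 2) :
    Tendsto (fun n => gap (frac (a n) (b n) (t n)) (firstTimes (a n) (b n)) (t n + 1 - a n)
      (zstat (G n) (frac (a n) (b n) (t n)) j)) atTop (𝓝 0) := by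
  fin_cases j
  · exact h.tendsto_gap_zero
  · exact h.tendsto_gap_one

/-- Joint asymptotic normality under independent selection. -/
lemma tendsto_charFun_bexp (h : Regime a b t G u) (α β : ℝ) :
    Tendsto (fun n => bexp (frac (a n) (b n) (t n)) (fun s => Complex.exp
      ((α * zstat (G n) (frac (a n) (b n) (t n)) 0 s +
        β * zstat (G n) (frac (a n) (b n) (t n)) 1 s : ℝ) * Complex.I))) atTop
      (𝓝 (Real.exp (-(α ^ 2 + β ^ 2) / 2) : ℝ)) := by
  have hu0 : 0 < u * (1 - u) := mul_pos h.pos (sub_pos.2 h.lt_one)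
  have hu : ∀ k, (u * (1 - u)) ^ k ≠ 0 := fun k => pow_ne_zero _ hu0.ne'
  have hsu : √(u * (1 - u)) ^ 3 ≠ 0 := pow_ne_zero _ (Real.sqrt_pos.2 hu0).ne'
  have d := h.tendsto_var_frac
  have lim := ((((((tendsto_const_nhds (x := 144 * α ^ 2 * β ^ 2)).div (d.pow 3) (hu 3)).mul
    h.sq_two.tendsto_div_nhds_zero).add
    (((tendsto_const_nhds (x := β ^ 4)).div (d.pow 4) (hu 4)).mul h.tendsto_sq_div_sq)).add
    (((tendsto_const_nhds (x := 2 * β ^ 4)).div (d.pow 4) (hu 4)).mul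
      h.tendsto_sqrt_mul_sq)).sqrt).add
    ((((tendsto_const_nhds (x := 96 * |α| ^ 3)).div (d.sqrt.pow 3) hsu).mul h.tendsto_cube).add
    (((tendsto_const_nhds (x := 42 * |β| ^ 3)).div (d.pow 3) (hu 3)).mul h.tendsto_sq))
  simp only [mul_zero, add_zero, Real.sqrt_zero] at lim
  rw [tendsto_iff_norm_sub_tendsto_zero]
  refine squeeze_zero' (Eventually.of_forall fun n => norm_nonneg _) ?_ lim
  filter_upwards [h.eventually_split, h.nonempty, h.eventually_degVar_pos] with n hn hG hV
  obtain ⟨h0, h1⟩ := frac_mem hn.1 hn.2.1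
  exact norm_charFun_zstat_sub_le (G n) (by omega) h0 h1 hG hV α β

end Regime

lemma abs_pexp_sub_le {V : Type*} [Fintype V] [DecidableEq V] {p : ℝ} {B : ℕ → Finset V}
    (h0 : 0 ≤ p) (h1 : p ≤ 1) (hB : ∀ k ≤ Fintype.card V, (B k).card = k) (k₀ : ℕ)
    (X : Finset V → ℝ) :
    |pexp (fun σ => X (pre σ (B k₀))) - bexp p X| ≤ √(gap p B k₀ X) := by
  rw [← jexp_pre p hB, ← jexp_perm p, ← jexp_sub, ← Real.norm_eq_abs]
  refine (norm_jexp_le h0 h1 _).trans (le_trans (le_of_eq ?_)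
    (jexp_abs_le_sqrt h0 h1 fun σ k => X (pre σ (B k)) - X (pre σ (B k₀))))
  refine congrArg (jexp p) (funext fun σ => funext fun k => ?_)
  rw [Real.norm_eq_abs, abs_sub_comm]

/-! ### `S` in terms of the statistics centred under the permutation law. -/

section PermStat

variable {a b : ℕ} (G : SimpleGraph (Seg a b)) (t : ℕ)

/-- The standardized statistics under the permutation distribution. -/
def pstat (j : Fin 2) (σ : Equiv.Perm (Seg a b)) : ℝ :=
  zstat G (frac a b t) j (pre σ (firstTimes a b (t + 1 - a)))

/-- The standardized statistics, centred under the permutation distribution. -/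
def cstat (j : Fin 2) (σ : Equiv.Perm (Seg a b)) : ℝ := pstat G t j σ - pexp (pstat G t j)

/-- The covariance matrix of the standardized statistics under the permutation distribution. -/
def cstatCov : Matrix (Fin 2) (Fin 2) ℝ :=
  Matrix.of fun j k => pexp fun ρ => cstat G t j ρ * cstat G t k ρ

lemma cstatCov_apply (j k : Fin 2) : cstatCov G t j k =
    pexp (fun ρ => pstat G t j ρ * pstat G t k ρ) - pexp (pstat G t j) * pexp (pstat G t k) := by
  have e : (fun ρ => cstat G t j ρ * cstat G t k ρ) = fun ρ =>
      ((pstat G t j ρ * pstat G t k ρ - pexp (pstat G t k) * pstat G t j ρ) -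
        pexp (pstat G t j) * pstat G t k ρ) + pexp (pstat G t j) * pexp (pstat G t k) := by
    funext ρ; unfold cstat; ring
  rw [cstatCov, Matrix.of_apply, e, pexp_add, pexp_sub, pexp_sub, pexp_mul_left, pexp_mul_left,
    pexp_const]
  ring

lemma S_eq_cstat (hat : a ≤ t) (htb : t < b) (hG : 0 < edgeCount G) (hV : 0 < degVar G)
    (σ : Equiv.Perm (Seg a b)) :
    S G t σ = ∑ j, ∑ k, (cstatCov G t)⁻¹ j k * (cstat G t j σ * cstat G t k σ) := by
  obtain ⟨κ, M, hM, h⟩ := exists_R_eq G hat htb hG hV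
  rw [S_eq_of_affine G hM (z := pstat G t) h σ]
  simp only [dotProduct, Matrix.mulVec, Finset.mul_sum]
  refine Finset.sum_congr rfl fun j _ => Finset.sum_congr rfl fun k _ => ?_
  change cstat G t j σ * ((cstatCov G t)⁻¹ j k * cstat G t k σ) = _
  ring

/-- `S` minus the sum of squares is the quadratic form with matrix `C⁻¹ - 1`, where `C = cstatCov G
t`. With `|xy| ≤ x² + y²` its mean is controlled by the diagonal of `C`. -/
lemma pexp_abs_S_sub_le (hat : a ≤ t) (htb : t < b) (hG : 0 < edgeCount G) (hV : 0 < degVar G) :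
    pexp (fun σ => |S G t σ - ∑ j, cstat G t j σ ^ 2|) ≤
      ∑ j, ∑ k, |((cstatCov G t)⁻¹ - 1) j k| * (cstatCov G t j j + cstatCov G t k k) := by
  have hb : ∀ σ, |S G t σ - ∑ j, cstat G t j σ ^ 2| ≤
      ∑ j, ∑ k, |((cstatCov G t)⁻¹ - 1) j k| * (cstat G t j σ * cstat G t j σ +
        cstat G t k σ * cstat G t k σ) := by
    intro σ
    have e : S G t σ - ∑ j, cstat G t j σ ^ 2 =
        ∑ j, ∑ k, ((cstatCov G t)⁻¹ - 1) j k * (cstat G t j σ * cstat G t k σ) := by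
      rw [S_eq_cstat G t hat htb hG hV]
      simp only [Matrix.sub_apply, sub_mul, Finset.sum_sub_distrib, Matrix.one_apply, ite_mul,
        one_mul, zero_mul, Finset.sum_ite_eq, Finset.mem_univ, if_true, sq]
    rw [e]
    refine (Finset.abs_sum_le_sum_abs _ _).trans (Finset.sum_le_sum fun j _ => ?_)
    refine (Finset.abs_sum_le_sum_abs _ _).trans (Finset.sum_le_sum fun k _ => ?_)
    rw [abs_mul]
    refine mul_le_mul_of_nonneg_left ?_ (abs_nonneg _)
    rw [abs_le]
    constructor <;> nlinarith [sq_nonneg (cstat G t j σ - cstat G t k σ),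
      sq_nonneg (cstat G t j σ + cstat G t k σ), sq_nonneg (cstat G t j σ),
      sq_nonneg (cstat G t k σ)]
  refine (pexp_mono hb).trans (le_of_eq ?_)
  simp only [pexp_sum, pexp_mul_left, pexp_add]
  rfl

end PermStat

/-! ### Limits under the permutation law. -/

namespace Regime

variable {a b t : ℕ → ℕ} {G : ∀ n, SimpleGraph (Seg (a n) (b n))} {u : ℝ}

lemma tendsto_pexp_pstat (h : Regime a b t G u) (j : Fin 2) :
    Tendsto (fun n => pexp (pstat (G n) (t n) j)) atTop (𝓝 0) := by
  have lim := (h.tendsto_gap j).sqrt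
  rw [Real.sqrt_zero] at lim
  refine squeeze_zero_norm' ?_ lim
  filter_upwards [h.eventually_split] with n hn
  obtain ⟨h0, h1⟩ := frac_mem hn.1 hn.2.1
  have := abs_pexp_sub_le h0.le h1.le (fun k hk => card_firstTimes hk) (t n + 1 - a n)
    (zstat (G n) (frac (a n) (b n) (t n)) j)
  rwa [bexp_zstat, sub_zero] at this

lemma tendsto_pexp_pstat_mul (h : Regime a b t G u) (j k : Fin 2) :
    Tendsto (fun n => pexp (fun σ => pstat (G n) (t n) j σ * pstat (G n) (t n) k σ)) atTop
      (𝓝 (if j = k then 1 else 0)) := by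
  have lj := (h.tendsto_gap j).sqrt
  have lk := (h.tendsto_gap k).sqrt
  rw [Real.sqrt_zero] at lj lk
  have lim := (lk.add lj).add (lj.mul lk)
  simp only [mul_zero, add_zero] at lim
  rw [tendsto_iff_norm_sub_tendsto_zero]
  refine squeeze_zero' (Eventually.of_forall fun n => norm_nonneg _) ?_ lim
  filter_upwards [h.eventually_split, h.nonempty, h.eventually_degVar_pos] with n hn hG hV
  obtain ⟨h0, h1⟩ := frac_mem hn.1 hn.2.1
  have hab : a n ≤ b n := by omega
  have := abs_pexp_mul_sub_le h0.le h1.le (fun k hk => card_firstTimes hk) (t n + 1 - a n)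
    (zstat (G n) (frac (a n) (b n) (t n)) j) (zstat (G n) (frac (a n) (b n) (t n)) k)
  simp only [pow_two] at this
  rw [bexp_zstat_mul (G n) hab h0 h1 hG hV, bexp_zstat_mul (G n) hab h0 h1 hG hV,
    bexp_zstat_mul (G n) hab h0 h1 hG hV, if_pos rfl, if_pos rfl, Real.sqrt_one, one_mul,
    mul_one] at this
  exact this

lemma tendsto_cstatCov (h : Regime a b t G u) :
    Tendsto (fun n => cstatCov (G n) (t n)) atTop (𝓝 1) := by
  refine tendsto_pi_nhds.2 fun j => tendsto_pi_nhds.2 fun k => ?_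
  simp only [cstatCov_apply]
  have := (h.tendsto_pexp_pstat_mul j k).sub ((h.tendsto_pexp_pstat j).mul (h.tendsto_pexp_pstat k))
  rw [mul_zero, sub_zero] at this
  rwa [Matrix.one_apply]

lemma tendsto_cstatCov_inv (h : Regime a b t G u) :
    Tendsto (fun n => (cstatCov (G n) (t n))⁻¹) atTop (𝓝 1) := by
  have hd : Tendsto (fun n => (cstatCov (G n) (t n)).det) atTop (𝓝 1) := by
    have := ((continuous_id.matrix_det (n := Fin 2) (R := ℝ)).tendsto 1).comp h.tendsto_cstatCov
    simpa [Function.comp_def] using this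
  have ha : Tendsto (fun n => (cstatCov (G n) (t n)).adjugate) atTop (𝓝 1) := by
    have := ((continuous_id.matrix_adjugate (n := Fin 2) (R := ℝ)).tendsto 1).comp
      h.tendsto_cstatCov
    simpa [Function.comp_def] using this
  have := (hd.inv₀ one_ne_zero).smul ha
  rw [inv_one, one_smul] at this
  -- The formula `C⁻¹ = (det C)⁻¹ • adjugate C` holds for every `n`, including singular `C`, where
  -- both sides are zero.
  refine this.congr fun n => ?_
  rw [Matrix.inv_def, Ring.inverse_eq_inv]

lemma tendsto_pexp_abs_S_sub (h : Regime a b t G u) :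
    Tendsto (fun n => pexp (fun σ => |S (G n) (t n) σ - ∑ j, cstat (G n) (t n) j σ ^ 2|)) atTop
      (𝓝 0) := by
  have entry : ∀ (M : ℕ → Matrix (Fin 2) (Fin 2) ℝ) (L : Matrix (Fin 2) (Fin 2) ℝ),
      Tendsto M atTop (𝓝 L) → ∀ j k, Tendsto (fun n => M n j k) atTop (𝓝 (L j k)) :=
    fun M L hM j k => tendsto_pi_nhds.1 (tendsto_pi_nhds.1 hM j) k
  have hI := h.tendsto_cstatCov_inv.sub (tendsto_const_nhds (x := (1 : Matrix (Fin 2) (Fin 2) ℝ)))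
  rw [sub_self] at hI
  have lim : Tendsto (fun n => ∑ j, ∑ k, |((cstatCov (G n) (t n))⁻¹ - 1) j k| *
      (cstatCov (G n) (t n) j j + cstatCov (G n) (t n) k k)) atTop (𝓝 0) := by
    rw [← Finset.sum_const_zero (s := (Finset.univ : Finset (Fin 2)))]
    refine tendsto_finsetSum _ fun j _ => ?_
    rw [← Finset.sum_const_zero (s := (Finset.univ : Finset (Fin 2)))]
    refine tendsto_finsetSum _ fun k _ => ?_
    have := (entry _ _ hI j k).abs.mul
      ((entry _ _ h.tendsto_cstatCov j j).add (entry _ _ h.tendsto_cstatCov k k))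
    simpa using this
  refine squeeze_zero' (Eventually.of_forall fun n => pexp_nonneg fun σ => abs_nonneg _) ?_ lim
  filter_upwards [h.eventually_split, h.nonempty, h.eventually_degVar_pos] with n hn hG hV
  exact pexp_abs_S_sub_le (G n) (t n) hn.1 hn.2.1 hG hV

/-- Joint asymptotic normality under the permutation distribution. -/
lemma tendsto_charFun_cstat (h : Regime a b t G u) (α β : ℝ) :
    Tendsto (fun n => pexp (fun σ => Complex.exp
      ((α * cstat (G n) (t n) 0 σ + β * cstat (G n) (t n) 1 σ : ℝ) * Complex.I))) atTop
      (𝓝 (Real.exp (-(α ^ 2 + β ^ 2) / 2) : ℝ)) := by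
  have l1 : Tendsto (fun n => pexp (fun σ => Complex.exp
      ((α * pstat (G n) (t n) 0 σ + β * pstat (G n) (t n) 1 σ : ℝ) * Complex.I))) atTop
      (𝓝 (Real.exp (-(α ^ 2 + β ^ 2) / 2) : ℝ)) := by
    refine (tendsto_iff_of_dist ?_).2 (h.tendsto_charFun_bexp α β)
    have lim := (((h.tendsto_gap 0).const_mul (2 * α ^ 2)).add
      ((h.tendsto_gap 1).const_mul (2 * β ^ 2))).sqrt
    simp only [mul_zero, add_zero, Real.sqrt_zero] at lim
    refine squeeze_zero' (Eventually.of_forall fun n => dist_nonneg) ?_ lim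
    filter_upwards [h.eventually_split] with n hn
    obtain ⟨h0, h1⟩ := frac_mem hn.1 hn.2.1
    rw [dist_eq_norm]
    refine (norm_charFun_pre_sub_le h0.le h1.le (fun k hk => card_firstTimes hk) (t n + 1 - a n)
      (fun s => α * zstat (G n) (frac (a n) (b n) (t n)) 0 s +
        β * zstat (G n) (frac (a n) (b n) (t n)) 1 s)).trans (Real.sqrt_le_sqrt ?_)
    refine (gap_add_le h0.le h1.le _ _ _).trans (le_of_eq ?_)
    rw [gap_const_mul, gap_const_mul]
    ring
  -- Centring multiplies the characteristic function by `exp(-i m_n)`, which tends to 1.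
  set m : ℕ → ℝ := fun n => α * pexp (pstat (G n) (t n) 0) + β * pexp (pstat (G n) (t n) 1) with hm
  have hm0 : Tendsto m atTop (𝓝 0) := by
    have := ((h.tendsto_pexp_pstat 0).const_mul α).add ((h.tendsto_pexp_pstat 1).const_mul β)
    simpa using this
  have l2 : Tendsto (fun n => Complex.exp ((-m n : ℝ) * Complex.I)) atTop (𝓝 1) := by
    have hc : Continuous fun x : ℝ => Complex.exp ((-x : ℝ) * Complex.I) := by fun_prop
    have := (hc.tendsto 0).comp hm0
    simpa [Function.comp_def] using this
  have l3 := l2.mul l1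
  rw [one_mul] at l3
  refine l3.congr fun n => ?_
  have : ∀ F : Equiv.Perm (Seg (a n) (b n)) → ℂ, ∀ c : ℂ, c * pexp F = pexp fun σ => c * F σ := by
    intro F c
    simp only [pexp, ← Finset.mul_sum, mul_smul_comm]
  rw [this]
  refine congrArg pexp (funext fun σ => ?_)
  rw [← Complex.exp_add]
  congr 1
  simp only [hm, cstat]
  push_cast
  ring

end Regime

/-! ### Chi-squared limits. -/

lemma integral_exp_chiSquared (k : ℕ) (s : ℝ) :
    charFun (chiSquared k) s =
      (∫ x, Complex.exp ((s * x ^ 2 : ℝ) * Complex.I) ∂(gaussianReal 0 1)) ^ k := by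
  rw [charFun_apply_real, chiSquared, integral_map (by exact Measurable.aemeasurable (by fun_prop))
    (by fun_prop)]
  have e : (fun x : Fin k → ℝ => Complex.exp (s * ((∑ i, x i ^ 2 : ℝ) : ℂ) * Complex.I)) =
      fun x => ∏ i, Complex.exp ((s * x i ^ 2 : ℝ) * Complex.I) := by
    funext x
    rw [← Complex.exp_sum]
    congr 1
    push_cast
    rw [Finset.mul_sum, Finset.sum_mul]
  rw [e, integral_fintype_prod_eq_prod (fun _ : Fin k => fun y : ℝ =>
    Complex.exp ((s * y ^ 2 : ℝ) * Complex.I))]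
  simp

/-- The link from Gaussian vectors to `chiSquared`: both integrals are taken over the same product
of standard normals. -/
lemma integral_exp_stdGaussian (k : ℕ) (s : ℝ) :
    ∫ x : EuclideanSpace ℝ (Fin k), Complex.exp ((s * ∑ j, x j ^ 2 : ℝ) * Complex.I)
      ∂(stdGaussian (EuclideanSpace ℝ (Fin k))) = charFun (chiSquared k) s := by
  rw [← map_pi_eq_stdGaussian, integral_map (by exact Measurable.aemeasurable (by fun_prop))
    (by fun_prop), charFun_apply_real, chiSquared,
    integral_map (by exact Measurable.aemeasurable (by fun_prop)) (by fun_prop)]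
  refine integral_congr_ae (Eventually.of_forall fun x => ?_)
  simp

lemma measurable_perm {a b : ℕ} {β : Type*} [MeasurableSpace β]
    (f : Equiv.Perm (Seg a b) → β) : Measurable f := fun _ _ => trivial

namespace Regime

variable {a b t : ℕ → ℕ} {G : ∀ n, SimpleGraph (Seg (a n) (b n))} {u : ℝ}

lemma tendsto_pexp_exp_sum_sq (h : Regime a b t G u) (s : ℝ) :
    Tendsto (fun n => pexp (fun σ => Complex.exp
      ((s * ∑ j, cstat (G n) (t n) j σ ^ 2 : ℝ) * Complex.I))) atTop
      (𝓝 (charFun (chiSquared 2) s)) := by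
  set y : ∀ n, Equiv.Perm (Seg (a n) (b n)) → EuclideanSpace ℝ (Fin 2) := fun n σ =>
    WithLp.toLp 2 (fun j => cstat (G n) (t n) j σ) with hy
  have hmeas : ∀ n, AEMeasurable (y n) (permNull (a n) (b n)) := fun n =>
    (measurable_perm (y n)).aemeasurable
  set ν : ℕ → ProbabilityMeasure (EuclideanSpace ℝ (Fin 2)) := fun n =>
    ⟨(permNull (a n) (b n)).map (y n), Measure.isProbabilityMeasure_map (hmeas n)⟩ with hν
  have hint : ∀ n (f : EuclideanSpace ℝ (Fin 2) → ℂ), Continuous f →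
      ∫ x, f x ∂(ν n : Measure (EuclideanSpace ℝ (Fin 2))) = pexp (fun σ => f (y n σ)) := by
    intro n f hf
    rw [← integral_permNull]
    exact integral_map (hmeas n) hf.aestronglyMeasurable
  have hconv : Tendsto ν atTop
      (𝓝 ⟨stdGaussian (EuclideanSpace ℝ (Fin 2)), isProbabilityMeasure_stdGaussian⟩) := by
    refine ProbabilityMeasure.tendsto_iff_tendsto_charFun.2 fun θ => ?_
    have h1 := h.tendsto_charFun_cstat (θ 0) (θ 1)
    have e1 : charFun (stdGaussian (EuclideanSpace ℝ (Fin 2))) θ =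
        (Real.exp (-(θ 0 ^ 2 + θ 1 ^ 2) / 2) : ℝ) := by
      rw [charFun_stdGaussian, ← Complex.ofReal_pow, EuclideanSpace.norm_sq_eq]
      simp
    change Tendsto _ _ (𝓝 (charFun (stdGaussian (EuclideanSpace ℝ (Fin 2))) θ))
    rw [e1]
    refine h1.congr fun n => ?_
    rw [charFun_apply, hint n _ (by fun_prop)]
    refine congrArg pexp (funext fun σ => ?_)
    congr 2
    simp [hy, PiLp.inner_apply, Fin.sum_univ_two, mul_comm]
  have hf : Continuous fun x : EuclideanSpace ℝ (Fin 2) =>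
      Complex.exp ((s * ∑ j, x j ^ 2 : ℝ) * Complex.I) := by fun_prop
  -- Weak convergence in the plane is tested on the bounded continuous function `x ↦ exp(i s |x|²)`.
  have key := (ProbabilityMeasure.tendsto_iff_forall_integral_rclike_tendsto ℂ).1 hconv
    (BoundedContinuousFunction.ofNormedAddCommGroup _ hf 1
      fun x => (Complex.norm_exp_ofReal_mul_I _).le)
  simp only [BoundedContinuousFunction.coe_ofNormedAddCommGroup] at key
  rw [← integral_exp_stdGaussian]
  refine key.congr fun n => ?_
  exact hint n _ hf

/-- The characteristic function of the edge-count statistic of one interval. -/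
lemma tendsto_charFun_S (h : Regime a b t G u) (s : ℝ) :
    Tendsto (fun n => ∫ σ, Complex.exp ((s * S (G n) (t n) σ : ℝ) * Complex.I)
      ∂(permNull (a n) (b n))) atTop (𝓝 (charFun (chiSquared 2) s)) := by
  simp only [integral_permNull]
  refine (tendsto_iff_of_dist ?_).2 (h.tendsto_pexp_exp_sum_sq s)
  have lim := h.tendsto_pexp_abs_S_sub.const_mul |s|
  rw [mul_zero] at lim
  refine squeeze_zero (fun n => dist_nonneg) (fun n => ?_) lim
  rw [dist_eq_norm, ← pexp_sub, ← pexp_mul_left]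
  refine (norm_pexp_le _).trans (pexp_mono fun σ => ?_)
  set x := S (G n) (t n) σ
  set y := ∑ j, cstat (G n) (t n) j σ ^ 2
  have e : Complex.exp ((s * x : ℝ) * Complex.I) - Complex.exp ((s * y : ℝ) * Complex.I) =
      Complex.exp ((s * y : ℝ) * Complex.I) *
        (Complex.exp ((s * (x - y) : ℝ) * Complex.I) - 1) := by
    rw [mul_sub, ← Complex.exp_add, mul_one]
    congr 2; push_cast; ring
  rw [e, norm_mul, Complex.norm_exp_ofReal_mul_I, one_mul, ← abs_mul]
  exact norm_exp_mul_I_sub_one_le _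

end Regime

/-- The sum of the edge-count statistics of finitely many intervals that are permuted
independently. -/
theorem tendstoInDistribution_sumS {m : ℕ} {a b t : ℕ → Fin m → ℕ}
    {G : ∀ n j, SimpleGraph (Seg (a n j) (b n j))} {u : Fin m → ℝ}
    (h : ∀ j, Regime (fun n => a n j) (fun n => b n j) (fun n => t n j) (fun n => G n j) (u j)) :
    TendstoInDistribution (fun n => sumS (t n) (G n)) atTop (id : ℝ → ℝ)
      (fun n => permNulls (a n) (b n)) (chiSquared (2 * m)) := by
  have hmeas : ∀ n, Measurable (sumS (t n) (G n)) := fun n =>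
    Finset.measurable_sum _ fun j _ => (measurable_perm (S (G n j) (t n j))).comp
      (measurable_pi_apply j)
  refine ⟨fun n => (hmeas n).aemeasurable, aemeasurable_id, ?_⟩
  refine ProbabilityMeasure.tendsto_iff_tendsto_charFun.2 fun s => ?_
  simp only [ProbabilityMeasure.coe_mk, Measure.map_id]
  have hprod := tendsto_finsetProd (Finset.univ : Finset (Fin m))
    fun j _ => (h j).tendsto_charFun_S s
  -- Both sides are powers of the characteristic function of one squared standard normal; no closed
  -- form is needed.
  have e : charFun (chiSquared (2 * m)) s = ∏ _j : Fin m, charFun (chiSquared 2) s := by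
    rw [integral_exp_chiSquared, integral_exp_chiSquared, Finset.prod_const, Finset.card_univ,
      Fintype.card_fin, pow_mul]
  rw [e]
  refine hprod.congr fun n => ?_
  rw [charFun_apply_real, integral_map (hmeas n).aemeasurable (by fun_prop),
    ← integral_fintype_prod_eq_prod]
  refine integral_congr_ae (Eventually.of_forall fun σ => ?_)
  simp only [sumS]
  rw [← Complex.exp_sum]
  congr 1
  push_cast
  rw [Finset.mul_sum, Finset.sum_mul]

end GraphCP

end

open GraphCP in
theorem theorem1 :
    (∀ (m : ℕ) (a b t : ℕ → Fin m → ℕ)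
        (G : ∀ n j, SimpleGraph (Seg (a n j) (b n j))) (u : Fin m → ℝ),
      (∀ n, Pairwise fun j k => Disjoint (Finset.Icc (a n j) (b n j)) (Finset.Icc (a n k) (b n k))) →
      (∀ n j, t n j ∈ Finset.Icc (a n j) (b n j)) →
      (∀ j, Regime (fun n => a n j) (fun n => b n j) (fun n => t n j) (fun n => G n j) (u j)) →
      TendstoInDistribution (fun n => sumS (t n) (G n)) atTop (id : ℝ → ℝ)
        (fun n => permNulls (a n) (b n)) (chiSquared (2 * m))) ∧
    (∀ (m : ℕ) (N : ℕ → ℕ) (τ : ℕ → Fin m → ℕ)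
        (G : ∀ n j, SimpleGraph (Seg (left (N n) (τ n) j) (right (N n) (τ n) j))) (u : Fin m → ℝ),
      (∀ n, StrictMono (τ n)) →
      (∀ n j, 1 ≤ τ n j ∧ τ n j + 1 ≤ N n) →
      (∀ j, Regime (fun n => left (N n) (τ n) j) (fun n => right (N n) (τ n) j)
        (fun n => τ n j) (fun n => G n j) (u j)) →
      TendstoInDistribution (fun n => AS (N n) (τ n) (G n)) atTop (id : ℝ → ℝ)
        (fun n => permNulls (left (N n) (τ n)) (right (N n) (τ n))) (chiSquared (2 * m))) :=
  -- `AS` is by definition `sumS` on the intervals cut out by `left` and `right`, so one theorem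
  -- proves both parts.
  ⟨fun _ _ _ _ _ _ _ _ h => tendstoInDistribution_sumS h,
    fun _ _ _ _ _ _ _ h => tendstoInDistribution_sumS h⟩
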